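/- Let $\mathcal D$ be a unital complex $*$-algebra with a tracial state $\psi$ (linear, $\psi(1)=1$, $\psi(a^*a)\ge 0$, $\psi(ab)=\psi(ba)$), let $(d_i)_{i\in I}$ be elements of $\mathcal D$, and for every $N$ let $D_i^{(N)}$ $(i\in I)$ be non-random complex $N\times N$ matrices. Assume that they converge in distribution to $(d_i)$ in $(\mathcal D,\psi)$, i.e. $\lim_{N}\frac1N\mathrm{Tr}[D^{(N)}_{i_1}\cdots D^{(N)}_{i_k}]=\psi(d_{i_1}\cdots d_{i_k})$ for all $i_1,\dots,i_k\in I$. Let $X_N$ be an $N\times N$ complex Gaussian random matrix: its entries are independent centered circular complex Gaussians of variance $1/N$ (real and imaginary parts independent, each of variance $1/(2N)$). Put $P_N(D_i):=X_N^*D_i^{(N)}X_N$, and $\mathrm k_2\{Y,Z\}:=\mathrm E\{YZ\}-\mathrm E\{Y\}\mathrm E\{Z\}$. *Fock spaces.* Let $\langle a,b\rangle:=\psi(b^*a)$ on $\mathcal D$. On the algebraic linear Fock space $\mathcal F_{\rm lin}(\mathcal D)=\mathbb C\Omega\oplus\bigoplus_{n\ge1}\mathcal D^{\otimes n}$ let,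 for $d\in\mathcal D$, $$l(d)\,f_1\otimes\cdots\otimes f_n=d\otimes f_1\otimes\cdots\otimes f_n,\qquad l(d)\Omega=d,$$ $$l^*(d)\,f_1\otimes\cdots\otimes f_n=\langle f_1,d\rangle f_2\otimes\cdots\otimes f_n,\qquad l^*(d)\Omega=0,$$ $$\Lambda(d)\,f_1\otimes\cdots\otimes f_n=(df_1)\otimes f_2\otimes\cdots\otimes f_n,\qquad \Lambda(d)\Omega=0,$$ and $p(d)=l(d)+l^*(d^*)+\Lambda(d)+\psi(d)1$. The algebraic cyclic Fock space $\mathcal F_{\rm cyc}(\mathcal D)$ is the direct sum of the spaces of circular tensors $[f_1\otimes\cdots\otimes f_n]$ (tensors modulo cyclic rotation), with the sesquilinear form $$\langle[f_1\otimes\cdots\otimes f_n],[g_1\otimes\cdots\otimes g_m]\rangle_{\rm cyc}=\delta_{nm}\sum_{k=0}^{n-1}\langle f_1,g_{1+k}\rangle\cdots\langle f_n,g_{n+k}\rangle$$ for $n,m\ge 1$ (indices of $g$ modulo $n$), linear in the first and conjugate-linear in the second argument. The linear map $\mathbf c:\mathcal F_{\rm lin}(\mathcal D)\to\mathcal F_{\rm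 cyc}(\mathcal D)$ is given recursively by $\mathbf c\,\Omega=0$, $\mathbf c(f)=[f]$ and, for $n\ge 2$, $$\mathbf c(f_1\otimes\cdots\otimes f_n)=[f_1\otimes\cdots\otimes f_n]+[f_nf_1\otimes f_2\otimes\cdots\otimes f_{n-1}]+\psi(f_1f_n)\,\mathbf c(f_2\otimes\cdots\otimes f_{n-1}),$$ where $f_2\otimes\cdots\otimes f_{n-1}$ is $\Omega$ for $n=2$. *Annular non-crossing permutations.* $S_{NC}(n,m)$ is the set of permutations $\pi$ of $\{1,\dots,n+m\}$ such that some cycle of $\pi$ meets both $\{1,\dots,n\}$ and $\{n+1,\dots,n+m\}$, and $\#(\pi)+\#(\pi^{-1}\gamma)=n+m$, where $\gamma=(1,\dots,n)(n+1,\dots,n+m)$ and $\#$ is the number of cycles, fixed points included. For a permutation $\pi$, $\psi_\pi(a_1,\dots,a_{n+m})$ is the product of the numbers $\psi(a_{r_1}\cdots a_{r_l})$ over all cycles $(r_1,\dots,r_l)$ of $\pi$. **Theorem.** For all $n,m$ and all indices $i_1,\dots,i_{n+m}\in I$, the random variables $\mathrm{Tr}[P_N(D_{i_1})\cdots P_N(D_{i_n})]$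 and $\mathrm{Tr}[P_N(D_{i_{n+1}})\cdots P_N(D_{i_{n+m}})]$ are square integrable, and the following hold. (1) $$\lim_{N\to\infty}\mathrm k_2\bigl\{\mathrm{Tr}[P_N(D_{i_1})\cdots P_N(D_{i_n})],\ \mathrm{Tr}[P_N(D_{i_{n+1}})\cdots P_N(D_{i_{n+m}})]\bigr\}$$ $$=\bigl\langle\mathbf c\,p(d_{i_1})\cdots p(d_{i_n})\Omega,\ \mathbf c\,p(d_{i_{n+m}}^*)\cdots p(d_{i_{n+1}}^*)\Omega\bigr\rangle_{\rm cyc}=\sum_{\pi\in S_{NC}(n,m)}\psi_\pi(d_{i_1},\dots,d_{i_{n+m}}).$$ (2) If the $D_i^{(N)}$ converge to $(d_i)$ even in $*$-distribution (that is, the family of all $D_i^{(N)}$ and $(D_i^{(N)})^*$ converges in distribution to the family of all $d_i$ and $d_i^*$), then $$\lim_{N\to\infty}\mathrm k_2\bigl\{\mathrm{Tr}[P_N(D_{i_1})\cdots P_N(D_{i_n})],\ \overline{\mathrm{Tr}[P_N(D_{i_{n+1}})\cdots P_N(D_{i_{n+m}})]}\bigr\}=\bigl\langle\mathbf c\,p(d_{i_1})\cdots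 p(d_{i_n})\Omega,\ \mathbf c\,p(d_{i_{n+1}})\cdots p(d_{i_{n+m}})\Omega\bigr\rangle_{\rm cyc}.$$ Whether or not they converge in $*$-distribution, the last inner product equals $\sum_{\pi\in S_{NC}(n,m)}\psi_\pi(d_{i_1},\dots,d_{i_n},d_{i_{n+m}}^*,\dots,d_{i_{n+1}}^*)$. -/

import Mathlib

open MeasureTheory ProbabilityTheory Filter Topology
open scoped NNReal ComplexConjugate DirectSum TensorProduct

noncomputable section

namespace CompoundWishart

/-! ### Compound Wishart matrices -/

section Probability

variable {Ω : Type*} [MeasurableSpace Ω]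

/-- `X` is a random `N × N` complex Gaussian matrix: its entries are independent centered
(circular) complex Gaussians with variance `1 / N`, that is, the real and imaginary parts of all
entries form an independent family of real centered Gaussians with variance `1 / (2 N)`. -/
structure IsComplexGaussian {N : ℕ} (X : Ω → Matrix (Fin N) (Fin N) ℂ) (P : Measure Ω) : Prop where
  indep : iIndepFun (fun (e : (Fin N × Fin N) × Bool) (ω : Ω) =>
    if e.2 then (X ω e.1.1 e.1.2).re else (X ω e.1.1 e.1.2).im) P
  law_re : ∀ i j, HasLaw (fun ω => (X ω i j).re) (gaussianReal 0 (1 / (2 * (N : ℝ≥0)))) P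
  law_im : ∀ i j, HasLaw (fun ω => (X ω i j).im) (gaussianReal 0 (1 / (2 * (N : ℝ≥0)))) P

/-- The second classical cumulant `k₂{Y, Z} = E{Y Z} - E{Y} E{Z}` (bilinear, no conjugation). -/
def k₂ (P : Measure Ω) (Y Z : Ω → ℂ) : ℂ :=
  (∫ ω, Y ω * Z ω ∂P) - (∫ ω, Y ω ∂P) * ∫ ω, Z ω ∂P

end Probability

/-- The compound Wishart matrix `P(A) = X⋆ A X`. -/
def wishart {N : ℕ} (X A : Matrix (Fin N) (Fin N) ℂ) : Matrix (Fin N) (Fin N) ℂ :=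
  X.conjTranspose * A * X

/-- The unnormalized trace `Tr[P(A₁) ⋯ P(Aₙ)]`. -/
def traceWishart {N n : ℕ} (X : Matrix (Fin N) (Fin N) ℂ)
    (A : Fin n → Matrix (Fin N) (Fin N) ℂ) : ℂ :=
  (List.ofFn fun k => wishart X (A k)).prod.trace

/-! ### Convergence in distribution -/

section Algebra

variable {D : Type*} [Ring D] [StarRing D] [Algebra ℂ D] [StarModule ℂ D]

/-- `ψ` is a tracial state on the unital complex `*`-algebra `D`. -/
structure IsTracialState (ψ : D →ₗ[ℂ] ℂ) : Prop where
  map_one : ψ 1 = 1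
  nonneg : ∀ a, 0 ≤ (ψ (star a * a)).re ∧ (ψ (star a * a)).im = 0
  tracial : ∀ a b, ψ (a * b) = ψ (b * a)

/-- The family of matrices `A N i` converges in distribution to the family `d i` in `(D, ψ)`:
`tr[A_{i₁} ⋯ A_{iₖ}] → ψ(d_{i₁} ⋯ d_{iₖ})` for all words, `tr` being the normalized trace. -/
def ConvergesInDistribution {ι : Type*} (A : ∀ N : ℕ, ι → Matrix (Fin N) (Fin N) ℂ)
    (ψ : D →ₗ[ℂ] ℂ) (d : ι → D) : Prop :=
  ∀ w : List ι, Tendsto (fun N : ℕ => (1 / (N : ℂ)) * (w.map (A N)).prod.trace) atTop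
    (𝓝 (ψ (w.map d).prod))

/-- Convergence in `*`-distribution: the family of the `A N i` together with their adjoints
converges in distribution to the family of the `d i` together with their adjoints. -/
def ConvergesInStarDistribution {ι : Type*} (A : ∀ N : ℕ, ι → Matrix (Fin N) (Fin N) ℂ)
    (ψ : D →ₗ[ℂ] ℂ) (d : ι → D) : Prop :=
  ConvergesInDistribution (fun N => Sum.elim (A N) fun i => (A N i).conjTranspose) ψ
    (Sum.elim d fun i => star (d i))

end Algebra

/-! ### Annular non-crossing permutations -/

section Permutations

/-- The number of cycles of a permutation, fixed points included. -/
def numCycles {α : Type*} (π : Equiv.Perm α) : ℕ :=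
  Nat.card (Quotient (Equiv.Perm.SameCycle.setoid π))

/-- The permutation `(1, …, n)(n + 1, …, n + m)`; the two circles are `Fin n` and `Fin m`. -/
def annularRotation (n m : ℕ) : Equiv.Perm (Fin n ⊕ Fin m) :=
  Equiv.sumCongr (finRotate n) (finRotate m)

/-- Annular non-crossing permutations: at least one cycle connects the two circles, and the
geodesic condition `#(π) + #(π⁻¹ γ) = n + m` holds. -/
def IsAnnularNC {n m : ℕ} (π : Equiv.Perm (Fin n ⊕ Fin m)) : Prop :=
  (∃ i j, π.SameCycle (Sum.inl i) (Sum.inr j)) ∧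
    numCycles π + numCycles (π⁻¹ * annularRotation n m) = n + m

open Classical in
/-- The set `S_NC(n, m)` of annular non-crossing permutations. -/
def SNC (n m : ℕ) : Finset (Equiv.Perm (Fin n ⊕ Fin m)) :=
  Finset.univ.filter IsAnnularNC

open Classical in
/-- `ψ_π(a) = ∏ ψ(a_{r₁} ⋯ a_{rₗ})`, the product over the cycles `(r₁, …, rₗ)` of `π`, fixed
points included. For tracial `ψ` the starting point of each cycle is immaterial. -/
def permFunctional {D : Type*} [Ring D] [Algebra ℂ D] (ψ : D →ₗ[ℂ] ℂ) {α : Type*} [Fintype α]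
    (π : Equiv.Perm α) (a : α → D) : ℂ :=
  ∏ c : Quotient (Equiv.Perm.SameCycle.setoid π),
    ψ ((List.range (Function.minimalPeriod π c.out)).map fun k => a ((π ^ k) c.out)).prod

end Permutations

/-! ### The linear Fock space and the operators `p(d)` -/

section Linear

variable {D : Type*} [Ring D] [Algebra ℂ D]

variable (D) in
/-- The space `D^{⊗n}`. -/
abbrev Tens (n : ℕ) : Type _ := PiTensorProduct ℂ fun _ : Fin n => D

variable (D) in
/-- The algebraic linear (full) Fock space `⨁ₙ D^{⊗n}`. -/
abbrev FockLin : Type _ := ⨁ n : ℕ, Tens D n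

variable (D) in
/-- The vacuum vector `Ω`. -/
def vacuum : FockLin D :=
  DirectSum.lof ℂ ℕ (Tens D) 0 (PiTensorProduct.tprod ℂ Fin.elim0)

/-- `f₁ ⊗ ⋯ ⊗ fₙ ↦ d ⊗ f₁ ⊗ ⋯ ⊗ fₙ`. -/
def createTens (d : D) (n : ℕ) : Tens D n →ₗ[ℂ] Tens D (n + 1) :=
  PiTensorProduct.lift <| MultilinearMap.mk'
    (fun f => PiTensorProduct.tprod ℂ (Fin.cons d f : Fin (n + 1) → D))
    (by intro f i x y; simp only [Fin.cons_update, MultilinearMap.map_update_add])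
    (by intro f i c x; simp only [Fin.cons_update, MultilinearMap.map_update_smul])

/-- `f₁ ⊗ f₂ ⊗ ⋯ ⊗ fₙ₊₁ ↦ φ(f₁) f₂ ⊗ ⋯ ⊗ fₙ₊₁` for a linear functional `φ`. -/
def annihilateTens (φ : D →ₗ[ℂ] ℂ) (n : ℕ) : Tens D (n + 1) →ₗ[ℂ] Tens D n :=
  PiTensorProduct.lift <| MultilinearMap.mk'
    (fun f => φ (f 0) • PiTensorProduct.tprod ℂ (fun i : Fin n => f i.succ))
    (by
      intro f i x y
      cases i using Fin.cases with
      | zero => simp [add_smul]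
      | succ i =>
        have h (z : D) : (fun j : Fin n => Function.update f i.succ z j.succ) =
            Function.update (fun j : Fin n => f j.succ) i z := Fin.tail_update_succ f i z
        simp only [h, MultilinearMap.map_update_add,
          Function.update_of_ne (Fin.succ_ne_zero i).symm, smul_add])
    (by
      intro f i c x
      cases i using Fin.cases with
      | zero => simp [mul_smul]
      | succ i =>
        have h (z : D) : (fun j : Fin n => Function.update f i.succ z j.succ) =
            Function.update (fun j : Fin n => f j.succ) i z := Fin.tail_update_succ f i z
        simp only [h, MultilinearMap.map_update_smul,
          Function.update_of_ne (Fin.succ_ne_zero i).symm]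
        rw [smul_comm])

/-- `f₁ ⊗ f₂ ⊗ ⋯ ⊗ fₙ ↦ (d f₁) ⊗ f₂ ⊗ ⋯ ⊗ fₙ`, and `0` on `D^{⊗0}`. -/
def gaugeTens (d : D) : ∀ n : ℕ, Tens D n →ₗ[ℂ] Tens D n
  | 0 => 0
  | _ + 1 => PiTensorProduct.map fun i => if i = 0 then LinearMap.mulLeft ℂ d else LinearMap.id

/-- The creation operator `l(d)`. -/
def creation (d : D) : Module.End ℂ (FockLin D) :=
  DirectSum.toModule ℂ ℕ _ fun n => DirectSum.lof ℂ ℕ (Tens D) (n + 1) ∘ₗ createTens d n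

/-- The preservation (gauge) operator `Λ(d)`. -/
def gauge (d : D) : Module.End ℂ (FockLin D) :=
  DirectSum.toModule ℂ ℕ _ fun n => DirectSum.lof ℂ ℕ (Tens D) n ∘ₗ gaugeTens d n

variable [StarRing D]

/-- The annihilation operator `l*(d)`, given by `l*(d) Ω = 0` and
`l*(d) f₁ ⊗ ⋯ ⊗ fₙ = ⟨f₁, d⟩ f₂ ⊗ ⋯ ⊗ fₙ`, where `⟨f, d⟩ = ψ(d* f)`. -/
def annihilation (ψ : D →ₗ[ℂ] ℂ) (d : D) : Module.End ℂ (FockLin D) :=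
  DirectSum.toModule ℂ ℕ _ fun n => match n with
    | 0 => 0
    | n + 1 => DirectSum.lof ℂ ℕ (Tens D) n ∘ₗ
        annihilateTens (ψ ∘ₗ LinearMap.mulLeft ℂ (star d)) n

/-- The operator `p(d) = l(d) + l*(d*) + Λ(d) + ψ(d) 1`. -/
def poisson (ψ : D →ₗ[ℂ] ℂ) (d : D) : Module.End ℂ (FockLin D) :=
  creation d + annihilation ψ (star d) + gauge d + ψ d • 1

/-- The vector `p(a₁) ⋯ p(aₙ) Ω`. -/
def poissonVector (ψ : D →ₗ[ℂ] ℂ) {n : ℕ} (a : Fin n → D) : FockLin D :=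
  (List.ofFn fun k => poisson ψ (a k)).prod (vacuum D)

end Linear

/-! ### The cyclic Fock space -/

section Cyclic

variable {D : Type*} [Ring D] [Algebra ℂ D]

variable (D) in
/-- The rotation `f₁ ⊗ f₂ ⊗ ⋯ ⊗ fₙ ↦ f₂ ⊗ ⋯ ⊗ fₙ ⊗ f₁`. -/
def rotTens (n : ℕ) : Tens D n →ₗ[ℂ] Tens D n :=
  (PiTensorProduct.reindex ℂ (fun _ : Fin n => D) (finRotate n).symm).toLinearMap

@[simp]
theorem rotTens_tprod (n : ℕ) (f : Fin n → D) :
    rotTens D n (PiTensorProduct.tprod ℂ f) =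
      PiTensorProduct.tprod ℂ fun i => f (finRotate n i) := by
  simp [rotTens, PiTensorProduct.reindex_tprod]

theorem tprod_cons_add {n : ℕ} (x y : D) (f : Fin n → D) :
    PiTensorProduct.tprod ℂ (Fin.cons (x + y) f : Fin (n + 1) → D) =
      PiTensorProduct.tprod ℂ (Fin.cons x f : Fin (n + 1) → D) +
        PiTensorProduct.tprod ℂ (Fin.cons y f : Fin (n + 1) → D) := by
  simpa [Fin.update_cons_zero] using
    (PiTensorProduct.tprod ℂ (s := fun _ : Fin (n + 1) => D)).map_update_add (Fin.cons 0 f) 0 x y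

theorem tprod_cons_smul {n : ℕ} (c : ℂ) (x : D) (f : Fin n → D) :
    PiTensorProduct.tprod ℂ (Fin.cons (c • x) f : Fin (n + 1) → D) =
      c • PiTensorProduct.tprod ℂ (Fin.cons x f : Fin (n + 1) → D) := by
  simpa [Fin.update_cons_zero] using
    (PiTensorProduct.tprod ℂ (s := fun _ : Fin (n + 1) => D)).map_update_smul (Fin.cons 0 f) 0 c x

variable (D) in
/-- The space of circular tensors `[f₁ ⊗ ⋯ ⊗ fₙ]`: the quotient of `D^{⊗n}` by rotations. -/
abbrev CycTens (n : ℕ) : Type _ :=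
  Tens D n ⧸ LinearMap.range (rotTens D n - LinearMap.id)

variable (D) in
/-- The algebraic cyclic Fock space. -/
abbrev FockCyc : Type _ := ⨁ n : ℕ, CycTens D n

variable (D) in
/-- `f₁ ⊗ ⋯ ⊗ fₙ ↦ [f₁ ⊗ ⋯ ⊗ fₙ]`, as a map into the cyclic Fock space. -/
def circular (n : ℕ) : Tens D n →ₗ[ℂ] FockCyc D :=
  DirectSum.lof ℂ ℕ (CycTens D) n ∘ₗ Submodule.mkQ _

/-- An index in `Fin (n + 2)` is the first one, the last one, or an inner one. -/
theorem fin_ends {n : ℕ} (i : Fin (n + 2)) :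
    i = 0 ∨ i = Fin.last (n + 1) ∨ ∃ j : Fin n, i = j.castSucc.succ := by
  cases i using Fin.cases with
  | zero => exact Or.inl rfl
  | succ i =>
    cases i using Fin.lastCases with
    | last => exact Or.inr (Or.inl rfl)
    | cast j => exact Or.inr (Or.inr ⟨j, rfl⟩)

/-- The inner part of a tuple `f₁, f₂, …, fₙ₊₁, fₙ₊₂`. -/
def innerPart {α : Type*} {n : ℕ} (f : Fin (n + 2) → α) : Fin n → α :=
  fun i => f i.castSucc.succ

theorem innerPart_update_zero {α : Type*} {n : ℕ} (f : Fin (n + 2) → α) (z : α) :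
    innerPart (Function.update f 0 z) = innerPart f := by
  funext j; simp [innerPart]

theorem innerPart_update_last {α : Type*} {n : ℕ} (f : Fin (n + 2) → α) (z : α) :
    innerPart (Function.update f (Fin.last (n + 1)) z) = innerPart f := by
  funext j
  have h : j.castSucc.succ ≠ Fin.last (n + 1) := by
    rw [← Fin.succ_last]; exact fun h => (Fin.castSucc_lt_last j).ne (Fin.succ_injective _ h)
  simp [innerPart]

theorem innerPart_update {α : Type*} {n : ℕ} (f : Fin (n + 2) → α) (i : Fin n) (z : α) :
    innerPart (Function.update f i.castSucc.succ z) = Function.update (innerPart f) i z := by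
  funext j
  by_cases h : j = i
  · subst h; simp [innerPart]
  · have h' : j.castSucc.succ ≠ i.castSucc.succ := by simpa using h
    simp [innerPart, Function.update_of_ne h, Function.update_of_ne h']

theorem update_innerPart_zero {α : Type*} {n : ℕ} (f : Fin (n + 2) → α) (i : Fin n) (z : α) :
    Function.update f i.castSucc.succ z 0 = f 0 :=
  Function.update_of_ne (Fin.succ_ne_zero _).symm _ _

theorem update_innerPart_last {α : Type*} {n : ℕ} (f : Fin (n + 2) → α) (i : Fin n) (z : α) :
    Function.update f i.castSucc.succ z (Fin.last (n + 1)) = f (Fin.last (n + 1)) := by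
  refine Function.update_of_ne ?_ _ _
  rw [← Fin.succ_last]; exact fun h => (Fin.castSucc_lt_last i).ne' (Fin.succ_injective _ h)

theorem update_zero_last {α : Type*} {n : ℕ} (f : Fin (n + 2) → α) (z : α) :
    Function.update f 0 z (Fin.last (n + 1)) = f (Fin.last (n + 1)) :=
  Function.update_of_ne (Fin.last_pos).ne' _ _

theorem update_last_zero {α : Type*} {n : ℕ} (f : Fin (n + 2) → α) (z : α) :
    Function.update f (Fin.last (n + 1)) z 0 = f 0 :=
  Function.update_of_ne (Fin.last_pos).ne _ _

/-- `f₁ ⊗ ⋯ ⊗ fₙ₊₂ ↦ (fₙ₊₂ f₁) ⊗ f₂ ⊗ ⋯ ⊗ fₙ₊₁`. -/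
def glueTens (n : ℕ) : Tens D (n + 2) →ₗ[ℂ] Tens D (n + 1) :=
  PiTensorProduct.lift <| MultilinearMap.mk'
    (fun f => PiTensorProduct.tprod ℂ
      (Fin.cons (f (Fin.last (n + 1)) * f 0) (innerPart f) : Fin (n + 1) → D))
    (by
      intro f i x y
      rcases fin_ends i with rfl | rfl | ⟨i, rfl⟩
      · simp only [update_zero_last, innerPart_update_zero, Function.update_self, mul_add,
          tprod_cons_add]
      · simp only [update_last_zero, innerPart_update_last, Function.update_self, add_mul,
          tprod_cons_add]
      · simp only [update_innerPart_zero, update_innerPart_last, innerPart_update, Fin.cons_update,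
          MultilinearMap.map_update_add])
    (by
      intro f i c x
      rcases fin_ends i with rfl | rfl | ⟨i, rfl⟩
      · simp only [update_zero_last, innerPart_update_zero, Function.update_self, mul_smul_comm,
          tprod_cons_smul]
      · simp only [update_last_zero, innerPart_update_last, Function.update_self, smul_mul_assoc,
          tprod_cons_smul]
      · simp only [update_innerPart_zero, update_innerPart_last, innerPart_update, Fin.cons_update,
          MultilinearMap.map_update_smul])

/-- `f₁ ⊗ ⋯ ⊗ fₙ₊₂ ↦ ψ(f₁ fₙ₊₂) f₂ ⊗ ⋯ ⊗ fₙ₊₁`. -/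
def closeTens (ψ : D →ₗ[ℂ] ℂ) (n : ℕ) : Tens D (n + 2) →ₗ[ℂ] Tens D n :=
  PiTensorProduct.lift <| MultilinearMap.mk'
    (fun f => ψ (f 0 * f (Fin.last (n + 1))) • PiTensorProduct.tprod ℂ (innerPart f))
    (by
      intro f i x y
      rcases fin_ends i with rfl | rfl | ⟨i, rfl⟩
      · simp only [update_zero_last, innerPart_update_zero, Function.update_self, add_mul, map_add,
          add_smul]
      · simp only [update_last_zero, innerPart_update_last, Function.update_self, mul_add, map_add,
          add_smul]
      · simp only [update_innerPart_zero, update_innerPart_last, innerPart_update,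
          MultilinearMap.map_update_add, smul_add])
    (by
      intro f i c x
      rcases fin_ends i with rfl | rfl | ⟨i, rfl⟩
      · simp only [update_zero_last, innerPart_update_zero, Function.update_self, smul_mul_assoc,
          map_smul, smul_assoc]
      · simp only [update_last_zero, innerPart_update_last, Function.update_self, mul_smul_comm,
          map_smul, smul_assoc]
      · simp only [update_innerPart_zero, update_innerPart_last, innerPart_update,
          MultilinearMap.map_update_smul, smul_comm c])

/-- The map `c` on `D^{⊗n}`: `c(Ω) = 0`, `c(f) = [f]`, and
`c(f₁ ⊗ ⋯ ⊗ fₙ) = [f₁ ⊗ ⋯ ⊗ fₙ] + [fₙ f₁ ⊗ f₂ ⊗ ⋯ ⊗ fₙ₋₁] + ψ(f₁ fₙ) c(f₂ ⊗ ⋯ ⊗ fₙ₋₁)`. -/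
def cycTens (ψ : D →ₗ[ℂ] ℂ) : ∀ n : ℕ, Tens D n →ₗ[ℂ] FockCyc D
  | 0 => 0
  | 1 => circular D 1
  | n + 2 => circular D (n + 2) + circular D (n + 1) ∘ₗ glueTens n + cycTens ψ n ∘ₗ closeTens ψ n

/-- The map `c` from the linear to the cyclic Fock space. -/
def cyc (ψ : D →ₗ[ℂ] ℂ) : FockLin D →ₗ[ℂ] FockCyc D :=
  DirectSum.toModule ℂ ℕ _ (cycTens ψ)

/-- The bilinear pairing
`(f₁ ⊗ ⋯ ⊗ fₙ, g₁ ⊗ ⋯ ⊗ gₙ) ↦ ψ(g₁ f₁) ⋯ ψ(gₙ fₙ)` on `D^{⊗n}`. -/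
def pairTens (ψ : D →ₗ[ℂ] ℂ) (n : ℕ) : Tens D n →ₗ[ℂ] Tens D n →ₗ[ℂ] ℂ :=
  (PiTensorProduct.map₂ fun _ : Fin n => ((LinearMap.mul ℂ D).compr₂ ψ).flip).compr₂
    (PiTensorProduct.lift (MultilinearMap.mkPiAlgebra ℂ (Fin n) ℂ))

theorem pairTens_tprod (ψ : D →ₗ[ℂ] ℂ) (n : ℕ) (f g : Fin n → D) :
    pairTens ψ n (PiTensorProduct.tprod ℂ f) (PiTensorProduct.tprod ℂ g) =
      ∏ i, ψ (g i * f i) := by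
  simp [pairTens, PiTensorProduct.map₂_tprod_tprod]

/-- The bilinear pairing
`(f₁ ⊗ ⋯ ⊗ fₙ, g₁ ⊗ ⋯ ⊗ gₙ) ↦ ∑ₖ ψ(g₁₊ₖ f₁) ⋯ ψ(gₙ₊ₖ fₙ)`, `k` running over the `n` rotations
and indices being counted modulo `n`; on `D^{⊗0}` there is only the trivial rotation. -/
def cycPairTens (ψ : D →ₗ[ℂ] ℂ) : ∀ n : ℕ, Tens D n →ₗ[ℂ] Tens D n →ₗ[ℂ] ℂ
  | 0 => pairTens ψ 0
  | n + 1 => ∑ k : Fin (n + 1), (pairTens ψ (n + 1)).compl₂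
      (PiTensorProduct.reindex ℂ (fun _ : Fin (n + 1) => D) (Equiv.addRight k).symm).toLinearMap

theorem cycPairTens_tprod (ψ : D →ₗ[ℂ] ℂ) (n : ℕ) (f g : Fin (n + 1) → D) :
    cycPairTens ψ (n + 1) (PiTensorProduct.tprod ℂ f) (PiTensorProduct.tprod ℂ g) =
      ∑ k, ∏ i, ψ (g (i + k) * f i) := by
  simp [cycPairTens, LinearMap.sum_apply, PiTensorProduct.reindex_tprod, pairTens_tprod]

theorem cycPairTens_rot_left (ψ : D →ₗ[ℂ] ℂ) (n : ℕ) (x y : Tens D n) :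
    cycPairTens ψ n (rotTens D n x) y = cycPairTens ψ n x y := by
  suffices h : cycPairTens ψ n ∘ₗ rotTens D n = cycPairTens ψ n from
    LinearMap.congr_fun (LinearMap.congr_fun h x) y
  ext f g
  cases n with
  | zero => simp [cycPairTens, pairTens_tprod]
  | succ n =>
    simp only [LinearMap.compMultilinearMap_apply, LinearMap.comp_apply, rotTens_tprod,
      cycPairTens_tprod, finRotate_apply]
    refine Fintype.sum_equiv (Equiv.subRight 1) _ _ fun k => ?_
    refine Fintype.prod_equiv (Equiv.addRight 1) _ _ fun i => ?_
    simp only [Equiv.subRight_apply, Equiv.coe_addRight]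
    congr 3
    abel

theorem cycPairTens_rot_right (ψ : D →ₗ[ℂ] ℂ) (n : ℕ) (x y : Tens D n) :
    cycPairTens ψ n x (rotTens D n y) = cycPairTens ψ n x y := by
  suffices h : (cycPairTens ψ n).compl₂ (rotTens D n) = cycPairTens ψ n from
    LinearMap.congr_fun (LinearMap.congr_fun h x) y
  ext f g
  cases n with
  | zero => simp [cycPairTens, pairTens_tprod]
  | succ n =>
    simp only [LinearMap.compMultilinearMap_apply, LinearMap.compl₂_apply, rotTens_tprod,
      cycPairTens_tprod, finRotate_apply]
    refine Fintype.sum_equiv (Equiv.addRight 1) _ _ fun k => ?_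
    refine Fintype.prod_congr _ _ fun i => ?_
    simp [add_assoc]

variable [StarRing D] [StarModule ℂ D]

variable (D) in
/-- The additive map underlying `starTens`. -/
def starTensAux (n : ℕ) : Tens D n →+ Tens D n :=
  PiTensorProduct.liftAddHom
    (fun p => conj p.1 • PiTensorProduct.tprod ℂ fun i => star (p.2 i))
    (by
      intro r f i hi
      rw [(PiTensorProduct.tprod ℂ).map_coord_zero i (by simp [hi]), smul_zero])
    (by intro f; simp)
    (by
      intro _ r f i x y
      have h (z : D) : (fun j => star (Function.update f i z j)) =
          Function.update (fun j => star (f j)) i (star z) := by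
        funext j; exact Function.apply_update (fun _ => star) f i z j
      simp only [h, star_add, MultilinearMap.map_update_add, smul_add])
    (by intro r s f; simp [add_smul])
    (by
      intro _ r f i s
      have h (z : D) : (fun j => star (Function.update f i z j)) =
          Function.update (fun j => star (f j)) i (star z) := by
        funext j; exact Function.apply_update (fun _ => star) f i z j
      simp only [h, star_smul, MultilinearMap.map_update_smul, Function.update_eq_self, smul_smul,
        map_mul, starRingEnd_apply, mul_comm])

variable (D) in
/-- The conjugate-linear map `f₁ ⊗ ⋯ ⊗ fₙ ↦ f₁* ⊗ ⋯ ⊗ fₙ*` on `D^{⊗n}`. -/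
def starTens (n : ℕ) : Tens D n →ₗ⋆[ℂ] Tens D n where
  toFun := starTensAux D n
  map_add' := map_add _
  map_smul' := by
    intro c x
    induction x using PiTensorProduct.induction_on' with
    | tprodCoeff r f =>
      rw [PiTensorProduct.smul_tprodCoeff']
      change conj (c • r) • (PiTensorProduct.tprod ℂ (fun i => star (f i)) : Tens D n) =
        conj c • conj r • (PiTensorProduct.tprod ℂ (fun i => star (f i)) : Tens D n)
      simp [smul_smul]
    | add x y hx hy => rw [smul_add, map_add, map_add, hx, hy, smul_add]

theorem starTens_tprod (n : ℕ) (f : Fin n → D) :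
    starTens D n (PiTensorProduct.tprod ℂ f) = PiTensorProduct.tprod ℂ fun i => star (f i) := by
  change conj (1 : ℂ) • (PiTensorProduct.tprod ℂ (fun i => star (f i)) : Tens D n) = _
  simp

theorem starTens_rot (n : ℕ) (x : Tens D n) :
    starTens D n (rotTens D n x) = rotTens D n (starTens D n x) := by
  induction x using PiTensorProduct.induction_on with
  | smul_tprod r f => simp [starTens_tprod, LinearMap.map_smulₛₗ]
  | add x y hx hy => simp only [map_add, hx, hy]

/-- The sesquilinear form on `D^{⊗n}` that induces the inner product of circular tensors. -/
def preInnerTens (ψ : D →ₗ[ℂ] ℂ) (n : ℕ) : Tens D n →ₗ[ℂ] Tens D n →ₗ⋆[ℂ] ℂ :=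
  (cycPairTens ψ n).compl₂ (starTens D n)

theorem preInnerTens_le_left (ψ : D →ₗ[ℂ] ℂ) (n : ℕ) :
    LinearMap.range (rotTens D n - LinearMap.id) ≤ LinearMap.ker (preInnerTens ψ n) := by
  rintro _ ⟨x, rfl⟩
  rw [LinearMap.mem_ker]
  ext y
  simp [preInnerTens, cycPairTens_rot_left]

theorem preInnerTens_le_right (ψ : D →ₗ[ℂ] ℂ) (n : ℕ) (x : Tens D n) :
    LinearMap.range (rotTens D n - LinearMap.id) ≤ LinearMap.ker (preInnerTens ψ n x) := by
  rintro _ ⟨y, rfl⟩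
  rw [LinearMap.mem_ker]
  simp [preInnerTens, starTens_rot, cycPairTens_rot_right]

/-- The inner product of circular tensors, linear in the first argument and conjugate-linear in
the second one. -/
def cycInnerTens (ψ : D →ₗ[ℂ] ℂ) (n : ℕ) : CycTens D n →ₗ[ℂ] CycTens D n →ₗ⋆[ℂ] ℂ :=
  Submodule.liftQ _
    { toFun := fun x => Submodule.liftQ _ (preInnerTens ψ n x) (preInnerTens_le_right ψ n x)
      map_add' := by
        intro x y; ext z
        simp
      map_smul' := by
        intro c x; ext z
        simp }
    (by
      intro x hx
      rw [LinearMap.mem_ker]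
      ext z
      simpa using LinearMap.congr_fun (LinearMap.mem_ker.1 (preInnerTens_le_left ψ n hx)) z)

/-- The inner product on the cyclic Fock space; tensors of different degrees are orthogonal. -/
def cycInner (ψ : D →ₗ[ℂ] ℂ) : FockCyc D →ₗ[ℂ] FockCyc D →ₗ⋆[ℂ] ℂ :=
  DirectSum.toModule ℂ ℕ _ fun n =>
    (cycInnerTens ψ n).compl₂ (DirectSum.component ℂ ℕ (CycTens D) n)

/-- `⟨[f₁ ⊗ ⋯ ⊗ fₙ], [g₁ ⊗ ⋯ ⊗ gₙ]⟩ = ∑ₖ ⟨f₁, g₁₊ₖ⟩ ⋯ ⟨fₙ, gₙ₊ₖ⟩`, where `⟨f, g⟩ = ψ(g* f)`. -/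
theorem cycInner_circular (ψ : D →ₗ[ℂ] ℂ) (n : ℕ) (f g : Fin (n + 1) → D) :
    cycInner ψ (circular D (n + 1) (PiTensorProduct.tprod ℂ f))
        (circular D (n + 1) (PiTensorProduct.tprod ℂ g)) =
      ∑ k, ∏ i, ψ (star (g (i + k)) * f i) := by
  simp [cycInner, circular, DirectSum.component.lof_self, cycInnerTens, preInnerTens,
    starTens_tprod, cycPairTens_tprod]

theorem cycInner_circular_of_ne (ψ : D →ₗ[ℂ] ℂ) {n m : ℕ} (h : n ≠ m) (x : Tens D n)
    (y : Tens D m) : cycInner ψ (circular D n x) (circular D m y) = 0 := by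
  simp [cycInner, circular, DirectSum.component.of, h.symm]

end Cyclic

end CompoundWishart

end

/-! The sum over annular non-crossing permutations is the meeting point of two independent
arguments.

Probability. By the Wick formula (`IsComplexGaussian.integral_prod`) the expectation of a product of
traces is a sum over permutations that match conjugated entries of `X` with unconjugated ones.
Subtracting the product of the expectations leaves the permutations `σ` that connect the two traces.
Summing over the indices gives, for each of them, `N ^ (#(σ) + #(σ⁻¹ γ) - (n + m))` times the
normalized traces along the cycles of `σ` (`IsComplexGaussian.k₂_cyclicSum`, `card_comp_perm_eq`,
`sum_prod_perm`). A connecting permutation has exponent at most `0` (`geod_annularRotation_le`), and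
those with exponent `0` form `SNC n m`, so these alone survive in the limit.

Fock space. The inner product is compared with the permutation sum through a common recursion,
`IsAnnularMoment`. Take the first letter `a` of the first circle and ask which letter follows it in
its cycle. If there is none, `a` is removed with the factor `ψ a`. If it is a letter `y` of the same
circle, the circle is cut into two, one of which remains joined to the second circle while the other
bounds a disc. If it is a letter of the second circle, the annulus is cut open into a disc. Discs
contribute `fpMoment`, the vacuum moments of the operators `p`.

For permutations, each case is multiplication by the transposition of `x` and `σ x`: it fixes `x`,
raises the geodesic quantity `geod` by exactly one, and splits a circle or merges two
(`sum_permFunctional_circles`, `sum_permFunctional_annular`). The latter evaluates the sum for any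
solution of the recursion, so uniqueness of the solution needs no separate proof.

On the Fock space, the operator `p(a)` has a mirror image acting on the last tensor factor. The two
commute (`lp_rp_comm`), so `p(a₁) ⋯ p(aₙ) Ω` can be built and decomposed from either end, and `c`
does not distinguish them (`wordCyc_lp`), so the vectors `cvec` are invariant under rotation.
Splitting off the part `openVec`, in which `a` closes its open block, gives the recursion up to one
inner product. That one is computed in stages (`cycInner_cycCre`, `cycInner_cycCre_openVec`,
`cycInner_openVec_openVec`, `cycInner_openVec_cvec`): each stage is an induction along one circle
that completes partial disc moments to full ones.

The conjugated version follows because the conjugate of a trace is the trace of the reversed word of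
adjoints. -/

noncomputable section

namespace CompoundWishart

/-! ### Sums over the ways to single out a letter of a word -/

section SplitSum

variable {α β M : Type*} [AddCommMonoid M]

/-- `∑ f u y v` over all decompositions `l = u ++ y :: v`. -/
def splitSum : (List α → α → List α → M) → List α → M
  | _, [] => 0
  | f, x :: l => f [] x l + splitSum (fun u y v => f (x :: u) y v) l

@[simp]
theorem splitSum_nil (f : List α → α → List α → M) : splitSum f [] = 0 := rfl

@[simp]
theorem splitSum_cons (f : List α → α → List α → M) (x : α) (l : List α) :
    splitSum f (x :: l) = f [] x l + splitSum (fun u y v => f (x :: u) y v) l := rfl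

theorem splitSum_append (f : List α → α → List α → M) (l l' : List α) :
    splitSum f (l ++ l') =
      splitSum (fun u y v => f u y (v ++ l')) l + splitSum (fun u y v => f (l ++ u) y v) l' := by
  induction l generalizing f with
  | nil => simp
  | cons x l ih => simp [ih, add_assoc]

theorem splitSum_concat (f : List α → α → List α → M) (l : List α) (x : α) :
    splitSum f (l ++ [x]) = splitSum (fun u y v => f u y (v ++ [x])) l + f l x [] := by
  simp [splitSum_append]

theorem splitSum_congr {f g : List α → α → List α → M} {l : List α}
    (h : ∀ u y v, l = u ++ y :: v → f u y v = g u y v) : splitSum f l = splitSum g l := by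
  induction l generalizing f g with
  | nil => rfl
  | cons x l ih =>
    rw [splitSum_cons, splitSum_cons, h [] x l rfl]
    congr 1
    exact ih fun u y v e => h (x :: u) y v (by simp [e])

theorem splitSum_add (f g : List α → α → List α → M) (l : List α) :
    splitSum (fun u y v => f u y v + g u y v) l = splitSum f l + splitSum g l := by
  induction l generalizing f g with
  | nil => simp
  | cons x l ih => simp only [splitSum_cons, ih]; abel

@[simp]
theorem splitSum_zero (l : List α) : splitSum (fun _ _ _ => (0 : M)) l = 0 := by
  induction l with
  | nil => rfl
  | cons x l ih => simp [ih]

theorem map_splitSum {M' F : Type*} [AddCommMonoid M'] [FunLike F M M'] [AddMonoidHomClass F M M']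
    (φ : F) (f : List α → α → List α → M) (l : List α) :
    φ (splitSum f l) = splitSum (fun u y v => φ (f u y v)) l := by
  induction l generalizing f with
  | nil => simp
  | cons x l ih => simp [ih]

theorem splitSum_map (g : α → β) (f : List β → β → List β → M) (l : List α) :
    splitSum f (l.map g) = splitSum (fun u y v => f (u.map g) (g y) (v.map g)) l := by
  induction l generalizing f with
  | nil => rfl
  | cons x l ih => simp [ih]

theorem splitSum_reverse (f : List α → α → List α → M) (l : List α) :
    splitSum f l.reverse = splitSum (fun u y v => f v.reverse y u.reverse) l := by
  induction l generalizing f with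
  | nil => rfl
  | cons x l ih => simp [splitSum_concat, ih, add_comm]

/-- Both sides run over the choices of two letters `z`, `y` of the word, in this order; only the
order of choosing differs. This is the Fubini rule behind the nested recursions below. -/
theorem splitSum_splitSum_left (g : List α → α → List α → α → List α → M) (l : List α) :
    splitSum (fun u y v => splitSum (fun u' z v' => g u' z v' y v) u) l =
      splitSum (fun u z w => splitSum (fun v' y v => g u z v' y v) w) l := by
  induction l generalizing g with
  | nil => rfl
  | cons x l ih => simp [splitSum_add, ih (fun u z v' y v => g (x :: u) z v' y v)]

theorem splitSum_comm (g : List α → α → List α → List β → β → List β → M) (l : List α)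
    (m : List β) :
    splitSum (fun u y v => splitSum (fun s z w => g u y v s z w) m) l =
      splitSum (fun s z w => splitSum (fun u y v => g u y v s z w) l) m := by
  induction l generalizing g with
  | nil => simp
  | cons x l ih => simp [splitSum_add, ih (fun u y v s z w => g (x :: u) y v s z w)]

theorem smul_splitSum {R : Type*} [DistribSMul R M] (c : R)
    (f : List α → α → List α → M) (l : List α) :
    c • splitSum f l = splitSum (fun u y v => c • f u y v) l :=
  map_splitSum (DistribSMul.toAddMonoidHom M c) f l

theorem mul_splitSum {R : Type*} [NonUnitalNonAssocSemiring R] (c : R)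
    (f : List α → α → List α → R) (l : List α) :
    c * splitSum f l = splitSum (fun u y v => c * f u y v) l :=
  map_splitSum (AddMonoidHom.mulLeft c) f l

theorem splitSum_mul {R : Type*} [NonUnitalNonAssocSemiring R] (c : R)
    (f : List α → α → List α → R) (l : List α) :
    splitSum f l * c = splitSum (fun u y v => f u y v * c) l :=
  map_splitSum (AddMonoidHom.mulRight c) f l

end SplitSum

/-! ### The Fock space on words -/

section Words

variable {D : Type*} [Ring D] [Algebra ℂ D]

variable (D) in
/-- Formal linear combinations of words in `D`; the word `f₁ ⋯ fₙ` stands for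
`f₁ ⊗ ⋯ ⊗ fₙ`. -/
abbrev WordFock : Type _ := List D →₀ ℂ

/-- The basis vector of a word. -/
def word (f : List D) : WordFock D := Finsupp.single f 1

/-- The linear map with prescribed values on words. -/
def wordLift {M : Type*} [AddCommMonoid M] [Module ℂ M] (φ : List D → M) : WordFock D →ₗ[ℂ] M :=
  Finsupp.linearCombination ℂ φ

@[simp]
theorem wordLift_word {M : Type*} [AddCommMonoid M] [Module ℂ M] (φ : List D → M) (f : List D) :
    wordLift φ (word f) = φ f := by
  simp [wordLift, word]

theorem wordFock_hom_ext {M : Type*} [AddCommMonoid M] [Module ℂ M] {S T : WordFock D →ₗ[ℂ] M}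
    (h : ∀ f, S (word f) = T (word f)) : S = T :=
  Finsupp.lhom_ext' fun f => LinearMap.ext_ring (h f)

/-- Words are empty, or one letter, or have distinct first and last letters. -/
theorem list_ends_induction {α : Type*} {P : List α → Prop} (nil : P []) (single : ∀ x, P [x])
    (ends : ∀ x h y, P (x :: (h ++ [y]))) (l : List α) : P l := by
  cases l with
  | nil => exact nil
  | cons x l =>
    induction l using List.reverseRecOn with
    | nil => exact single x
    | append_singleton l y => exact ends x l y

/-- Left creation. -/
def lcre (a : D) : Module.End ℂ (WordFock D) := wordLift fun f => word (a :: f)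

/-- Left annihilation `f₁ ⋯ fₙ ↦ ψ(a f₁) f₂ ⋯ fₙ`. -/
def lann (ψ : D →ₗ[ℂ] ℂ) (a : D) : Module.End ℂ (WordFock D) := wordLift fun f =>
  match f with
  | [] => 0
  | x :: f => ψ (a * x) • word f

/-- Left preservation. -/
def lgau (a : D) : Module.End ℂ (WordFock D) := wordLift fun f =>
  match f with
  | [] => 0
  | x :: f => word (a * x :: f)

/-- Right creation. -/
def rcre (a : D) : Module.End ℂ (WordFock D) := wordLift fun f => word (f ++ [a])

/-- Right annihilation `f₁ ⋯ fₙ ↦ ψ(fₙ a) f₁ ⋯ fₙ₋₁`. -/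
def rann (ψ : D →ₗ[ℂ] ℂ) (a : D) : Module.End ℂ (WordFock D) := wordLift fun f =>
  match f.reverse with
  | [] => 0
  | y :: h => ψ (y * a) • word h.reverse

/-- Right preservation. -/
def rgau (a : D) : Module.End ℂ (WordFock D) := wordLift fun f =>
  match f.reverse with
  | [] => 0
  | y :: h => word (h.reverse ++ [y * a])

/-- The vacuum coefficient. -/
def vac : WordFock D →ₗ[ℂ] ℂ := wordLift fun f => if f = [] then 1 else 0

section simps

variable (ψ : D →ₗ[ℂ] ℂ) (a x y : D) (f : List D)

@[simp] theorem lcre_word : lcre a (word f) = word (a :: f) := by simp [lcre]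
@[simp] theorem lann_nil : lann ψ a (word []) = 0 := by simp [lann]
@[simp] theorem lann_cons : lann ψ a (word (x :: f)) = ψ (a * x) • word f := by simp [lann]
@[simp] theorem lgau_nil : lgau a (word []) = 0 := by simp [lgau]
@[simp] theorem lgau_cons : lgau a (word (x :: f)) = word (a * x :: f) := by simp [lgau]
@[simp] theorem rcre_word : rcre a (word f) = word (f ++ [a]) := by simp [rcre]
@[simp] theorem rann_nil : rann ψ a (word []) = 0 := by simp [rann]
@[simp] theorem rann_concat : rann ψ a (word (f ++ [y])) = ψ (y * a) • word f := by simp [rann]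
@[simp] theorem rann_single : rann ψ a (word [y]) = ψ (y * a) • word [] := by simp [rann]
@[simp] theorem rann_ends : rann ψ a (word (x :: (f ++ [y]))) = ψ (y * a) • word (x :: f) := by
  simp [rann]
@[simp] theorem rgau_nil : rgau a (word []) = 0 := by simp [rgau]
@[simp] theorem rgau_concat : rgau a (word (f ++ [y])) = word (f ++ [y * a]) := by simp [rgau]
@[simp] theorem rgau_single : rgau a (word [y]) = word [y * a] := by simp [rgau]
@[simp] theorem rgau_ends : rgau a (word (x :: (f ++ [y]))) = word (x :: (f ++ [y * a])) := by
  simp [rgau]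
@[simp] theorem vac_nil : vac (word ([] : List D)) = 1 := by simp [vac]
@[simp] theorem vac_cons : vac (word (x :: f)) = 0 := by simp [vac]
@[simp] theorem vac_concat : vac (word (f ++ [x])) = 0 := by simp [vac]

end simps

/-- The left operator `p(a)` on words. -/
def lp (ψ : D →ₗ[ℂ] ℂ) (a : D) : Module.End ℂ (WordFock D) :=
  lcre a + lann ψ a + lgau a + ψ a • 1

/-- The right analogue of `p(a)`. -/
def rp (ψ : D →ₗ[ℂ] ℂ) (a : D) : Module.End ℂ (WordFock D) :=
  rcre a + rann ψ a + rgau a + ψ a • 1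

theorem lp_apply (ψ : D →ₗ[ℂ] ℂ) (a : D) (g : WordFock D) :
    lp ψ a g = lcre a g + lann ψ a g + lgau a g + ψ a • g := by simp [lp]

theorem rp_apply (ψ : D →ₗ[ℂ] ℂ) (a : D) (g : WordFock D) :
    rp ψ a g = rcre a g + rann ψ a g + rgau a g + ψ a • g := by simp [rp]

/-- Left operators touch the first letter and right operators the last, so they interfere only on
words of length at most one. Checking commutation relations therefore splits into these three
shapes. -/
theorem wordFock_apply_ext {M : Type*} [AddCommMonoid M] [Module ℂ M]
    (S T : WordFock D →ₗ[ℂ] M) (nil : S (word []) = T (word []))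
    (single : ∀ x, S (word [x]) = T (word [x]))
    (cons : ∀ x y h, S (word (x :: y :: h)) = T (word (x :: y :: h))) (g : WordFock D) :
    S g = T g := by
  refine LinearMap.congr_fun (wordFock_hom_ext fun f => ?_) g
  rcases f with _ | ⟨x, _ | ⟨y, h⟩⟩
  exacts [nil, single x, cons x y h]

variable (ψ : D →ₗ[ℂ] ℂ)

theorem lann_lcre (a x : D) (g : WordFock D) : lann ψ a (lcre x g) = ψ (a * x) • g :=
  LinearMap.congr_fun (f := lann ψ a ∘ₗ lcre x) (g := ψ (a * x) • 1)
    (wordFock_hom_ext fun f => by simp) g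

theorem lgau_lcre (a x : D) (g : WordFock D) : lgau a (lcre x g) = lcre (a * x) g :=
  LinearMap.congr_fun (f := lgau a ∘ₗ lcre x) (wordFock_hom_ext fun f => by simp) g

theorem vac_lcre (x : D) (g : WordFock D) : vac (lcre x g) = 0 :=
  LinearMap.congr_fun (f := vac ∘ₗ lcre x) (g := 0) (wordFock_hom_ext fun f => by simp) g

theorem vac_lgau (x : D) (g : WordFock D) : vac (lgau x g) = 0 :=
  LinearMap.congr_fun (f := vac ∘ₗ lgau x) (g := 0)
    (wordFock_hom_ext fun f => by cases f <;> simp) g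

-- A right operator does not see the first of two or more letters, which therefore factors out as a
-- left creation. The same holds for `rgau`, `rp` and `rblk`.
@[simp] theorem rann_cons_cons (a x y : D) (f : List D) :
    rann ψ a (word (x :: y :: f)) = lcre x (rann ψ a (word (y :: f))) := by
  obtain ⟨h, z, e⟩ : ∃ h z, y :: f = h ++ [z] := ⟨_, _, (List.dropLast_append_getLast (by simp)).symm⟩
  simp [e]

@[simp] theorem rgau_cons_cons (a x y : D) (f : List D) :
    rgau a (word (x :: y :: f)) = lcre x (rgau a (word (y :: f))) := by
  obtain ⟨h, z, e⟩ : ∃ h z, y :: f = h ++ [z] := ⟨_, _, (List.dropLast_append_getLast (by simp)).symm⟩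
  simp [e]

@[simp] theorem rp_cons_cons (a x y : D) (f : List D) :
    rp ψ a (word (x :: y :: f)) = lcre x (rp ψ a (word (y :: f))) := by
  simp [rp]

theorem lp_lcre (a x : D) (g : WordFock D) :
    lp ψ a (lcre x g) = lcre a (lcre x g) + ψ (a * x) • g + lcre (a * x) g + ψ a • lcre x g := by
  simp [lp_apply, lann_lcre, lgau_lcre]

/-- The operators creating an open block of `a` on the right. -/
def rblk (a : D) : Module.End ℂ (WordFock D) := rcre a + rgau a

@[simp] theorem rblk_cons_cons (a x y : D) (f : List D) :
    rblk a (word (x :: y :: f)) = lcre x (rblk a (word (y :: f))) := by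
  simp [rblk]

/-- On words with two or more letters the operators act at different ends; on shorter words the
creation, annihilation and preservation terms compensate each other by associativity. No trace
property is needed. -/
theorem lp_rp_comm (a z : D) (g : WordFock D) : lp ψ a (rp ψ z g) = rp ψ z (lp ψ a g) := by
  refine wordFock_apply_ext (lp ψ a ∘ₗ rp ψ z) (rp ψ z ∘ₗ lp ψ a) ?_ ?_ (fun x y h => ?_) g
  · simp [lp, rp]
    module
  · intro x
    simp [lp, rp, mul_assoc]
    module
  · rw [LinearMap.comp_apply, LinearMap.comp_apply, rp_cons_cons, lp_lcre, lp_apply]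
    simp only [lcre_word, lann_cons, lgau_cons, map_add, map_smul, rp_cons_cons]

theorem vac_lp_eq_vac_rp (htr : ∀ a b, ψ (a * b) = ψ (b * a)) (a : D) (g : WordFock D) :
    vac (lp ψ a g) = vac (rp ψ a g) := by
  refine wordFock_apply_ext (vac ∘ₗ lp ψ a) (vac ∘ₗ rp ψ a) ?_ ?_ (fun x y h => ?_) g
  · simp [lp, rp]
  · intro x
    simp [lp, rp, htr a x]
  · rw [LinearMap.comp_apply, LinearMap.comp_apply, rp_cons_cons, vac_lcre]
    simp [lp]

/-- The commutator lives on words of length at most one, where the letter annihilated from the left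
is also the one on which the right operator acts. The defect is a multiple of the vacuum, with
coefficient a moment of `z * x`. -/
theorem lann_rp (htr : ∀ a b, ψ (a * b) = ψ (b * a)) (x z : D) (g : WordFock D) :
    lann ψ x (rp ψ z g) = rp ψ z (lann ψ x g) + vac (lp ψ (z * x) g) • word [] := by
  refine wordFock_apply_ext (lann ψ x ∘ₗ rp ψ z)
    (rp ψ z ∘ₗ lann ψ x + (vac ∘ₗ lp ψ (z * x)).smulRight (word [])) ?_ ?_ (fun a y h => ?_) g
  · simp [lp, rp, htr x z]
  · intro y
    have h1 : ψ (x * (y * z)) = ψ (z * x * y) := by rw [← mul_assoc, htr, mul_assoc]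
    simp [lp, rp, h1]
    module
  · rw [LinearMap.comp_apply, rp_cons_cons, lann_lcre]
    simp [lp]

theorem rann_lp (htr : ∀ a b, ψ (a * b) = ψ (b * a)) (x z : D) (g : WordFock D) :
    rann ψ x (lp ψ z g) = lp ψ z (rann ψ x g) + vac (lp ψ (x * z) g) • word [] := by
  refine wordFock_apply_ext (rann ψ x ∘ₗ lp ψ z)
    (lp ψ z ∘ₗ rann ψ x + (vac ∘ₗ lp ψ (x * z)).smulRight (word [])) ?_ ?_ (fun a y h => ?_) g
  · simp [lp, htr x z]
  · intro y
    have h1 : ψ (z * (y * x)) = ψ (x * (z * y)) := by rw [← mul_assoc, htr]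
    simp [lp, mul_assoc, h1]
    module
  · simp [lp, lann_lcre, lgau_lcre]

/-- `rblk` never produces the vacuum, but `p(a)` can close the block it has just opened or extended;
this is the defect term. -/
theorem lp_rblk (htr : ∀ a b, ψ (a * b) = ψ (b * a)) (a y : D) (g : WordFock D) :
    lp ψ a (rblk y g) = rblk y (lp ψ a g) + vac (lp ψ (y * a) g) • word [] := by
  refine wordFock_apply_ext (lp ψ a ∘ₗ rblk y)
    (rblk y ∘ₗ lp ψ a + (vac ∘ₗ lp ψ (y * a)).smulRight (word [])) ?_ ?_ (fun x z h => ?_) g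
  · simp [lp, rblk, htr a y]
    module
  · intro z
    have h1 : ψ (a * (z * y)) = ψ (y * (a * z)) := by rw [← mul_assoc, htr]
    simp [lp, rblk, mul_assoc, h1]
    module
  · rw [LinearMap.comp_apply, rblk_cons_cons, lp_lcre]
    simp [lp]

/-- The defect is concentrated on the vacuum component: there the letter `z` created on the right is
immediately available to `a` on the left, and the two act as the single letter `a * z`. -/
theorem lgau_lann_rp (a z : D) (g : WordFock D) :
    lgau a (rp ψ z g) + lann ψ a (rp ψ z g) =
      rp ψ z (lgau a g + lann ψ a g) + vac g • lp ψ (a * z) (word []) := by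
  refine wordFock_apply_ext (lgau a ∘ₗ rp ψ z + lann ψ a ∘ₗ rp ψ z)
    (rp ψ z ∘ₗ (lgau a + lann ψ a) + vac.smulRight (lp ψ (a * z) (word []))) ?_ ?_
    (fun x y h => ?_) g
  · simp [lp, rp]
  · intro x
    simp [lp, rp, mul_assoc]
    module
  · rw [LinearMap.add_apply, LinearMap.comp_apply, LinearMap.comp_apply, rp_cons_cons, lann_lcre,
      lgau_lcre]
    simp

/-- The vector `p(a₁) ⋯ p(aₙ) Ω` on words. -/
def pvec : List D → WordFock D
  | [] => word []
  | a :: l => lp ψ a (pvec l)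

/-- The moment `⟨p(a₁) ⋯ p(aₙ) Ω, Ω⟩`. -/
def fpMoment (l : List D) : ℂ := vac (pvec ψ l)

@[simp] theorem pvec_nil : pvec ψ [] = word [] := rfl
@[simp] theorem pvec_cons (a : D) (l : List D) : pvec ψ (a :: l) = lp ψ a (pvec ψ l) := rfl
@[simp] theorem fpMoment_nil : fpMoment ψ [] = 1 := by simp [fpMoment]

-- Left and right operators agree on the vacuum and commute, so appending a letter at the end of the
-- word is an application of the right operator. This permits inductions from either end.
@[simp] theorem pvec_concat (l : List D) (z : D) : pvec ψ (l ++ [z]) = rp ψ z (pvec ψ l) := by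
  induction l with
  | nil => simp [lp, rp]
  | cons a l ih => simp [ih, lp_rp_comm]

variable {ψ} (htr : ∀ a b, ψ (a * b) = ψ (b * a))

include htr

theorem fpMoment_concat_eq_cons (l : List D) (a : D) :
    fpMoment ψ (l ++ [a]) = fpMoment ψ (a :: l) := by
  simp [fpMoment, vac_lp_eq_vac_rp ψ htr]

theorem fpMoment_append_comm (l l' : List D) : fpMoment ψ (l ++ l') = fpMoment ψ (l' ++ l) := by
  induction l' using List.reverseRecOn generalizing l with
  | nil => simp
  | append_singleton l' a ih =>
    rw [← List.append_assoc, fpMoment_concat_eq_cons htr, ← List.cons_append, ih]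
    simp

/-- Here `z` is the last letter of the first open block, the one closed by `x`: the letters `s`
before it form a disc together with that block, the letters `t` after it are untouched. Each
commutation of `lann` past a right operator contributes one `z`. -/
theorem lann_pvec (x : D) (l : List D) : lann ψ x (pvec ψ l) =
    splitSum (fun s z t => fpMoment ψ (s ++ [z * x]) • pvec ψ t) l := by
  induction l using List.reverseRecOn with
  | nil => simp
  | append_singleton l z ih =>
    rw [pvec_concat, lann_rp ψ htr, ih, splitSum_concat, map_splitSum, fpMoment_concat_eq_cons htr]
    simp [fpMoment]

theorem rann_pvec (x : D) (l : List D) : rann ψ x (pvec ψ l) =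
    splitSum (fun s z t => fpMoment ψ (x * z :: t) • pvec ψ s) l := by
  induction l with
  | nil => simp
  | cons z l ih =>
    rw [pvec_cons, rann_lp ψ htr, ih, splitSum_cons, map_splitSum, add_comm]
    simp [fpMoment]

/-- Case distinction on the letter `y` following `a` in its block; the letters `u` in between are
enclosed and split off. After a rotation, only the annihilation and scalar parts of the right
operator reach the vacuum. -/
theorem fpMoment_cons (a : D) (l : List D) : fpMoment ψ (a :: l) = ψ a * fpMoment ψ l +
    splitSum (fun u y v => fpMoment ψ u * fpMoment ψ (a * y :: v)) l := by
  rw [← fpMoment_concat_eq_cons htr, fpMoment, pvec_concat, rp_apply, map_add, map_add, map_add,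
    rann_pvec htr, map_splitSum]
  have h1 : vac (rcre a (pvec ψ l)) = 0 := LinearMap.congr_fun (f := vac ∘ₗ rcre a) (g := 0)
    (wordFock_hom_ext fun f => by simp) _
  have h2 : vac (rgau a (pvec ψ l)) = 0 := LinearMap.congr_fun (f := vac ∘ₗ rgau a) (g := 0)
    (wordFock_hom_ext fun f => by
      rcases List.eq_nil_or_concat f with rfl | ⟨h, y, rfl⟩ <;> simp) _
  simp [h1, h2, fpMoment, mul_comm, add_comm]

theorem fpMoment_concat (l : List D) (a : D) : fpMoment ψ (l ++ [a]) = ψ a * fpMoment ψ l +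
    splitSum (fun u y v => fpMoment ψ v * fpMoment ψ (u ++ [y * a])) l := by
  rw [fpMoment_concat_eq_cons htr, fpMoment, pvec_cons, lp_apply, map_add, map_add, map_add,
    lann_pvec htr, map_splitSum, vac_lcre, vac_lgau]
  simp [fpMoment, mul_comm, add_comm]

/-- Here `y` is the last letter lying in an open block: everything after it closes up on its own and
gives `fpMoment ψ v`, while `y` either forms a new open block or extends the last one. -/
theorem pvec_eq_rblk (l : List D) : pvec ψ l = fpMoment ψ l • word [] +
    splitSum (fun u y v => fpMoment ψ v • rblk y (pvec ψ u)) l := by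
  induction l with
  | nil => simp
  | cons a l ih =>
    have h : splitSum (fun u y v => fpMoment ψ v • lp ψ a (rblk y (pvec ψ u))) l =
        splitSum (fun u y v => fpMoment ψ v • rblk y (pvec ψ (a :: u))) l +
        splitSum (fun u y v => fpMoment ψ v * fpMoment ψ (u ++ [y * a])) l • word [] := by
      rw [← LinearMap.toSpanSingleton_apply, map_splitSum, ← splitSum_add]
      refine splitSum_congr fun u y v _ => ?_
      rw [lp_rblk ψ htr, smul_add, fpMoment_concat_eq_cons htr, LinearMap.toSpanSingleton_apply,
        smul_smul]
      rfl
    rw [pvec_cons, ih, map_add, map_splitSum]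
    simp only [map_smul, splitSum_cons]
    rw [h, ← fpMoment_concat_eq_cons htr, fpMoment_concat htr]
    simp [lp, rblk]
    module

-- In the preservation and annihilation parts `a` joins an existing block. With `y` the next letter
-- of that block, `a` and `y` act as one letter and the letters `u` in between close up.
omit htr in
theorem lgau_lann_pvec (a : D) (l : List D) : lgau a (pvec ψ l) + lann ψ a (pvec ψ l) =
    splitSum (fun u y v => fpMoment ψ u • pvec ψ (a * y :: v)) l := by
  induction l using List.reverseRecOn with
  | nil => simp
  | append_singleton l z ih =>
    rw [pvec_concat, lgau_lann_rp, ih, splitSum_concat, map_splitSum]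
    simp [fpMoment, ← List.cons_append, -List.cons_append_fun]

end Words

/-! ### From words to tensors -/

section Transfer

variable {D : Type*} [Ring D] [Algebra ℂ D]

/-- The pure tensor of a word, in the linear Fock space. -/
def linTensor (f : List D) : FockLin D :=
  DirectSum.lof ℂ ℕ (Tens D) f.length (PiTensorProduct.tprod ℂ f.get)

/-- The circular tensor of a word. -/
def cycTensor (f : List D) : FockCyc D :=
  circular D f.length (PiTensorProduct.tprod ℂ f.get)

theorem linTensor_ofFn {n : ℕ} (f : Fin n → D) :
    linTensor (List.ofFn f) = DirectSum.lof ℂ ℕ (Tens D) n (PiTensorProduct.tprod ℂ f) := by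
  -- Generalizing the length turns the equality of lengths into a substitution and avoids casts
  -- between tensor powers.
  have key : ∀ (k : ℕ) (h : k = n) (g : Fin k → D), (∀ i, g i = f (Fin.cast h i)) →
      DirectSum.lof ℂ ℕ (Tens D) k (PiTensorProduct.tprod ℂ g) =
        DirectSum.lof ℂ ℕ (Tens D) n (PiTensorProduct.tprod ℂ f) := by
    rintro k rfl g hg
    rw [show g = f from funext hg]
  exact key _ (List.length_ofFn) _ fun i => by simp; rfl

theorem cycTensor_ofFn {n : ℕ} (f : Fin n → D) :
    cycTensor (List.ofFn f) = circular D n (PiTensorProduct.tprod ℂ f) := by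
  have key : ∀ (k : ℕ) (h : k = n) (g : Fin k → D), (∀ i, g i = f (Fin.cast h i)) →
      circular D k (PiTensorProduct.tprod ℂ g) = circular D n (PiTensorProduct.tprod ℂ f) := by
    rintro k rfl g hg
    rw [show g = f from funext hg]
  exact key _ (List.length_ofFn) _ fun i => by simp; rfl

variable (D) in
/-- The map from formal combinations of words to the linear Fock space. -/
def toFockLin : WordFock D →ₗ[ℂ] FockLin D := wordLift linTensor

@[simp] theorem toFockLin_word (f : List D) : toFockLin D (word f) = linTensor f := by
  simp [toFockLin]

theorem creation_linTensor (a : D) (f : List D) :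
    creation a (linTensor f) = linTensor (a :: f) := by
  obtain ⟨n, f, rfl⟩ : ∃ n, ∃ g : Fin n → D, f = List.ofFn g := ⟨_, f.get, (List.ofFn_get f).symm⟩
  have h : a :: List.ofFn f = List.ofFn (Fin.cons a f : Fin (n + 1) → D) := by
    simp
  rw [h, linTensor_ofFn, linTensor_ofFn]
  simp [creation, createTens]

theorem gauge_linTensor_cons (a x : D) (f : List D) :
    gauge a (linTensor (x :: f)) = linTensor (a * x :: f) := by
  obtain ⟨n, f, rfl⟩ : ∃ n, ∃ g : Fin n → D, f = List.ofFn g := ⟨_, f.get, (List.ofFn_get f).symm⟩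
  have h : ∀ a, a :: List.ofFn f = List.ofFn (Fin.cons a f : Fin (n + 1) → D) := by
    simp
  rw [h, h, linTensor_ofFn, linTensor_ofFn]
  simp only [gauge, DirectSum.toModule_lof, LinearMap.comp_apply, gaugeTens,
    PiTensorProduct.map_tprod]
  congr 2
  funext i
  cases i using Fin.cases <;> simp

theorem gauge_linTensor_nil (a : D) : gauge a (linTensor []) = 0 := by
  simp [gauge, linTensor, gaugeTens]

theorem cyc_linTensor_nil (ψ : D →ₗ[ℂ] ℂ) : cyc ψ (linTensor []) = 0 := by
  simp [cyc, linTensor, cycTens]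

theorem cyc_linTensor_single (ψ : D →ₗ[ℂ] ℂ) (x : D) :
    cyc ψ (linTensor [x]) = cycTensor [x] := by
  simp [cyc, linTensor, cycTens, cycTensor]

theorem cyc_linTensor_ends (ψ : D →ₗ[ℂ] ℂ) (x y : D) (h : List D) :
    cyc ψ (linTensor (x :: (h ++ [y]))) = cycTensor (x :: (h ++ [y])) + cycTensor (y * x :: h) +
      ψ (x * y) • cyc ψ (linTensor h) := by
  obtain ⟨n, h, rfl⟩ : ∃ n, ∃ g : Fin n → D, h = List.ofFn g := ⟨_, h.get, (List.ofFn_get h).symm⟩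
  set f : Fin (n + 2) → D := Fin.cons x (Fin.snoc h y : Fin (n + 1) → D) with hf
  have h1 : x :: (List.ofFn h ++ [y]) = List.ofFn f := by
    rw [List.ofFn_succ, hf, List.ofFn_succ']
    simp
  have h2 : y * x :: List.ofFn h = List.ofFn (Fin.cons (y * x) h : Fin (n + 1) → D) := by simp
  have h0 : f 0 = x := by simp [hf]
  have hl : f (Fin.last (n + 1)) = y := by
    rw [hf, ← Fin.succ_last]; simp only [Fin.cons_succ, Fin.snoc_last]
  have hi : innerPart f = h := by
    funext i; simp [innerPart, hf]
  rw [h1, h2, linTensor_ofFn, linTensor_ofFn, cycTensor_ofFn, cycTensor_ofFn]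
  simp [cyc, cycTens, glueTens, closeTens, h0, hl, hi]

theorem cycTensor_rotate (x : D) (f : List D) : cycTensor (x :: f) = cycTensor (f ++ [x]) := by
  obtain ⟨n, f, rfl⟩ : ∃ n, ∃ g : Fin n → D, f = List.ofFn g := ⟨_, f.get, (List.ofFn_get f).symm⟩
  have h1 : x :: List.ofFn f = List.ofFn (Fin.cons x f : Fin (n + 1) → D) := by simp
  have h2 : List.ofFn f ++ [x] = List.ofFn (Fin.snoc f x : Fin (n + 1) → D) := by
    rw [List.ofFn_succ']; simp
  have h3 : (Fin.snoc f x : Fin (n + 1) → D) =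
      fun i => (Fin.cons x f : Fin (n + 1) → D) (finRotate (n + 1) i) := by
    funext i
    cases i using Fin.lastCases <;> simp
  rw [h1, h2, cycTensor_ofFn, cycTensor_ofFn, h3, ← rotTens_tprod]
  simp only [circular, LinearMap.comp_apply]
  congr 1
  rw [Submodule.mkQ_apply, Submodule.mkQ_apply, eq_comm, Submodule.Quotient.eq]
  -- The difference of the two tensors is the image of this pure tensor under `rotTens - id`.
  exact ⟨PiTensorProduct.tprod ℂ (Fin.cons x f : Fin (n + 1) → D), by simp⟩

/-- Circular creation: `f₁ ⋯ fₙ ↦ [a ⊗ f₁ ⊗ ⋯ ⊗ fₙ]`. -/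
def cycCre (a : D) : WordFock D →ₗ[ℂ] FockCyc D := wordLift fun f => cycTensor (a :: f)

@[simp] theorem cycCre_word (a : D) (f : List D) :
    cycCre a (word f) = cycTensor (a :: f) := by simp [cycCre]

variable (ψ : D →ₗ[ℂ] ℂ)

/-- The map `c` on words. -/
def wordCyc : WordFock D →ₗ[ℂ] FockCyc D := cyc ψ ∘ₗ toFockLin D

@[simp] theorem wordCyc_nil : wordCyc ψ (word []) = 0 := by
  simp [wordCyc, cyc_linTensor_nil]

@[simp] theorem wordCyc_single (x : D) : wordCyc ψ (word [x]) = cycTensor [x] := by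
  simp [wordCyc, cyc_linTensor_single]

@[simp] theorem wordCyc_ends (x y : D) (h : List D) : wordCyc ψ (word (x :: (h ++ [y]))) =
    cycTensor (x :: (h ++ [y])) + cycTensor (y * x :: h) + ψ (x * y) • wordCyc ψ (word h) := by
  simp [wordCyc, cyc_linTensor_ends]

theorem wordCyc_pair (x y : D) : wordCyc ψ (word [x, y]) =
    cycTensor [x, y] + cycTensor [y * x] := by
  simpa using wordCyc_ends ψ x y []

/-- The recursion of `c` offers three fates to a last letter `y`: it stays, it is glued to `a`
around the circle, or it closes with `a`. Adding the case where `y` extends the last block supplies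
exactly the terms that reassemble into `c` with `a` replaced by `y * a`. -/
theorem wordCyc_lcre_rblk (htr : ∀ a b, ψ (a * b) = ψ (b * a)) (a y : D) (g : WordFock D) :
    wordCyc ψ (lcre a (rblk y g)) =
      cycCre a (rblk y g) + wordCyc ψ (lcre (y * a) g) + ψ (y * a) • wordCyc ψ g := by
  refine LinearMap.congr_fun (f := wordCyc ψ ∘ₗ lcre a ∘ₗ rblk y)
    (g := cycCre a ∘ₗ rblk y + wordCyc ψ ∘ₗ lcre (y * a) + ψ (y * a) • wordCyc ψ)
    (wordFock_hom_ext fun f => ?_) g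
  rcases List.eq_nil_or_concat f with rfl | ⟨h, z, rfl⟩
  · simp [rblk, wordCyc_pair]
  · have h1 : ψ (a * (z * y)) = ψ (y * a * z) := by rw [← mul_assoc, htr, mul_assoc]
    have h2 := wordCyc_ends ψ a y (h ++ [z])
    simp [rblk, mul_assoc] at h2 ⊢
    simp [h2, h1, htr a y, mul_assoc]
    module

/-- This is the trace property of `c`, and the reason for its correction terms: gluing and closing
the two ends makes an operator at the front indistinguishable from its mirror image at the back. -/
theorem wordCyc_lp (htr : ∀ a b, ψ (a * b) = ψ (b * a)) (a : D) (g : WordFock D) :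
    wordCyc ψ (lp ψ a g) = wordCyc ψ (rp ψ a g) := by
  refine LinearMap.congr_fun (f := wordCyc ψ ∘ₗ lp ψ a) (g := wordCyc ψ ∘ₗ rp ψ a)
    (wordFock_hom_ext fun f => ?_) g
  refine list_ends_induction (P := fun f => (wordCyc ψ ∘ₗ lp ψ a) (word f) =
    (wordCyc ψ ∘ₗ rp ψ a) (word f)) ?_ (fun x => ?_) (fun x h y => ?_) f
  · simp [lp, rp]
  · have h1 := cycTensor_rotate a [x]
    simp at h1
    simp [lp, rp, wordCyc_pair, h1]
    abel
  · have h1 := wordCyc_ends ψ a y (x :: h)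
    have h2 := wordCyc_ends ψ x a (h ++ [y])
    have h3 := cycTensor_rotate a (x :: (h ++ [y]))
    have h5 := cycTensor_rotate (y * a) (x :: h)
    have h8 : ψ (a * x * y) = ψ (x * (y * a)) := by rw [mul_assoc, htr, mul_assoc]
    simp only [List.cons_append, List.append_assoc, List.nil_append] at h1 h2 h3 h5
    have h9 : wordCyc ψ (word (a * x :: (h ++ [y]))) = _ := wordCyc_ends ψ (a * x) y h
    have h10 : wordCyc ψ (word (x :: (h ++ [y * a]))) = _ := wordCyc_ends ψ x (y * a) h
    rw [h8, ← mul_assoc y a x] at h9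
    simp only [LinearMap.comp_apply, lp_apply, rp_apply, map_add, map_smul, lcre_word, lann_cons,
      lgau_cons, rcre_word, rann_ends, rgau_ends, List.cons_append, List.append_assoc,
      List.nil_append, h1, h2, h9, h10, h3, h5, htr y a, htr x a]
    abel

/-- The operators on the Fock space are the multilinear shadows of those on words. The double
adjoint in `annihilation ψ (star a)` cancels, so the functional is `ψ (a * ·)`. -/
theorem poisson_toFockLin [StarRing D] (a : D) (g : WordFock D) :
    poisson ψ a (toFockLin D g) = toFockLin D (lp ψ a g) := by
  refine LinearMap.congr_fun (f := poisson ψ a ∘ₗ toFockLin D) (g := toFockLin D ∘ₗ lp ψ a)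
    (wordFock_hom_ext fun f => ?_) g
  have h1 : annihilation ψ (star a) (linTensor f) = toFockLin D (lann ψ a (word f)) := by
    cases f with
    | nil => simp [annihilation, linTensor]
    | cons x f =>
      simp [annihilation, linTensor, annihilateTens]
      rfl
  have h2 : gauge a (linTensor f) = toFockLin D (lgau a (word f)) := by
    cases f with
    | nil => simp [gauge_linTensor_nil]
    | cons x f => simp [gauge_linTensor_cons]
  simp [poisson, lp, h1, h2, creation_linTensor]

theorem poissonVector_eq [StarRing D] {n : ℕ} (a : Fin n → D) :
    poissonVector ψ a = toFockLin D (pvec ψ (List.ofFn a)) := by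
  have key (l : List D) : (l.map (poisson ψ)).prod (vacuum D) = toFockLin D (pvec ψ l) := by
    induction l with
    | nil =>
      simp [vacuum, linTensor]
      congr
      funext i
      exact i.elim0
    | cons x l ih => simp [ih, poisson_toFockLin]
  rw [poissonVector, ← key, List.map_ofFn]
  rfl

/-! ### The vectors `c p(a₁) ⋯ p(aₙ) Ω` -/

/-- The vector `c p(a₁) ⋯ p(aₙ) Ω`. -/
def cvec (l : List D) : FockCyc D := wordCyc ψ (pvec ψ l)

@[simp] theorem cvec_nil : cvec ψ [] = 0 := by simp [cvec]

/-- The part of `c p(a) p(l₁) ⋯ p(lₙ) Ω` in which the last letter of the open block containing `a`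
is `a` itself. -/
def openVec (a : D) (l : List D) : FockCyc D :=
  wordCyc ψ (lcre a (pvec ψ l)) - splitSum (fun u y v => fpMoment ψ (a * y :: v) • cvec ψ u) l

variable {ψ} (htr : ∀ a b, ψ (a * b) = ψ (b * a))

include htr

theorem cvec_concat (l : List D) (a : D) : cvec ψ (l ++ [a]) = cvec ψ (a :: l) := by
  simp [cvec, wordCyc_lp ψ htr]

-- The joining part of `p(a)` is given by `lgau_lann_pvec`; the terms subtracted in `openVec` are
-- added back. They are the configurations in which the block of `a` bounds a disc and the rest of
-- the annulus is carried by `u`.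
omit htr in
theorem cvec_cons (a : D) (l : List D) : cvec ψ (a :: l) = ψ a • cvec ψ l +
    splitSum (fun u y v => fpMoment ψ u • cvec ψ (a * y :: v) +
      fpMoment ψ (a * y :: v) • cvec ψ u) l + openVec ψ a l := by
  have h : wordCyc ψ (lgau a (pvec ψ l)) + wordCyc ψ (lann ψ a (pvec ψ l)) =
      splitSum (fun u y v => fpMoment ψ u • cvec ψ (a * y :: v)) l := by
    rw [← map_add, lgau_lann_pvec, map_splitSum]
    simp [cvec]
  rw [splitSum_add, ← h, openVec, cvec, pvec_cons, lp_apply]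
  simp only [map_add, map_smul, cvec]
  abel

/-- Here `y` is the letter preceding `a` in its open block, reached by going backwards around the
circle; the enclosed letters `v` close up. If there is no such letter, `a` is a tensor factor of its
own. -/
theorem openVec_eq (a : D) (l : List D) : openVec ψ a l = cycCre a (pvec ψ l) +
    splitSum (fun u y v => fpMoment ψ v • openVec ψ (y * a) u) l := by
  have h1 : wordCyc ψ (lcre a (pvec ψ l)) = cycCre a (pvec ψ l) +
      splitSum (fun u y v => fpMoment ψ v • wordCyc ψ (lcre (y * a) (pvec ψ u))) l +
      splitSum (fun u y v => (ψ (y * a) * fpMoment ψ v) • cvec ψ u) l := by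
    have e := pvec_eq_rblk htr l
    conv_lhs => rw [e]
    rw [map_add, map_add, map_splitSum, map_splitSum, add_assoc, ← splitSum_add]
    conv_rhs => enter [1]; rw [e]
    rw [map_add, map_splitSum, add_assoc, ← splitSum_add]
    congr 1
    · simp
    · refine splitSum_congr fun u y v _ => ?_
      rw [map_smul, map_smul, map_smul, wordCyc_lcre_rblk ψ htr, cvec]
      module
  have h2 : splitSum (fun u y v => fpMoment ψ v • openVec ψ (y * a) u) l =
      splitSum (fun u y v => fpMoment ψ v • wordCyc ψ (lcre (y * a) (pvec ψ u))) l -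
      splitSum (fun u z w => splitSum (fun v' y v => (fpMoment ψ v *
        fpMoment ψ (y * a * z :: v')) • cvec ψ u) w) l := by
    rw [← splitSum_splitSum_left, eq_sub_iff_add_eq, ← splitSum_add]
    refine splitSum_congr fun u y v _ => ?_
    rw [openVec, smul_sub, smul_splitSum]
    simp only [smul_smul, sub_add_cancel]
  -- Expanding the subtracted moments by the letter preceding `a` yields the scalar terms of `h1`
  -- and the double sum of `h2`, which cancel.
  have h3 : splitSum (fun u y v => fpMoment ψ (a * y :: v) • cvec ψ u) l =
      splitSum (fun u y v => (ψ (y * a) * fpMoment ψ v) • cvec ψ u) l +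
      splitSum (fun u z w => splitSum (fun v' y v => (fpMoment ψ v *
        fpMoment ψ (y * a * z :: v')) • cvec ψ u) w) l := by
    rw [← splitSum_add]
    refine splitSum_congr fun u y v _ => ?_
    rw [← fpMoment_concat_eq_cons htr, fpMoment_concat htr, add_smul, htr y a,
      ← LinearMap.toSpanSingleton_apply ℂ _ (cvec ψ u) (splitSum _ _), map_splitSum]
    congr 1
    refine splitSum_congr fun s z t _ => ?_
    rw [fpMoment_concat_eq_cons htr, mul_assoc]
    rfl
  rw [openVec, h1, h2, h3]
  abel

end Transfer

/-! ### The inner product of the vectors `c p(a₁) ⋯ p(aₙ) Ω` -/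

section Pairing

variable {D : Type*} [Ring D] [Algebra ℂ D]

theorem splitSum_eq_sum {α M : Type*} [AddCommMonoid M] (f : List α → α → List α → M)
    (l : List α) : splitSum f l = ∑ k : Fin l.length, f (l.take k) l[k] (l.drop (k + 1)) := by
  induction l generalizing f with
  | nil => simp
  | cons x l ih =>
    rw [splitSum_cons, ih]
    exact (Fin.sum_univ_succ (n := l.length)
      (fun k : Fin (l.length + 1) => f ((x :: l).take k) (x :: l)[k] ((x :: l).drop (k + 1)))).symm

theorem splitSum_apply {α V W : Type*} [AddCommMonoid V] [Module ℂ V] [AddCommMonoid W]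
    [Module ℂ W] (f : List α → α → List α → V →ₗ[ℂ] W) (l : List α) (x : V) :
    splitSum f l x = splitSum (fun u y v => f u y v x) l :=
  map_splitSum (LinearMap.applyₗ x : (V →ₗ[ℂ] W) →ₗ[ℂ] W) f l

/-- A nontrivial rotation begins at some letter `y` of `h`, and `b` then follows the end of `h`. -/
theorem sum_rotate {α M : Type*} [AddCommMonoid M] (φ : List α → M) (b : α) (h : List α) :
    ∑ k : Fin (h.length + 1), φ ((b :: h).rotate k) =
      φ (b :: h) + splitSum (fun h₁ y h₂ => φ (y :: h₂ ++ b :: h₁)) h := by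
  rw [Fin.sum_univ_succ, splitSum_eq_sum]
  congr 1
  · simp
  · refine Fintype.sum_congr _ _ fun k => ?_
    rw [List.rotate_eq_drop_append_take (by simp)]
    simp

/-- `ψ(h₁ f₁) ⋯ ψ(hₙ fₙ)` for words of the same length, `0` otherwise. -/
def alignPair (ψ : D →ₗ[ℂ] ℂ) : List D → List D → ℂ
  | [], [] => 1
  | x :: h, y :: f => ψ (x * y) * alignPair ψ h f
  | [], _ :: _ => 0
  | _ :: _, [] => 0

variable (ψ : D →ₗ[ℂ] ℂ)

/-- The partner `z` of `b` cuts the pairing in two. Only the splitting with matching lengths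
contributes, since `alignPair` vanishes on words of different lengths. -/
theorem alignPair_append_cons (h₁ h₂ : List D) (b : D) (f : List D) :
    alignPair ψ (h₁ ++ b :: h₂) f =
      splitSum (fun s z w => ψ (b * z) * (alignPair ψ h₁ s * alignPair ψ h₂ w)) f := by
  induction h₁ generalizing f with
  | nil => cases f <;> simp [alignPair]
  | cons x h₁ ih =>
    cases f with
    | nil => simp [alignPair]
    | cons y f =>
      simp only [List.cons_append, alignPair, splitSum_cons, ih, mul_splitSum, zero_mul, mul_zero,
        zero_add]
      exact splitSum_congr fun u y v _ => by ring

theorem alignPair_concat_concat (h f : List D) (a y : D) :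
    alignPair ψ (h ++ [a]) (f ++ [y]) = ψ (a * y) * alignPair ψ h f := by
  rw [alignPair_append_cons, splitSum_concat, splitSum_congr (g := fun _ _ _ => 0)]
  · simp [alignPair]
  · intro u z v _
    have : alignPair ψ [] (v ++ [y]) = 0 := by cases v <;> rfl
    simp [this]

theorem alignPair_concat_single (h : List D) (a y : D) :
    alignPair ψ (h ++ [a]) [y] = ψ (a * y) * alignPair ψ h [] :=
  alignPair_concat_concat ψ h [] a y

theorem alignPair_single_concat (f : List D) (a y : D) :
    alignPair ψ [a] (f ++ [y]) = ψ (a * y) * alignPair ψ [] f :=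
  alignPair_concat_concat ψ [] f a y

@[simp] theorem alignPair_concat_nil (h : List D) (a : D) : alignPair ψ (h ++ [a]) [] = 0 := by
  cases h <;> rfl

@[simp] theorem alignPair_nil_concat (h : List D) (a : D) : alignPair ψ [] (h ++ [a]) = 0 := by
  cases h <;> rfl

@[simp] theorem alignPair_nil_nil : alignPair ψ [] [] = 1 := rfl

theorem alignPair_ofFn {n : ℕ} (h f : Fin n → D) :
    alignPair ψ (List.ofFn h) (List.ofFn f) = ∏ i, ψ (h i * f i) := by
  induction n with
  | zero => simp
  | succ n ih => simp [List.ofFn_succ, alignPair, ih, Fin.prod_univ_succ]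

theorem alignPair_of_length_ne {h f : List D} (e : h.length ≠ f.length) :
    alignPair ψ h f = 0 := by
  induction h generalizing f with
  | nil => cases f <;> simp_all [alignPair]
  | cons x h ih =>
    cases f with
    | nil => rfl
    | cons y f => simp [alignPair, ih (f := f) (by simpa using e)]

/-- The bilinear pairing of `g` and `f`, the last letter of `g` being paired with the first one of
`f`, and so on. -/
def revPair : WordFock D →ₗ[ℂ] WordFock D →ₗ[ℂ] ℂ :=
  wordLift fun g => wordLift fun f => alignPair ψ g.reverse f

@[simp] theorem revPair_word (g f : List D) :
    revPair ψ (word g) (word f) = alignPair ψ g.reverse f := by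
  simp [revPair]

/-- The first letter of `g` faces the last letter of `f`, so left creation is dual to right
annihilation and conversely, and the preservation operators are dual to each other by traciality. -/
theorem revPair_lp (htr : ∀ a b, ψ (a * b) = ψ (b * a)) (a : D) (g f : WordFock D) :
    revPair ψ (lp ψ a g) f = revPair ψ g (rp ψ a f) := by
  refine LinearMap.congr_fun (LinearMap.congr_fun (f := revPair ψ ∘ₗ lp ψ a)
    (g := (revPair ψ).compl₂ (rp ψ a)) (wordFock_hom_ext fun g => wordFock_hom_ext fun f => ?_)
    g) f
  rcases List.eq_nil_or_concat f with rfl | ⟨f, y, rfl⟩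
  · cases g with
    | nil => simp [lp, rp, alignPair]
    | cons x g =>
      simp [lp, rp, alignPair_concat_single, htr a x, -List.append_assoc]
  · cases g with
    | nil => 
      simp [lp, rp, alignPair_single_concat, htr a y, -List.append_assoc]
    | cons x g => 
      have h1 : ψ (a * x * y) = ψ (x * (y * a)) := by rw [mul_assoc, htr, mul_assoc]
      simp [lp, rp, alignPair_concat_concat, h1, htr a y, htr a x, -List.append_assoc]
      ring

/-- Duality moves the operators of `m` one by one to the right end of `l`, until the pairing with
the vacuum is left. -/
theorem revPair_pvec (htr : ∀ a b, ψ (a * b) = ψ (b * a)) (m l : List D) :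
    revPair ψ (pvec ψ m) (pvec ψ l) = fpMoment ψ (l ++ m) := by
  induction m generalizing l with
  | nil =>
    rw [List.append_nil, fpMoment, pvec_nil]
    exact LinearMap.congr_fun (wordFock_hom_ext fun f => by cases f <;> simp [alignPair]) _
  | cons a m ih =>
    rw [pvec_cons, revPair_lp ψ htr, ← pvec_concat, ih]
    simp

/-- The functional `f₁ ⋯ fₙ ↦ ∑ₖ ψ(a fₖ) φ(fₖ₊₁ ⋯ fₙ) χ(f₁ ⋯ fₖ₋₁)`. -/
def lsplit (a : D) (φ χ : WordFock D →ₗ[ℂ] ℂ) : WordFock D →ₗ[ℂ] ℂ :=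
  wordLift fun g => splitSum (fun u y v => ψ (a * y) * (φ (word v) * χ (word u))) g

/-- The functional `f₁ ⋯ fₙ ↦ ∑ₖ ψ(fₖ b) χ(f₁ ⋯ fₖ₋₁) φ(fₖ₊₁ ⋯ fₙ)`. -/
def rsplit (b : D) (χ φ : WordFock D →ₗ[ℂ] ℂ) : WordFock D →ₗ[ℂ] ℂ :=
  wordLift fun g => splitSum (fun s z w => ψ (z * b) * (χ (word s) * φ (word w))) g

/-- Applying `p(b)` acts on the part before the singled-out letter, except when that letter is the
first one: then `b` may itself have created it or been multiplied into it. These are the two extra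
terms. -/
theorem lsplit_lp (a b : D) (φ χ : WordFock D →ₗ[ℂ] ℂ) (g : WordFock D) :
    lsplit ψ a φ χ (lp ψ b g) = lsplit ψ a φ (χ ∘ₗ lp ψ b) g +
      φ (lann ψ (a * b) g + ψ (a * b) • g) * χ (word []) := by
  refine LinearMap.congr_fun (f := lsplit ψ a φ χ ∘ₗ lp ψ b)
    (g := lsplit ψ a φ (χ ∘ₗ lp ψ b) +
      χ (word []) • φ ∘ₗ (lann ψ (a * b) + ψ (a * b) • 1)) (wordFock_hom_ext fun f => ?_) g |>.trans ?_
  · cases f with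
    | nil => simp [lsplit, lp]; ring
    | cons x f =>
      simp [lsplit, lp, mul_add, splitSum_add, mul_assoc, mul_splitSum]
      simp only [mul_left_comm _ (ψ (b * x)), mul_left_comm _ (ψ b)]
      ring
  · simp; ring

theorem rsplit_rp (b x : D) (χ φ : WordFock D →ₗ[ℂ] ℂ) (g : WordFock D) :
    rsplit ψ b χ φ (rp ψ x g) = rsplit ψ b χ (φ ∘ₗ rp ψ x) g +
      χ (rann ψ (x * b) g + ψ (x * b) • g) * φ (word []) := by
  refine LinearMap.congr_fun (f := rsplit ψ b χ φ ∘ₗ rp ψ x)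
    (g := rsplit ψ b χ (φ ∘ₗ rp ψ x) +
      φ (word []) • χ ∘ₗ (rann ψ (x * b) + ψ (x * b) • 1)) (wordFock_hom_ext fun f => ?_) g |>.trans ?_
  · rcases List.eq_nil_or_concat f with rfl | ⟨f, y, rfl⟩
    · simp [rsplit, rp]; ring
    · simp [rsplit, rp, mul_add, splitSum_add, splitSum_append, mul_assoc, mul_splitSum]
      simp only [mul_left_comm _ (ψ (y * x)), mul_left_comm _ (ψ x)]
      ring
  · simp; ring

/-- The letter `y` is the leftmost member of the open block paired with `a`. The rest of this block
lies in `v` (the term with `lann`) or is empty (the term with `ψ (a * y)`). -/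
theorem lsplit_pvec (a : D) (φ χ : WordFock D →ₗ[ℂ] ℂ) (m : List D) :
    lsplit ψ a φ χ (pvec ψ m) = splitSum (fun u y v =>
      φ (lann ψ (a * y) (pvec ψ v) + ψ (a * y) • pvec ψ v) * χ (pvec ψ u)) m := by
  induction m generalizing χ with
  | nil => simp [lsplit]
  | cons b m ih =>
    rw [pvec_cons, lsplit_lp, ih, splitSum_cons, add_comm]
    rfl

theorem rsplit_pvec (b : D) (χ φ : WordFock D →ₗ[ℂ] ℂ) (l : List D) :
    rsplit ψ b χ φ (pvec ψ l) = splitSum (fun s z w =>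
      χ (rann ψ (z * b) (pvec ψ s) + ψ (z * b) • pvec ψ s) * φ (pvec ψ w)) l := by
  induction l using List.reverseRecOn generalizing φ with
  | nil => simp [rsplit]
  | append_singleton l x ih =>
    rw [pvec_concat, rsplit_rp, ih, splitSum_concat]
    simp

/-- The pairing of `p(v) Ω`, preceded by a closed block containing `x`, with `p(w) Ω`. -/
def leftClosed (x : D) (v w : List D) : ℂ := ψ x * fpMoment ψ (v ++ w) +
  splitSum (fun s z t => fpMoment ψ (s ++ [z * x]) * fpMoment ψ (t ++ w)) v

/-- The pairing of `p(s) Ω`, followed by a closed block containing `x`, with `p(u) Ω`. -/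
def rightClosed (x : D) (s u : List D) : ℂ := ψ x * fpMoment ψ (u ++ s) +
  splitSum (fun s' y t => fpMoment ψ (x * y :: t) * fpMoment ψ (u ++ s')) s

theorem revPair_leftClosed (htr : ∀ a b, ψ (a * b) = ψ (b * a)) (x : D) (v w : List D) :
    revPair ψ (lann ψ x (pvec ψ v) + ψ x • pvec ψ v) (pvec ψ w) = leftClosed ψ x v w := by
  rw [lann_pvec htr, map_add, LinearMap.add_apply, map_smul, LinearMap.smul_apply,
    revPair_pvec ψ htr, leftClosed, add_comm, fpMoment_append_comm htr w, map_splitSum,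
    splitSum_apply]
  congr 1
  refine splitSum_congr fun s z t _ => ?_
  rw [map_smul, LinearMap.smul_apply, revPair_pvec ψ htr,
    fpMoment_append_comm htr w, smul_eq_mul]

theorem revPair_rightClosed (htr : ∀ a b, ψ (a * b) = ψ (b * a)) (x : D) (s u : List D) :
    revPair ψ (pvec ψ u) (rann ψ x (pvec ψ s) + ψ x • pvec ψ s) = rightClosed ψ x s u := by
  rw [rann_pvec htr, map_add, map_smul, revPair_pvec ψ htr, rightClosed, add_comm,
    fpMoment_append_comm htr s, map_splitSum]
  congr 1
  refine splitSum_congr fun s' z t _ => ?_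
  rw [map_smul, revPair_pvec ψ htr, fpMoment_append_comm htr s', smul_eq_mul]

/-- The bilinear form obtained by pairing `a` with a letter of the word of the second vector and
`b` with the corresponding letter of the word of the first vector. -/
theorem splitSum_splitSum_pvec (htr : ∀ a b, ψ (a * b) = ψ (b * a)) (a b : D)
    (B : WordFock D →ₗ[ℂ] WordFock D →ₗ[ℂ] ℂ)
    (hB : ∀ f g, B (word f) (word g) = splitSum (fun u y v => splitSum (fun s z w =>
      ψ (a * y) * (ψ (z * b) * (alignPair ψ u.reverse s * alignPair ψ v.reverse w))) f) g)
    (l m : List D) :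
    B (pvec ψ l) (pvec ψ m) = splitSum (fun u y v => splitSum (fun s z w =>
      leftClosed ψ (a * y) v w * rightClosed ψ (z * b) s u) l) m := by
  -- Only one argument of `B` is resolved at a time: first `pvec ψ m` by `lsplit_pvec` against a
  -- fixed word, then `pvec ψ l` by `rsplit_pvec`.
  have h1 (f : List D) : B (word f) (pvec ψ m) = splitSum (fun s z w => ψ (z * b) *
      lsplit ψ a ((revPair ψ).flip (word w)) ((revPair ψ).flip (word s)) (pvec ψ m)) f := by
    refine (LinearMap.congr_fun (g := splitSum (fun s z w => ψ (z * b) •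
      lsplit ψ a ((revPair ψ).flip (word w)) ((revPair ψ).flip (word s))) f)
      (wordFock_hom_ext fun g => ?_) (pvec ψ m)).trans ?_
    · rw [hB, splitSum_comm, splitSum_apply]
      refine splitSum_congr fun s z w _ => ?_
      simp only [LinearMap.smul_apply, lsplit, wordLift_word,
        LinearMap.flip_apply, revPair_word, smul_eq_mul, mul_splitSum]
      refine splitSum_congr fun u y v _ => ?_
      ring
    · rw [splitSum_apply]
      rfl
  have h2 (f : List D) : B (word f) (pvec ψ m) = splitSum (fun u y v =>
      rsplit ψ b (revPair ψ (pvec ψ u)) (revPair ψ (lann ψ (a * y) (pvec ψ v) +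
        ψ (a * y) • pvec ψ v)) (word f)) m := by
    rw [h1]
    simp only [lsplit_pvec, mul_splitSum, rsplit, wordLift_word]
    rw [splitSum_comm]
    refine splitSum_congr fun u y v _ => splitSum_congr fun s z w _ => ?_
    rw [LinearMap.flip_apply, LinearMap.flip_apply]
    ring
  have h3 : B (pvec ψ l) (pvec ψ m) = splitSum (fun u y v =>
      rsplit ψ b (revPair ψ (pvec ψ u)) (revPair ψ (lann ψ (a * y) (pvec ψ v) +
        ψ (a * y) • pvec ψ v)) (pvec ψ l)) m := by
    refine (LinearMap.congr_fun (f := B.flip (pvec ψ m)) (g := splitSum (fun u y v =>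
      rsplit ψ b (revPair ψ (pvec ψ u)) (revPair ψ (lann ψ (a * y) (pvec ψ v) +
        ψ (a * y) • pvec ψ v))) m) (wordFock_hom_ext fun f => ?_) (pvec ψ l)).trans ?_
    · rw [LinearMap.flip_apply, h2, splitSum_apply]
    · rw [splitSum_apply]
  rw [h3]
  refine splitSum_congr fun u y v _ => ?_
  rw [rsplit_pvec]
  refine splitSum_congr fun s z w _ => ?_
  rw [revPair_leftClosed ψ htr, revPair_rightClosed ψ htr, mul_comm]

end Pairing

/-! ### Adjoint words and inner products of circular tensors -/

section Inner

variable {D : Type*} [Ring D] [StarRing D] [Algebra ℂ D] [StarModule ℂ D]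

/-- The adjoint word `fₙ* ⋯ f₁*`. -/
def starRev (f : List D) : List D := (f.map star).reverse

omit [Algebra ℂ D] [StarModule ℂ D] in
@[simp] theorem starRev_nil : starRev ([] : List D) = [] := rfl

omit [Algebra ℂ D] [StarModule ℂ D] in
@[simp] theorem starRev_cons (x : D) (f : List D) : starRev (x :: f) = starRev f ++ [star x] := by
  simp [starRev]

omit [Algebra ℂ D] [StarModule ℂ D] in
theorem splitSum_starRev {M : Type*} [AddCommMonoid M] (f : List D → D → List D → M)
    (l : List D) : splitSum f (starRev l) =
      splitSum (fun u y v => f (starRev v) (star y) (starRev u)) l := by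
  rw [starRev, splitSum_reverse, splitSum_map]
  rfl

/-- Positivity on `1 + a` and on `1 + i a` forces two imaginary parts to vanish, which compares the
imaginary and the real parts of `ψ (star a)` and `ψ a`. -/
theorem IsTracialState.map_star {ψ : D →ₗ[ℂ] ℂ} (hψ : IsTracialState ψ) (a : D) :
    ψ (star a) = conj (ψ a) := by
  have h0 := (hψ.nonneg a).2
  have h1 := (hψ.nonneg (1 + a)).2
  have h2 := (hψ.nonneg (1 + Complex.I • a)).2
  simp [add_mul, mul_add, smul_smul, hψ.map_one, h0] at h1 h2
  apply Complex.ext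
  · simp; linarith
  · simp; linarith

variable (D) in
/-- The conjugate-linear map `f ↦ f*` on words. -/
def starWord : WordFock D →+ WordFock D :=
  Finsupp.liftAddHom fun f =>
    (Finsupp.singleAddHom (starRev f)).comp (starRingEnd ℂ).toAddMonoidHom

omit [Algebra ℂ D] [StarModule ℂ D] in
theorem starWord_single (f : List D) (c : ℂ) :
    starWord D (Finsupp.single f c) = Finsupp.single (starRev f) (conj c) := by
  simp [starWord]

omit [Algebra ℂ D] [StarModule ℂ D] in
@[simp] theorem starWord_word (f : List D) : starWord D (word f) = word (starRev f) := by
  simp [word, starWord_single]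

omit [Algebra ℂ D] [StarModule ℂ D] in
theorem starWord_smul (c : ℂ) (g : WordFock D) :
    starWord D (c • g) = conj c • starWord D g := by
  induction g using Finsupp.induction_linear with
  | zero => simp
  | add f g hf hg => simp [hf, hg]
  | single f d => simp only [Finsupp.smul_single, smul_eq_mul, starWord_single, map_mul]

/-- Taking adjoints reverses words, so it exchanges the operators at the two ends. This is why a
reversed word of adjoints appears in the theorem. -/
theorem starWord_lp {ψ : D →ₗ[ℂ] ℂ} (hψ : IsTracialState ψ) (a : D) (g : WordFock D) :
    starWord D (lp ψ a g) = rp ψ (star a) (starWord D g) := by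
  induction g using Finsupp.induction_linear with
  | zero => simp
  | add f g hf hg => simp [hf, hg]
  | single f d =>
    have h : Finsupp.single f d = d • word f := by simp [word]
    rw [h, map_smul, starWord_smul, starWord_smul, map_smul]
    congr 1
    cases f with
    | nil => simp [lp, rp, starWord_smul, hψ.map_star]
    | cons x f => simp [lp, rp, starWord_smul, hψ.map_star, ← star_mul]

theorem pvec_starRev {ψ : D →ₗ[ℂ] ℂ} (hψ : IsTracialState ψ) (m : List D) :
    pvec ψ (starRev m) = starWord D (pvec ψ m) := by
  induction m with
  | nil => simp
  | cons a m ih => simp [ih, starWord_lp hψ]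

theorem fpMoment_starRev {ψ : D →ₗ[ℂ] ℂ} (hψ : IsTracialState ψ) (m : List D) :
    fpMoment ψ (starRev m) = conj (fpMoment ψ m) := by
  rw [fpMoment, pvec_starRev hψ, fpMoment]
  induction pvec ψ m using Finsupp.induction_linear with
  | zero => simp
  | add f g hf hg => simp [hf, hg]
  | single f d =>
    have h : Finsupp.single f d = d • word f := by simp [word]
    rw [h, starWord_smul, map_smul, map_smul]
    cases f <;> simp

variable (ψ : D →ₗ[ℂ] ℂ)

omit [Ring D] [StarRing D] [Algebra ℂ D] [StarModule ℂ D] in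
theorem rotate_ofFn {n : ℕ} (G : Fin (n + 1) → D) (k : Fin (n + 1)) :
    (List.ofFn G).rotate k = List.ofFn fun i => G (i + k) := by
  apply List.ext_getElem
  · simp
  · intro i h1 h2
    simp only [List.getElem_rotate, List.getElem_ofFn, List.length_ofFn]
    congr 1

theorem cycInner_cycTensor (a b : D) (f h : List D) :
    cycInner ψ (cycTensor (a :: f)) (cycTensor ((b :: h).map star)) =
      ∑ k : Fin (h.length + 1), alignPair ψ ((b :: h).rotate k) (a :: f) := by
  by_cases e : h.length = f.length
  · obtain ⟨n, h, rfl⟩ : ∃ n, ∃ g : Fin n → D, h = List.ofFn g :=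
      ⟨_, h.get, (List.ofFn_get h).symm⟩
    obtain ⟨f, rfl⟩ : ∃ g : Fin n → D, f = List.ofFn g := by
      rw [List.length_ofFn] at e
      subst e
      exact ⟨f.get, (List.ofFn_get f).symm⟩
    have h1 : a :: List.ofFn f = List.ofFn (Fin.cons a f : Fin (n + 1) → D) := by simp
    have h2 : b :: List.ofFn h = List.ofFn (Fin.cons b h : Fin (n + 1) → D) := by simp
    rw [h1, h2, List.map_ofFn, cycTensor_ofFn, cycTensor_ofFn, cycInner_circular]
    -- The rotations on the two sides are indexed by `Fin` types whose sizes agree only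
    -- propositionally.
    refine Fintype.sum_equiv (finCongr (by simp)) _ _ fun k => ?_
    have := rotate_ofFn (Fin.cons b h : Fin (n + 1) → D) k
    simp only [finCongr_apply, Fin.val_cast, this, alignPair_ofFn]
    simp
  · rw [cycTensor, cycTensor, cycInner_circular_of_ne ψ (by simpa using fun h => e h.symm)]
    symm
    refine Finset.sum_eq_zero fun k _ => alignPair_of_length_ne ψ ?_
    simpa using e

variable {ψ}

/-- Either `a` faces `b`, or `a` faces a letter `y` of the second circle while `b` faces a letter
`z` of the first. In the second case these two spokes cut the annulus into two strips, one pairing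
`u` with `s`, the other `v` with `w`. -/
theorem cycInner_cycTensor_starRev (htr : ∀ a b, ψ (a * b) = ψ (b * a)) (a b : D)
    (f g : List D) :
    cycInner ψ (cycTensor (a :: f)) (cycTensor (star b :: starRev g)) =
      ψ (a * b) * alignPair ψ g.reverse f +
      splitSum (fun u y v => splitSum (fun s z w =>
        ψ (a * y) * (ψ (z * b) * (alignPair ψ u.reverse s * alignPair ψ v.reverse w))) f) g := by
  have h : star b :: starRev g = (b :: g.reverse).map star := by simp [starRev]
  rw [h, cycInner_cycTensor, sum_rotate (fun l => alignPair ψ l (a :: f)), splitSum_reverse]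
  simp only [List.cons_append, alignPair, alignPair_append_cons, mul_splitSum, htr b a]
  congr 1
  exact splitSum_congr fun u y v _ => splitSum_congr fun s z w _ => by rw [htr a y, htr z b]

theorem cycInner_cycCre (hψ : IsTracialState ψ) (a b : D) (l m : List D) :
    cycInner ψ (cycCre a (pvec ψ l)) (cycCre (star b) (pvec ψ (starRev m))) =
      ψ (a * b) * fpMoment ψ (m ++ l) + splitSum (fun u y v => splitSum (fun s z w =>
        leftClosed ψ (a * y) v w * rightClosed ψ (z * b) s u) l) m := by
  set B : WordFock D →ₗ[ℂ] WordFock D →ₗ[ℂ] ℂ := wordLift fun f => wordLift fun g =>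
    splitSum (fun u y v => splitSum (fun s z w =>
      ψ (a * y) * (ψ (z * b) * (alignPair ψ u.reverse s * alignPair ψ v.reverse w))) f) g with hB
  -- Both sides are linear in `F` and `G`, since the conjugation in `starWord` cancels that of the
  -- inner product; so it is enough to treat words.
  have key (F G : WordFock D) : cycInner ψ (cycCre a F) (cycCre (star b) (starWord D G)) =
      ψ (a * b) * revPair ψ G F + B F G := by
    induction G using Finsupp.induction_linear with
    | zero => simp
    | add G G' h h' => simp [h, h']; ring
    | single g d =>
      have h : Finsupp.single g d = d • word g := by simp [word]
      rw [h, starWord_smul, map_smul, map_smulₛₗ, map_smul, map_smul, LinearMap.smul_apply,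
        starWord_word]
      suffices h : cycInner ψ (cycCre a F) (cycCre (star b) (word (starRev g))) =
          ψ (a * b) * revPair ψ (word g) F + B F (word g) by
        rw [h]; simp; ring
      refine LinearMap.congr_fun
        (f := ((cycInner ψ).flip (cycCre (star b) (word (starRev g)))) ∘ₗ cycCre a)
        (g := ψ (a * b) • revPair ψ (word g) + B.flip (word g))
        (wordFock_hom_ext fun f => ?_) F
      simp [hB, cycInner_cycTensor_starRev hψ.tracial]
  rw [pvec_starRev hψ, key, revPair_pvec ψ hψ.tracial, fpMoment_append_comm hψ.tracial,
    splitSum_splitSum_pvec ψ hψ.tracial a b B (fun f g => by simp [hB])]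

end Inner

/-! ### The annular recursion on the Fock space -/

section Recursion

variable {D : Type*} [Ring D] [Algebra ℂ D]

/-- The recursion of the second order moments: the letter `a` of the first circle is alone in its
block, or followed by another letter of the first circle, or by a letter of the second circle. -/
structure IsAnnularMoment (ψ : D →ₗ[ℂ] ℂ) (F : List D → List D → ℂ) : Prop where
  nil : ∀ b, F [] b = 0
  cons : ∀ a l b, F (a :: l) b = ψ a * F l b +
    splitSum (fun u y v => fpMoment ψ u * F (a * y :: v) b + fpMoment ψ (a * y :: v) * F u b) l +
    splitSum (fun u y v => fpMoment ψ (a * y :: (v ++ u ++ l))) b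

variable {ψ : D →ₗ[ℂ] ℂ} (htr : ∀ a b, ψ (a * b) = ψ (b * a))

include htr

/-- `rightClosed` collects the cases in which the letter following `x` lies in `s` or does not
exist; the sum collects those in which it lies in `u`. The left version is the mirror image. -/
theorem fpMoment_eq_rightClosed (x : D) (u s : List D) : fpMoment ψ (x :: (u ++ s)) =
    rightClosed ψ x s u +
      splitSum (fun u' y v => fpMoment ψ u' * fpMoment ψ (x * y :: (v ++ s))) u := by
  rw [fpMoment_cons htr, splitSum_append, rightClosed]
  simp only [mul_comm (fpMoment ψ (u ++ _))]
  ring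

theorem fpMoment_eq_leftClosed (x : D) (v w : List D) : fpMoment ψ (x :: (v ++ w)) =
    leftClosed ψ x v w +
      splitSum (fun w' y v' => fpMoment ψ v' * fpMoment ψ (y * x :: (v ++ w'))) w := by
  rw [← fpMoment_concat_eq_cons htr, fpMoment_concat htr, splitSum_append, leftClosed]
  simp only [mul_comm (fpMoment ψ (_ ++ w)), ← fpMoment_concat_eq_cons htr]
  simp only [List.append_assoc]
  ring

variable [StarRing D] [StarModule ℂ D]

omit htr

variable (hψ : IsTracialState ψ)

include hψ

theorem openVec_starRev (b : D) (m : List D) : openVec ψ (star b) (starRev m) =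
    cycCre (star b) (pvec ψ (starRev m)) +
      splitSum (fun u y v => conj (fpMoment ψ u) • openVec ψ (star (b * y)) (starRev v)) m := by
  rw [openVec_eq hψ.tracial, splitSum_starRev]
  simp only [fpMoment_starRev hψ, star_mul]

/-- Unfolding the second vector by `openVec_eq` leaves `cycInner_cycCre` and shorter instances of
the claim. The latter supply the configurations in which the block of `b` has a further letter in
`m`, and so complete scalars and `rightClosed` to full moments. -/
theorem cycInner_cycCre_openVec (a b : D) (l m : List D) :
    cycInner ψ (cycCre a (pvec ψ l)) (openVec ψ (star b) (starRev m)) =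
      ψ (a * b) * fpMoment ψ (m ++ l) +
      splitSum (fun u y v => fpMoment ψ (y * a * b :: u) * fpMoment ψ (v ++ l)) m +
      splitSum (fun u y v => splitSum (fun s z w =>
        fpMoment ψ (z * b :: (u ++ s)) * leftClosed ψ (a * y) v w) l) m := by
  induction hn : m.length using Nat.strong_induction_on generalizing b m with
  | _ n ih =>
    have h1 : splitSum (fun u y v => fpMoment ψ u *
        cycInner ψ (cycCre a (pvec ψ l)) (openVec ψ (star (b * y)) (starRev v))) m =
        splitSum (fun u y v => ψ (y * a * b) * fpMoment ψ u * fpMoment ψ (v ++ l)) m +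
        splitSum (fun u y v => splitSum (fun u' y' v' => fpMoment ψ u' *
          fpMoment ψ (y * a * b * y' :: v')) u * fpMoment ψ (v ++ l)) m +
        splitSum (fun u y v => splitSum (fun s z w => splitSum (fun u' y' v' => fpMoment ψ u' *
          fpMoment ψ (z * b * y' :: (v' ++ s))) u * leftClosed ψ (a * y) v w) l) m := by
      simp only [splitSum_mul]
      have e (u : List D) (y : D) (v : List D) : splitSum (fun s z w => splitSum (fun u' y' v' =>
          fpMoment ψ u' * fpMoment ψ (z * b * y' :: (v' ++ s)) * leftClosed ψ (a * y) v w) u) l =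
        splitSum (fun u' y' v' => splitSum (fun s z w =>
          fpMoment ψ u' * fpMoment ψ (z * b * y' :: (v' ++ s)) * leftClosed ψ (a * y) v w) l) u :=
        splitSum_comm _ _ _
      simp only [e]
      -- The sums are reordered so that the letter chosen by the recursion is outermost; the
      -- induction hypothesis then applies term by term.
      rw [splitSum_splitSum_left, splitSum_splitSum_left, ← splitSum_add, ← splitSum_add]
      refine splitSum_congr fun u y v huv => ?_
      rw [ih v.length (by subst hn; simp [huv]; omega) (b * y) v rfl]
      simp only [mul_add, mul_splitSum]
      congr 1
      · congr 1
        · rw [← mul_assoc a, hψ.tracial (a * b) y, ← mul_assoc y]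
          ring
        · refine splitSum_congr fun u' y' v' _ => ?_
          simp only [mul_assoc]
      · refine splitSum_congr fun u' y' v' _ => splitSum_congr fun s z w _ => ?_
        simp only [mul_assoc]
    rw [openVec_starRev hψ, map_add, cycInner_cycCre hψ, map_splitSum]
    simp only [map_smulₛₗ, Complex.conj_conj, smul_eq_mul]
    rw [h1]
    have h2 : splitSum (fun u y v => fpMoment ψ (y * a * b :: u) * fpMoment ψ (v ++ l)) m =
        splitSum (fun u y v => ψ (y * a * b) * fpMoment ψ u * fpMoment ψ (v ++ l)) m +
        splitSum (fun u y v => splitSum (fun u' y' v' => fpMoment ψ u' *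
          fpMoment ψ (y * a * b * y' :: v')) u * fpMoment ψ (v ++ l)) m := by
      rw [← splitSum_add]
      refine splitSum_congr fun u y v _ => ?_
      rw [fpMoment_cons hψ.tracial, add_mul]
    have h3 : splitSum (fun u y v => splitSum (fun s z w =>
        fpMoment ψ (z * b :: (u ++ s)) * leftClosed ψ (a * y) v w) l) m =
        splitSum (fun u y v => splitSum (fun s z w =>
          leftClosed ψ (a * y) v w * rightClosed ψ (z * b) s u) l) m +
        splitSum (fun u y v => splitSum (fun s z w => splitSum (fun u' y' v' => fpMoment ψ u' *
          fpMoment ψ (z * b * y' :: (v' ++ s))) u * leftClosed ψ (a * y) v w) l) m := by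
      rw [← splitSum_add]
      refine splitSum_congr fun u y v _ => ?_
      rw [← splitSum_add]
      refine splitSum_congr fun s z w _ => ?_
      rw [fpMoment_eq_rightClosed hψ.tracial]
      ring
    rw [h2, h3]
    ring

/-- The same induction on the other circle completes `leftClosed` to full moments. What remains has
a geometric reading: if `a` is followed by `b` the annulus opens to one disc; otherwise `a` is
followed by `y`, `b` is preceded by `z`, and the annulus falls into two discs. -/
theorem cycInner_openVec_openVec (a b : D) (l m : List D) :
    cycInner ψ (openVec ψ a l) (openVec ψ (star b) (starRev m)) =
      fpMoment ψ (a * b :: (m ++ l)) +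
      splitSum (fun u y v => splitSum (fun s z w =>
        fpMoment ψ (z * b :: (u ++ s)) * fpMoment ψ (a * y :: (v ++ w))) l) m := by
  induction hn : l.length using Nat.strong_induction_on generalizing a l with
  | _ n ih =>
    have h1 : splitSum (fun u y v => fpMoment ψ v *
        cycInner ψ (openVec ψ (y * a) u) (openVec ψ (star b) (starRev m))) l =
        splitSum (fun u y v => fpMoment ψ v * fpMoment ψ (y * (a * b) :: (m ++ u))) l +
        splitSum (fun u y v => splitSum (fun s z w => splitSum (fun w' y' v' =>
          fpMoment ψ (z * b :: (u ++ s)) *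
          (fpMoment ψ v' * fpMoment ψ (y' * (a * y) :: (v ++ w')))) w) l) m := by
      have e (u : List D) (y : D) (v : List D) : splitSum (fun s z w => splitSum (fun w' y' v' =>
          fpMoment ψ (z * b :: (u ++ s)) *
          (fpMoment ψ v' * fpMoment ψ (y' * (a * y) :: (v ++ w')))) w) l =
          splitSum (fun t y' v' => splitSum (fun s z w' => fpMoment ψ (z * b :: (u ++ s)) *
          (fpMoment ψ v' * fpMoment ψ (y' * (a * y) :: (v ++ w')))) t) l :=
        (splitSum_splitSum_left (fun s z w' y' v' => fpMoment ψ (z * b :: (u ++ s)) *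
          (fpMoment ψ v' * fpMoment ψ (y' * (a * y) :: (v ++ w')))) l).symm
      simp only [e]
      rw [splitSum_comm, ← splitSum_add]
      refine splitSum_congr fun u y v huv => ?_
      rw [ih u.length (by subst hn; simp [huv]) (y * a) u rfl]
      simp only [mul_add, mul_splitSum, mul_assoc]
      congr 1
      refine splitSum_congr fun u' y' v' _ => splitSum_congr fun s z w _ => ?_
      ring
    rw [openVec_eq hψ.tracial, map_add, LinearMap.add_apply, cycInner_cycCre_openVec hψ,
      map_splitSum]
    -- Evaluation at a fixed vector is additive on conjugate-linear functionals, hence passes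
    -- through `splitSum`.
    have h0 : (splitSum (fun u y v => cycInner ψ (fpMoment ψ v • openVec ψ (y * a) u)) l)
        (openVec ψ (star b) (starRev m)) = splitSum (fun u y v => fpMoment ψ v *
        cycInner ψ (openVec ψ (y * a) u) (openVec ψ (star b) (starRev m))) l := by
      refine (map_splitSum (M' := ℂ) (AddMonoidHom.mk' (fun T : FockCyc D →ₗ⋆[ℂ] ℂ =>
        T (openVec ψ (star b) (starRev m))) fun _ _ => rfl) _ l).trans ?_
      exact splitSum_congr fun u y v _ => by simp
    rw [h0, h1, fpMoment_eq_leftClosed hψ.tracial (a * b) m l, leftClosed]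
    have h2 : splitSum (fun s z t => fpMoment ψ (s ++ [z * (a * b)]) * fpMoment ψ (t ++ l)) m =
        splitSum (fun u y v => fpMoment ψ (y * a * b :: u) * fpMoment ψ (v ++ l)) m :=
      splitSum_congr fun u y v _ => by rw [fpMoment_concat_eq_cons hψ.tracial, mul_assoc]
    have h3 : splitSum (fun u y v => splitSum (fun s z w =>
        fpMoment ψ (z * b :: (u ++ s)) * fpMoment ψ (a * y :: (v ++ w))) l) m =
        splitSum (fun u y v => splitSum (fun s z w =>
        fpMoment ψ (z * b :: (u ++ s)) * leftClosed ψ (a * y) v w) l) m +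
        splitSum (fun u y v => splitSum (fun s z w => splitSum (fun w' y' v' =>
          fpMoment ψ (z * b :: (u ++ s)) *
          (fpMoment ψ v' * fpMoment ψ (y' * (a * y) :: (v ++ w')))) w) l) m := by
      rw [← splitSum_add]
      refine splitSum_congr fun u y v _ => ?_
      rw [← splitSum_add]
      refine splitSum_congr fun s z w _ => ?_
      rw [fpMoment_eq_leftClosed hψ.tracial (a * y), mul_add, mul_splitSum]
    rw [h2, h3]
    ring

/-- Reversal puts the adjoint of `b` at the end; rotation invariance brings it back to the front,
where `cvec_cons` applies. -/
theorem cvec_starRev_cons (b : D) (m : List D) : cvec ψ (starRev (b :: m)) =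
    conj (ψ b) • cvec ψ (starRev m) +
    splitSum (fun u y v => conj (fpMoment ψ v) • cvec ψ (starRev (y * b :: u)) +
      conj (fpMoment ψ (y * b :: u)) • cvec ψ (starRev v)) m +
    openVec ψ (star b) (starRev m) := by
  rw [starRev_cons, cvec_concat hψ.tracial, cvec_cons, hψ.map_star, splitSum_starRev]
  refine congrArg (fun x => conj (ψ b) • cvec ψ (starRev m) + x + openVec ψ (star b) (starRev m))
    (splitSum_congr fun u y v _ => ?_)
  rw [← fpMoment_starRev hψ, ← fpMoment_starRev hψ, starRev_cons, cvec_concat hψ.tracial,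
    fpMoment_concat_eq_cons hψ.tracial, star_mul]

/-- Since `a` ends its open block, its successor `y` is on the second circle, and cutting along this
spoke leaves a disc with boundary word `a * y, v, u, l`. The induction removes the first letter of
the second circle from both sides. -/
theorem cycInner_openVec_cvec (a : D) (l b : List D) :
    cycInner ψ (openVec ψ a l) (cvec ψ (starRev b)) =
      splitSum (fun u y v => fpMoment ψ (a * y :: (v ++ u ++ l))) b := by
  have htr := hψ.tracial
  induction hn : b.length using Nat.strong_induction_on generalizing b with
  | _ n ih =>
    cases b with
    | nil => simp
    | cons b m =>
      rw [cvec_starRev_cons hψ, map_add, map_add, map_smulₛₗ, Complex.conj_conj,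
        ih m.length (by subst hn; simp) m rfl, map_splitSum, cycInner_openVec_openVec hψ,
        splitSum_cons]
      have h1 : splitSum (fun u y v => cycInner ψ (openVec ψ a l)
          (conj (fpMoment ψ v) • cvec ψ (starRev (y * b :: u)) +
          conj (fpMoment ψ (y * b :: u)) • cvec ψ (starRev v))) m =
          splitSum (fun u y v => fpMoment ψ v * fpMoment ψ (a * y * b :: (u ++ l))) m +
          splitSum (fun u y v => splitSum (fun s z t => fpMoment ψ t *
            fpMoment ψ (a * y :: (s ++ z * b :: (u ++ l)))) v) m +
          splitSum (fun u y v => splitSum (fun s z t => fpMoment ψ (z * b :: s) *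
            fpMoment ψ (a * y :: (v ++ (t ++ l)))) u) m := by
        rw [splitSum_splitSum_left, ← splitSum_splitSum_left (fun u y s z t => fpMoment ψ t *
            fpMoment ψ (a * y :: (s ++ z * b :: (u ++ l)))), ← splitSum_add, ← splitSum_add]
        refine splitSum_congr fun u y v huv => ?_
        rw [map_add, map_smulₛₗ, map_smulₛₗ, Complex.conj_conj, Complex.conj_conj,
          ih _ (by subst hn; simp [huv]) (y * b :: u) rfl,
          ih _ (by subst hn; simp [huv]; omega) v rfl]
        simp [mul_add, mul_splitSum, mul_assoc]
      -- In the disc, the removed letter `b` is alone or has its predecessor in `u`, in `l`, at `a *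
      -- y`, or in `v`: five terms, the one for `l` coming from `cycInner_openVec_openVec`.
      have h2 : splitSum (fun u y v => fpMoment ψ (a * y :: (v ++ b :: u ++ l))) m =
          splitSum (fun u y v => ψ b * fpMoment ψ (a * y :: (v ++ u ++ l))) m +
          splitSum (fun u y v => splitSum (fun s z t => fpMoment ψ (z * b :: s) *
            fpMoment ψ (a * y :: (v ++ (t ++ l)))) u) m +
          splitSum (fun u y v => splitSum (fun s z w =>
            fpMoment ψ (z * b :: (u ++ s)) * fpMoment ψ (a * y :: (v ++ w))) l) m +
          splitSum (fun u y v => fpMoment ψ v * fpMoment ψ (a * y * b :: (u ++ l))) m +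
          splitSum (fun u y v => splitSum (fun s z t => fpMoment ψ t *
            fpMoment ψ (a * y :: (s ++ z * b :: (u ++ l)))) v) m := by
        simp only [← splitSum_add]
        refine splitSum_congr fun u y v _ => ?_
        have e1 : fpMoment ψ (a * y :: (v ++ b :: u ++ l)) =
            fpMoment ψ ((u ++ (l ++ a * y :: v)) ++ [b]) := by
          have := fpMoment_append_comm htr (a * y :: v ++ [b]) (u ++ l)
          simpa using this
        have e2 (r : List D) : fpMoment ψ (r ++ (l ++ a * y :: v)) =
            fpMoment ψ (a * y :: (v ++ (r ++ l))) := by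
          have := fpMoment_append_comm htr (a * y :: v) (r ++ l)
          simpa using this.symm
        have e3 (r : List D) : fpMoment ψ (r ++ a * y :: v) =
            fpMoment ψ (a * y :: (v ++ r)) := by
          have := fpMoment_append_comm htr (a * y :: v) r
          simpa using this.symm
        have e4 (s : List D) (z : D) : fpMoment ψ (u ++ (l ++ (a * y :: s ++ [z * b]))) =
            fpMoment ψ (a * y :: (s ++ z * b :: (u ++ l))) := by
          have := fpMoment_append_comm htr (a * y :: s ++ [z * b]) (u ++ l)
          simpa using this.symm
        have e5 (r : List D) (z : D) : fpMoment ψ (u ++ (r ++ [z])) =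
            fpMoment ψ (z :: (u ++ r)) := by
          rw [← List.append_assoc, fpMoment_concat_eq_cons htr]
        rw [e1, fpMoment_concat htr, splitSum_append, splitSum_append, splitSum_cons, e2]
        simp only [e2, e3, e4, e5, fpMoment_concat_eq_cons htr, List.append_nil, mul_assoc,
          List.append_assoc]
        simp only [mul_comm (fpMoment ψ (a * y :: _))]
        ring
      rw [h1, h2, ← mul_splitSum]
      simp
      ring

/-- The inner products of the vectors `c p(a₁) ⋯ p(aₙ) Ω` satisfy the annular recursion. -/
theorem isAnnularMoment_cycInner :
    IsAnnularMoment ψ fun l b => cycInner ψ (cvec ψ l) (cvec ψ (starRev b)) where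
  nil b := by simp
  cons a l b := by
    rw [← cycInner_openVec_cvec hψ, cvec_cons]
    simp only [map_add, map_smul, LinearMap.add_apply, LinearMap.smul_apply, smul_eq_mul]
    congr 2
    refine (map_splitSum (M' := ℂ) ((AddMonoidHom.mk' (fun T : FockCyc D →ₗ⋆[ℂ] ℂ =>
        T (cvec ψ (starRev b))) fun _ _ => rfl).comp (cycInner ψ).toAddMonoidHom) _ l).trans ?_
    exact splitSum_congr fun u y v _ => by simp

end Recursion

/-! ### Cycles of permutations -/

section Cycles

variable {α : Type*}

theorem sameCycle_apply_eq {β : Type*} {σ : Equiv.Perm α} {r : α → β} (h : ∀ x, r (σ x) = r x)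
    {x y : α} (hxy : σ.SameCycle x y) : r x = r y := by
  obtain ⟨i, rfl⟩ := hxy
  induction i using Int.induction_on with
  | zero => rfl
  | succ i ih => rw [ih, add_comm, zpow_add, zpow_one, Equiv.Perm.mul_apply, h]
  | pred i ih =>
    rw [ih, ← h ((σ ^ (-(i : ℤ) - 1)) x), ← Equiv.Perm.mul_apply, ← zpow_one_add]
    congr 3
    ring

variable [DecidableEq α]

theorem swap_mul_swap_mul_self (x k : α) (σ : Equiv.Perm α) :
    Equiv.swap x k * (Equiv.swap x k * σ) = σ := by
  rw [← mul_assoc, Equiv.swap_mul_self, one_mul]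

/-- One step of `γ` differs from one step of the product only at arrivals in `x` or `k`, and these
two points lie in a common cycle by assumption. -/
theorem sameCycle_swap_mul_of_sameCycle {γ : Equiv.Perm α} {x k y z : α}
    (h : (Equiv.swap x k * γ).SameCycle x k) (hyz : γ.SameCycle y z) :
    (Equiv.swap x k * γ).SameCycle y z := by
  set γ' := Equiv.swap x k * γ with hγ'
  have key (y : α) : γ'.SameCycle y (γ y) := by
    have h1 : γ'.SameCycle y (γ' y) := Equiv.Perm.sameCycle_apply_right.2 (.refl _ _)
    have h2 : γ' y = Equiv.swap x k (γ y) := rfl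
    rw [h2] at h1
    by_cases hx : γ y = x
    · rw [hx, Equiv.swap_apply_left] at h1
      rw [hx]
      exact h1.trans h.symm
    by_cases hk : γ y = k
    · rw [hk, Equiv.swap_apply_right] at h1
      rw [hk]
      exact h1.trans h
    rwa [Equiv.swap_apply_of_ne_of_ne hx hk] at h1
  have := sameCycle_apply_eq (r := fun y => (Quotient.mk (Equiv.Perm.SameCycle.setoid γ') y))
    (fun y => Quotient.sound (key y).symm) hyz
  exact Quotient.exact this

variable [Fintype α]

/-- Starting at `x`, the product follows `γ` until the cycle is about to return to `x`; the
transposition then sends it to `k`. -/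
theorem sameCycle_swap_mul {γ : Equiv.Perm α} {x k : α} (h : ¬ γ.SameCycle x k) :
    (Equiv.swap x k * γ).SameCycle x k := by
  set γ' := Equiv.swap x k * γ with hγ'
  have key (j : ℕ) : γ'.SameCycle x ((γ ^ j) x) := by
    induction j with
    | zero => exact .refl _ _
    | succ j ih =>
      have h1 : γ'.SameCycle x (γ' ((γ ^ j) x)) := Equiv.Perm.sameCycle_apply_right.2 ih
      have h2 : γ' ((γ ^ j) x) = Equiv.swap x k ((γ ^ (j + 1)) x) := by
        rw [pow_succ']; rfl
      by_cases hx : (γ ^ (j + 1)) x = x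
      · rw [hx]
      have hk : (γ ^ (j + 1)) x ≠ k := fun e => h ⟨(j + 1 : ℕ), by rw [zpow_natCast, e]⟩
      rwa [h2, Equiv.swap_apply_of_ne_of_ne hx hk] at h1
  obtain ⟨j, -, hj⟩ : ∃ j < orderOf γ, (γ ^ j) x = γ⁻¹ x :=
    Equiv.Perm.SameCycle.exists_pow_eq' ⟨-1, by simp⟩
  have h1 := key j
  rw [hj] at h1
  have h2 : γ' (γ⁻¹ x) = k := by simp [hγ']
  rw [← h2]
  exact Equiv.Perm.sameCycle_apply_right.2 h1

-- Identifying the class of `k` with that of `x` gives a function invariant under both `γ` and the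
-- transposition, hence constant on the cycles of the product.
open Classical in
theorem sameCycle_of_sameCycle_swap_mul {γ : Equiv.Perm α} {x k y z : α}
    (h : (Equiv.swap x k * γ).SameCycle y z) :
    γ.SameCycle y z ∨ ((γ.SameCycle y x ∨ γ.SameCycle y k) ∧
      (γ.SameCycle z x ∨ γ.SameCycle z k)) := by
  set r : α → Quotient (Equiv.Perm.SameCycle.setoid γ) := fun y =>
    if γ.SameCycle y k then Quotient.mk _ x else Quotient.mk _ y with hr
  have hrx : r x = Quotient.mk _ x := by simp [hr]
  have hrk : r k = Quotient.mk _ x := if_pos (.refl _ _)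
  have hs (y : α) : r (Equiv.swap x k y) = r y := by
    by_cases hx : y = x
    · rw [hx, Equiv.swap_apply_left, hrk, hrx]
    by_cases hk : y = k
    · rw [hk, Equiv.swap_apply_right, hrk, hrx]
    rw [Equiv.swap_apply_of_ne_of_ne hx hk]
  have hγ (y : α) : r (γ y) = r y := by
    have e : (Quotient.mk (Equiv.Perm.SameCycle.setoid γ) (γ y)) = Quotient.mk _ y :=
      Quotient.sound (Equiv.Perm.sameCycle_apply_left.2 (.refl _ _))
    simp only [hr, Equiv.Perm.sameCycle_apply_left, e]
  have key : r y = r z := sameCycle_apply_eq (fun y => by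
    rw [Equiv.Perm.mul_apply, hs, hγ]) h
  simp only [hr] at key
  by_cases hy : γ.SameCycle y k <;> by_cases hz : γ.SameCycle z k
  · exact Or.inl (hy.trans hz.symm)
  · rw [if_pos hy, if_neg hz] at key
    exact Or.inr ⟨Or.inr hy, Or.inl (Equiv.Perm.SameCycle.symm (Quotient.exact key))⟩
  · rw [if_neg hy, if_pos hz] at key
    exact Or.inr ⟨Or.inl (Quotient.exact key), Or.inr hz⟩
  · rw [if_neg hy, if_neg hz] at key
    exact Or.inl (Quotient.exact key)

/-- Two cycles become one and the others are unchanged. Omitting the class of `k` makes this a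
bijection, used for counting cycles and for comparing products over them. -/
theorem bijective_merge {γ : Equiv.Perm α} {x k : α} (h : ¬ γ.SameCycle x k) :
    Function.Bijective
      (fun c : {c : Quotient (Equiv.Perm.SameCycle.setoid γ) // c ≠ Quotient.mk _ k} =>
        (Quotient.map id (fun _ _ => sameCycle_swap_mul_of_sameCycle (sameCycle_swap_mul h)) c.1 :
          Quotient (Equiv.Perm.SameCycle.setoid (Equiv.swap x k * γ)))) := by
  constructor
  · rintro ⟨c, hc⟩ ⟨d, hd⟩ e
    induction c using Quotient.inductionOn with
    | h y =>
    induction d using Quotient.inductionOn with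
    | h z =>
    have hy : ¬ γ.SameCycle y k := fun e => hc (Quotient.sound e)
    have hz : ¬ γ.SameCycle z k := fun e => hd (Quotient.sound e)
    have e' : (Equiv.swap x k * γ).SameCycle y z := Quotient.exact e
    refine Subtype.ext (Quotient.sound ?_)
    rcases sameCycle_of_sameCycle_swap_mul e' with e | ⟨e1 | e1, e2 | e2⟩
    exacts [e, e1.trans e2.symm, absurd e2 hz, absurd e1 hy, absurd e1 hy]
  · intro c
    induction c using Quotient.inductionOn with
    | h y =>
    by_cases hy : γ.SameCycle y k
    · refine ⟨⟨Quotient.mk _ x, fun e => h (Quotient.exact e)⟩, Quotient.sound ?_⟩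
      exact (sameCycle_swap_mul h).trans
        (sameCycle_swap_mul_of_sameCycle (sameCycle_swap_mul h) hy.symm)
    · exact ⟨⟨Quotient.mk _ y, fun e => hy (Quotient.exact e)⟩, rfl⟩

theorem numCycles_swap_mul {γ : Equiv.Perm α} {x k : α} (h : ¬ γ.SameCycle x k) :
    numCycles (Equiv.swap x k * γ) + 1 = numCycles γ := by
  classical
  rw [numCycles, numCycles, ← Nat.card_congr (Equiv.ofBijective _ (bijective_merge h)),
    Nat.card_eq_fintype_card, Nat.card_eq_fintype_card, Fintype.card_subtype_compl,
    Fintype.card_subtype_eq]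
  exact Nat.sub_add_cancel (Fintype.card_pos_iff.2 ⟨Quotient.mk _ k⟩)

theorem numCycles_swap_mul_le (γ : Equiv.Perm α) (x k : α) :
    numCycles (Equiv.swap x k * γ) ≤ numCycles γ + 1 := by
  by_cases h : γ.SameCycle x k
  · by_cases h' : (Equiv.swap x k * γ).SameCycle x k
    · refine le_trans ?_ (Nat.le_succ _)
      refine Nat.card_le_card_of_surjective
        (Quotient.map id fun _ _ => sameCycle_swap_mul_of_sameCycle h') ?_
      exact fun c => Quotient.inductionOn c fun y => ⟨Quotient.mk _ y, rfl⟩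
    · have := numCycles_swap_mul h'
      rw [swap_mul_swap_mul_self] at this
      exact this.ge
  · have := numCycles_swap_mul h
    omega

omit [DecidableEq α] [Fintype α] in
theorem eq_of_sameCycle_of_fixed {σ : Equiv.Perm α} {x y : α} (hx : σ x = x)
    (h : σ.SameCycle x y) : y = x := by
  obtain ⟨i, rfl⟩ := h
  exact Equiv.Perm.zpow_apply_eq_self_of_apply_eq_self hx i

/-- Removing a point from its cycle. -/
theorem numCycles_swap_apply_mul {σ : Equiv.Perm α} {x : α} (h : σ x ≠ x) :
    numCycles (Equiv.swap x (σ x) * σ) = numCycles σ + 1 := by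
  have hx : (Equiv.swap x (σ x) * σ) x = x := by simp
  have := numCycles_swap_mul (γ := Equiv.swap x (σ x) * σ) (x := x) (k := σ x)
    fun e => h (eq_of_sameCycle_of_fixed hx e)
  rw [swap_mul_swap_mul_self] at this
  exact this.symm

omit [DecidableEq α] in
@[simp]
theorem numCycles_one : numCycles (1 : Equiv.Perm α) = Fintype.card α := by
  rw [numCycles, ← Nat.card_eq_fintype_card]
  refine (Nat.card_congr (Equiv.ofBijective (Quotient.mk _) ⟨fun x y h => ?_, ?_⟩)).symm
  · exact (eq_of_sameCycle_of_fixed rfl (Quotient.exact h)).symm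
  · exact fun c => Quotient.exists_rep c

/-- `#(σ) + #(σ⁻¹ γ)`, the quantity governing the geodesic condition. -/
def geod (σ γ : Equiv.Perm α) : ℕ := numCycles σ + numCycles (σ⁻¹ * γ)

/-- The transposition cancels in `σ⁻¹ γ`, so only the number of cycles of `σ` changes, and it grows
because `x` becomes a fixed point. -/
theorem geod_swap (σ γ : Equiv.Perm α) {x : α} (h : σ x ≠ x) :
    geod (Equiv.swap x (σ x) * σ) (Equiv.swap x (σ x) * γ) = geod σ γ + 1 := by
  have e : (Equiv.swap x (σ x) * σ)⁻¹ * (Equiv.swap x (σ x) * γ) = σ⁻¹ * γ := by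
    rw [mul_inv_rev, Equiv.swap_inv, mul_assoc, swap_mul_swap_mul_self]
  rw [geod, e, numCycles_swap_apply_mul h, geod]
  ring

/-- As `σ` fixes `x`, the transposition can be moved past `σ⁻¹`, where it removes `x` from its cycle
in `σ⁻¹ γ`. -/
theorem geod_swap_right (σ γ : Equiv.Perm α) {x : α} (hσ : σ x = x) (h : γ x ≠ x) :
    geod σ (Equiv.swap x (γ x) * γ) = geod σ γ + 1 := by
  have hx : σ⁻¹ x = x := by rw [Equiv.Perm.inv_eq_iff_eq, hσ]
  have e : σ⁻¹ * (Equiv.swap x (γ x) * γ) =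
      Equiv.swap x ((σ⁻¹ * γ) x) * (σ⁻¹ * γ) := by
    rw [Equiv.Perm.mul_apply, ← mul_assoc, ← mul_assoc, Equiv.mul_swap_eq_swap_mul, hx]
  rw [geod, e, numCycles_swap_apply_mul, geod, add_assoc]
  rw [Equiv.Perm.mul_apply, ne_eq, Equiv.Perm.inv_eq_iff_eq, hσ]
  exact h

/-- Shrinking the support of `σ` point by point raises `geod` by exactly one and the number of
cycles of `γ` by at most one per step. -/
theorem geod_le (σ γ : Equiv.Perm α) : geod σ γ ≤ Fintype.card α + numCycles γ := by
  induction hn : σ.support.card using Nat.strong_induction_on generalizing σ γ with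
  | _ n ih =>
    by_cases h : ∃ x, σ x ≠ x
    · obtain ⟨x, hx⟩ := h
      have h1 := ih _ (by
        rw [← hn]
        exact Equiv.Perm.card_support_swap_mul hx) (Equiv.swap x (σ x) * σ)
        (Equiv.swap x (σ x) * γ) rfl
      have h2 := geod_swap σ γ hx
      have h3 := numCycles_swap_mul_le γ x (σ x)
      omega
    · have : σ = 1 := by
        push Not at h
        exact Equiv.ext h
      simp [this, geod]

/-- When `σ` connects two cycles of `γ`, the same step merges them: `geod` rises while the bound
drops, a total loss of two. -/
theorem geod_of_not_sameCycle {σ γ : Equiv.Perm α} {x : α} (h : ¬ γ.SameCycle x (σ x)) :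
    geod σ γ + 2 ≤ Fintype.card α + numCycles γ := by
  have hx : σ x ≠ x := fun e => h (by rw [e])
  have h1 := geod_le (Equiv.swap x (σ x) * σ) (Equiv.swap x (σ x) * γ)
  have h2 := geod_swap σ γ hx
  have h3 := numCycles_swap_mul h
  omega

/-- Permutations satisfying the geodesic condition preserve the cycles. -/
theorem sameCycle_of_geod_eq {σ γ : Equiv.Perm α}
    (h : geod σ γ = Fintype.card α + numCycles γ) (x : α) : γ.SameCycle x (σ x) := by
  by_contra hx
  have := geod_of_not_sameCycle hx
  omega

/-- A permutation of annular type that connects the cycles of `x` and `σ x` preserves all other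
cycles. -/
theorem sameCycle_of_geod_add_two {σ γ : Equiv.Perm α}
    (h : geod σ γ + 2 = Fintype.card α + numCycles γ) {x : α} (hx : ¬ γ.SameCycle x (σ x))
    (z : α) : γ.SameCycle z (σ z) ∨ ((γ.SameCycle z x ∨ γ.SameCycle z (σ x)) ∧
      (γ.SameCycle (σ z) x ∨ γ.SameCycle (σ z) (σ x))) := by
  have hx' : σ x ≠ x := fun e => hx (by rw [e])
  have h2 := geod_swap σ γ hx'
  have h3 := numCycles_swap_mul hx
  have h4 : geod (Equiv.swap x (σ x) * σ) (Equiv.swap x (σ x) * γ) =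
    Fintype.card α + numCycles (Equiv.swap x (σ x) * γ) := by omega
  have h5 := sameCycle_of_geod_eq h4 z
  -- The points `σ z` and its image under the transposition lie in one cycle of the merged
  -- permutation.
  have h6 : (Equiv.swap x (σ x) * γ).SameCycle z (σ z) := by
    have e := sameCycle_swap_mul hx
    rw [Equiv.Perm.mul_apply] at h5
    by_cases h1 : σ z = x
    · rw [h1, Equiv.swap_apply_left] at h5
      rw [h1]
      exact h5.trans e.symm
    by_cases h1' : σ z = σ x
    · rw [h1', Equiv.swap_apply_right] at h5
      rw [h1']
      exact h5.trans e
    rwa [Equiv.swap_apply_of_ne_of_ne h1 h1'] at h5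
  exact sameCycle_of_sameCycle_swap_mul h6

end Cycles

/-! ### The functional of a permutation and the removal of points -/

section PermFunctional

variable {D : Type*} [Ring D] [Algebra ℂ D] {α : Type*}

/-- `ψ(a_x a_{σ x} ⋯)`, the product running over the cycle of `x`. -/
def cycleVal (ψ : D →ₗ[ℂ] ℂ) (σ : Equiv.Perm α) (a : α → D) (x : α) : ℂ :=
  ψ ((List.range (Function.minimalPeriod σ x)).map fun k => a ((σ ^ k) x)).prod

variable {ψ : D →ₗ[ℂ] ℂ} (htr : ∀ a b, ψ (a * b) = ψ (b * a))

theorem cycleVal_fixed {σ : Equiv.Perm α} (a : α → D) {x : α} (h : σ x = x) :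
    cycleVal ψ σ a x = ψ (a x) := by
  have : Function.minimalPeriod σ x = 1 := Function.minimalPeriod_eq_one_iff_isFixedPt.2 h
  simp [cycleVal, this]

theorem cycleVal_congr {σ τ : Equiv.Perm α} {a b : α → D} {x : α}
    (h : ∀ j : ℕ, (σ ^ j) x = (τ ^ j) x) (hab : ∀ j : ℕ, a ((σ ^ j) x) = b ((σ ^ j) x)) :
    cycleVal ψ σ a x = cycleVal ψ τ b x := by
  have : Function.minimalPeriod σ x = Function.minimalPeriod τ x := by
    rw [Function.minimalPeriod_eq_minimalPeriod_iff]
    intro n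
    simp only [Function.IsPeriodicPt, Function.IsFixedPt, ← Equiv.Perm.coe_pow, h]
  simp only [cycleVal, this, ← h, hab]

variable [Fintype α]

-- Moving the base point one step along the cycle rotates the product, which a trace does not
-- notice.
include htr in
theorem cycleVal_apply (σ : Equiv.Perm α) (a : α → D) (x : α) :
    cycleVal ψ σ a (σ x) = cycleVal ψ σ a x := by
  have hx : x ∈ Function.periodicPts σ := Function.Injective.mem_periodicPts σ.injective x
  have hp : Function.minimalPeriod σ (σ x) = Function.minimalPeriod σ x :=
    Function.minimalPeriod_apply hx
  obtain ⟨q, hq⟩ : ∃ q, Function.minimalPeriod σ x = q + 1 :=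
    Nat.exists_eq_succ_of_ne_zero (Function.minimalPeriod_pos_of_mem_periodicPts hx).ne'
  have h1 : (σ ^ q) (σ x) = x := by
    rw [← Equiv.Perm.mul_apply, ← pow_succ, ← hq, Equiv.Perm.coe_pow]
    exact Function.iterate_minimalPeriod
  rw [cycleVal, hp, cycleVal, hq]
  conv_lhs => rw [List.range_succ]
  conv_rhs => rw [List.range_succ_eq_map]
  simp only [List.map_append, List.prod_append, List.map_cons, List.map_nil, List.prod_cons,
    List.prod_nil, mul_one, h1, List.map_map, pow_zero, Equiv.Perm.one_apply]
  rw [htr]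
  rfl

/-- The factor of `ψ_σ` belonging to a cycle. -/
def classVal (ψ : D →ₗ[ℂ] ℂ) (σ : Equiv.Perm α) (a : α → D)
    (c : Quotient (Equiv.Perm.SameCycle.setoid σ)) : ℂ := cycleVal ψ σ a c.out

include htr in
theorem classVal_mk (σ : Equiv.Perm α) (a : α → D) (x : α) :
    classVal ψ σ a (Quotient.mk _ x) = cycleVal ψ σ a x :=
  sameCycle_apply_eq (cycleVal_apply htr σ a) (Quotient.mk_out (s := Equiv.Perm.SameCycle.setoid σ) x)

open Classical in
theorem permFunctional_eq (σ : Equiv.Perm α) (a : α → D) :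
    permFunctional ψ σ a = ∏ c, classVal ψ σ a c := rfl

variable [DecidableEq α]

include htr in
theorem permFunctional_fixed (h1 : ψ 1 = 1) {σ : Equiv.Perm α} (a : α → D) {x : α} (h : σ x = x) :
    permFunctional ψ σ a = ψ (a x) * permFunctional ψ σ (Function.update a x 1) := by
  classical
  rw [permFunctional_eq, permFunctional_eq,
    Fintype.prod_eq_mul_prod_subtype_ne _ (Quotient.mk (Equiv.Perm.SameCycle.setoid σ) x),
    Fintype.prod_eq_mul_prod_subtype_ne _ (Quotient.mk (Equiv.Perm.SameCycle.setoid σ) x),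
    classVal_mk htr, classVal_mk htr, cycleVal_fixed _ h, cycleVal_fixed _ h, Function.update_self,
    h1, one_mul]
  congr 1
  refine Fintype.prod_congr _ _ ?_
  rintro ⟨c, hc⟩
  induction c using Quotient.inductionOn with
  | h y =>
  rw [classVal_mk htr, classVal_mk htr]
  refine cycleVal_congr (fun _ => rfl) fun j => ?_
  rw [Function.update_of_ne]
  rintro e
  exact hc (Quotient.sound ⟨j, by simpa using e⟩)

omit [Fintype α] in
theorem pow_swap_mul_apply {γ : Equiv.Perm α} {x k : α} {y : α} (n : ℕ)
    (h : ∀ j, j < n → (γ ^ (j + 1)) y ≠ x ∧ (γ ^ (j + 1)) y ≠ k) :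
    ((Equiv.swap x k * γ) ^ n) y = (γ ^ n) y := by
  induction n with
  | zero => rfl
  | succ n ih =>
    rw [pow_succ', Equiv.Perm.mul_apply, ih fun j hj => h j (hj.trans (Nat.lt_succ_self n)),
      Equiv.Perm.mul_apply, ← Equiv.Perm.mul_apply γ, ← pow_succ',
      Equiv.swap_apply_of_ne_of_ne (h n (Nat.lt_succ_self n)).1 (h n (Nat.lt_succ_self n)).2]

/-- Inserting the fixed point `k` before `x` in the cycle of `x`. -/
theorem cycleVal_swap_mul {γ : Equiv.Perm α} {x k : α} (hk : γ k = k) (hxk : x ≠ k) (a : α → D) :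
    cycleVal ψ (Equiv.swap x k * γ) a k =
      cycleVal ψ γ (Function.update (Function.update a x (a k * a x)) k 1) x := by
  set σ := Equiv.swap x k * γ with hσ
  have hx : x ∈ Function.periodicPts γ := Function.Injective.mem_periodicPts γ.injective x
  obtain ⟨q, hq⟩ : ∃ q, Function.minimalPeriod γ x = q + 1 :=
    Nat.exists_eq_succ_of_ne_zero (Function.minimalPeriod_pos_of_mem_periodicPts hx).ne'
  have hper : (γ ^ (q + 1)) x = x := by
    rw [← hq, Equiv.Perm.coe_pow]
    exact Function.iterate_minimalPeriod
  have hne (j : ℕ) : (γ ^ j) x ≠ k := fun e => hxk (by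
    have e' : γ.SameCycle k x := Equiv.Perm.SameCycle.symm ⟨j, by simpa using e⟩
    exact eq_of_sameCycle_of_fixed hk e')
  -- The cycle of `x` has length `q + 1`, so there is no return to `x` before that; up to there `σ`
  -- and `γ` agree on it.
  have hnx (j : ℕ) (hj : j < q) : (γ ^ (j + 1)) x ≠ x := fun e => by
    have : Function.IsPeriodicPt γ (j + 1) x := by
      rw [Function.IsPeriodicPt, Function.IsFixedPt, ← Equiv.Perm.coe_pow, e]
    have := this.minimalPeriod_le (Nat.succ_pos j)
    omega
  have hσk : σ k = x := by simp [hσ, hk]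
  have hpow (j : ℕ) (hj : j ≤ q) : (σ ^ j) x = (γ ^ j) x :=
    pow_swap_mul_apply j fun i hi => ⟨hnx i (by omega), hne _⟩
  have hpow' (j : ℕ) (hj : j ≤ q) : (σ ^ (j + 1)) k = (γ ^ j) x := by
    rw [pow_succ, Equiv.Perm.mul_apply, hσk, hpow j hj]
  have hlast : (σ ^ (q + 2)) k = k := by
    rw [pow_succ', Equiv.Perm.mul_apply, hpow' q le_rfl, hσ, Equiv.Perm.mul_apply,
      ← Equiv.Perm.mul_apply γ, ← pow_succ', hper, Equiv.swap_apply_left]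
  have hmin : Function.minimalPeriod σ k = q + 2 := by
    have h1 : Function.IsPeriodicPt σ (q + 2) k := by
      rw [Function.IsPeriodicPt, Function.IsFixedPt, ← Equiv.Perm.coe_pow, hlast]
    refine le_antisymm (h1.minimalPeriod_le (Nat.succ_pos _)) ?_
    by_contra hlt
    have h2 := h1.minimalPeriod_pos (Nat.succ_pos _)
    obtain ⟨j, hj⟩ : ∃ j, Function.minimalPeriod σ k = j + 1 :=
      Nat.exists_eq_succ_of_ne_zero h2.ne'
    have h3 : (σ ^ (j + 1)) k = k := by
      rw [← hj, Equiv.Perm.coe_pow]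
      exact Function.iterate_minimalPeriod
    rw [hpow' j (by omega)] at h3
    exact hne j h3
  rw [cycleVal, cycleVal, hmin, hq, List.range_succ_eq_map, List.range_succ_eq_map]
  simp only [List.map_cons, List.map_map, List.prod_cons, pow_zero, Equiv.Perm.one_apply,
    Function.comp_def, Nat.succ_eq_add_one]
  have e0 : (γ ^ 0) x = x := rfl
  have e1 : (σ ^ (0 + 1)) k = x := hσk
  rw [e0, e1, Function.update_of_ne hxk, Function.update_self, ← mul_assoc]
  congr 3
  refine List.map_congr_left fun j hj => ?_
  rw [List.mem_range] at hj
  rw [hpow' (j + 1) hj, Function.update_of_ne (hne _), Function.update_of_ne (hnx j hj)]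

-- The cycles correspond by `bijective_merge`. Writing the weight of `k` into that of `x` and
-- leaving `1` at `k` keeps the underlying set of points fixed, so that permutations before and
-- after act on one type.
include htr in
theorem permFunctional_swap_mul (h1 : ψ 1 = 1) {γ : Equiv.Perm α} {x k : α} (hk : γ k = k)
    (hxk : x ≠ k) (a : α → D) : permFunctional ψ (Equiv.swap x k * γ) a =
      permFunctional ψ γ (Function.update (Function.update a x (a k * a x)) k 1) := by
  classical
  have h : ¬ γ.SameCycle x k := fun e => hxk (eq_of_sameCycle_of_fixed hk e.symm)
  rw [permFunctional_eq, permFunctional_eq, ← (bijective_merge h).prod_comp,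
    Fintype.prod_eq_mul_prod_subtype_ne _ (Quotient.mk (Equiv.Perm.SameCycle.setoid γ) k),
    classVal_mk htr, cycleVal_fixed _ hk, Function.update_self, h1, one_mul]
  refine Fintype.prod_congr _ _ ?_
  rintro ⟨c, hc⟩
  induction c using Quotient.inductionOn with
  | h y =>
  have hyk : ¬ γ.SameCycle y k := fun e => hc (Quotient.sound e)
  change classVal ψ _ a (Quotient.mk _ y) = classVal ψ γ _ (Quotient.mk _ y)
  by_cases hy : γ.SameCycle y x
  · have e1 : Quotient.mk (Equiv.Perm.SameCycle.setoid γ) y = Quotient.mk _ x :=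
      Quotient.sound hy
    have e2 : Quotient.mk (Equiv.Perm.SameCycle.setoid (Equiv.swap x k * γ)) y =
        Quotient.mk _ k := Quotient.sound
      ((sameCycle_swap_mul_of_sameCycle (sameCycle_swap_mul h) hy).trans (sameCycle_swap_mul h))
    rw [e1, e2, classVal_mk htr, classVal_mk htr, cycleVal_swap_mul hk hxk]
  · have hne (j : ℕ) : (γ ^ j) y ≠ x ∧ (γ ^ j) y ≠ k :=
      ⟨fun e => hy ⟨j, by simpa using e⟩, fun e => hyk ⟨j, by simpa using e⟩⟩
    have hp (j : ℕ) : ((Equiv.swap x k * γ) ^ j) y = (γ ^ j) y :=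
      pow_swap_mul_apply j fun i _ => hne _
    rw [classVal_mk htr, classVal_mk htr]
    refine cycleVal_congr hp fun j => ?_
    rw [hp, Function.update_of_ne (hne j).2, Function.update_of_ne (hne j).1]

include htr in
/-- Removing the point `x` from its cycle. -/
theorem permFunctional_eq_swap_mul (h1 : ψ 1 = 1) {σ : Equiv.Perm α} {x : α} (hx : σ x ≠ x)
    (a : α → D) : permFunctional ψ σ a = permFunctional ψ (Equiv.swap x (σ x) * σ)
      (Function.update (Function.update a (σ x) (a x * a (σ x))) x 1) := by
  have h := permFunctional_swap_mul htr h1 (γ := Equiv.swap x (σ x) * σ) (x := σ x) (k := x)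
    (by simp) hx a
  rwa [Equiv.swap_comm (σ x) x, swap_mul_swap_mul_self] at h

end PermFunctional

/-! ### Sums over non-crossing permutations of several circles -/

section Circles

variable {α : Type*} [DecidableEq α]

/-- The permutation whose cycles are the given lists. -/
def circles (Ls : List (List α)) : Equiv.Perm α := (Ls.map List.formPerm).prod

@[simp] theorem circles_nil : circles ([] : List (List α)) = 1 := rfl

@[simp] theorem circles_cons (L : List α) (Ls : List (List α)) :
    circles (L :: Ls) = L.formPerm * circles Ls := by simp [circles]

/-- The transposition redirects the ends of the two arcs: the last point of `x :: u` returns to `x`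
instead of going on to `k`, and the last point of `k :: v` returns to `k`. -/
theorem swap_mul_formPerm {x k : α} {u v : List α} (h : (x :: (u ++ k :: v)).Nodup) :
    Equiv.swap x k * (x :: (u ++ k :: v)).formPerm = (x :: u).formPerm * (k :: v).formPerm := by
  induction u generalizing x with
  | nil => simp [List.formPerm_cons_cons]
  | cons y u ih =>
    have h1 : k ≠ x := by simp at h; tauto
    have h2 : k ≠ y := by simp at h; tauto
    have h3 := ih (x := y) (List.nodup_cons.1 h).2
    rw [List.cons_append, List.formPerm_cons_cons, ← swap_mul_swap_mul_self y k
      ((y :: (u ++ k :: v)).formPerm), h3, List.formPerm_cons_cons, ← mul_assoc (Equiv.swap x y),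
      Equiv.mul_swap_eq_swap_mul, Equiv.swap_apply_right, Equiv.swap_apply_of_ne_of_ne h1 h2,
      mul_assoc, swap_mul_swap_mul_self, mul_assoc]

theorem formPerm_mem_iff (L : List α) (x : α) : L.formPerm x ∈ L ↔ x ∈ L :=
  ⟨List.mem_of_formPerm_apply_mem, List.formPerm_apply_mem_of_mem⟩

theorem circles_apply_of_notMem {Ls : List (List α)} {x : α} (h : x ∉ Ls.flatten) :
    circles Ls x = x := by
  induction Ls with
  | nil => rfl
  | cons L Ls ih =>
    simp only [List.flatten_cons, List.mem_append, not_or] at h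
    rw [circles_cons, Equiv.Perm.mul_apply, ih h.2, List.formPerm_apply_of_notMem h.1]

theorem circles_mem_iff {Ls : List (List α)} (hN : Ls.flatten.Nodup) {L : List α} (hL : L ∈ Ls)
    (x : α) : circles Ls x ∈ L ↔ x ∈ L := by
  induction Ls generalizing L x with
  | nil => simp at hL
  | cons L' Ls ih =>
    rw [List.flatten_cons, List.nodup_append'] at hN
    obtain ⟨h1, h2, h3⟩ := hN
    rw [circles_cons, Equiv.Perm.mul_apply]
    have key (M : List α) (hM : M ∈ Ls) (y : α) : L'.formPerm y ∈ M ↔ y ∈ M := by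
      have hd : ∀ z ∈ M, z ∉ L' := fun z hz hz' => h3 hz' (List.mem_flatten.2 ⟨M, hM, hz⟩)
      by_cases hy : y ∈ L'
      · exact ⟨fun h => absurd ((formPerm_mem_iff L' y).2 hy) (hd _ h),
          fun h => absurd hy (hd _ h)⟩
      · rw [List.formPerm_apply_of_notMem hy]
    rcases List.mem_cons.1 hL with rfl | hL
    · rw [formPerm_mem_iff]
      by_cases hx : x ∈ Ls.flatten
      · obtain ⟨M, hM, hxM⟩ := List.mem_flatten.1 hx
        have := (ih h2 hM x).2 hxM
        exact ⟨fun h => absurd (List.mem_flatten.2 ⟨M, hM, this⟩) (h3 h),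
          fun h => absurd hx (h3 h)⟩
      · rw [circles_apply_of_notMem hx]
    · rw [key L hL, ih h2 hL]

theorem mem_iff_of_sameCycle_circles {Ls : List (List α)} (hN : Ls.flatten.Nodup) {L : List α}
    (hL : L ∈ Ls) {x y : α} (h : (circles Ls).SameCycle x y) : x ∈ L ↔ y ∈ L :=
  iff_of_eq (sameCycle_apply_eq (r := fun x => x ∈ L)
    (fun x => propext (circles_mem_iff hN hL x)) h)

theorem circles_swap {L L' : List α} {Ls : List (List α)} (hN : (L :: L' :: Ls).flatten.Nodup) :
    circles (L :: L' :: Ls) = circles (L' :: L :: Ls) := by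
  have hd : L.formPerm.Disjoint L'.formPerm := fun x => by
    simp only [List.flatten_cons] at hN
    by_cases hx : x ∈ L
    · right
      refine List.formPerm_apply_of_notMem fun hx' => ?_
      exact (List.nodup_append'.1 hN).2.2 hx (List.mem_append_left _ hx')
    · exact Or.inl (List.formPerm_apply_of_notMem hx)
  rw [circles_cons, circles_cons, circles_cons, circles_cons, ← mul_assoc, hd.commute.eq, mul_assoc]

/-- Removing the head of the first circle. -/
theorem swap_mul_circles {x : α} {l : List α} {Ls : List (List α)}
    (hN : ((x :: l) :: Ls).flatten.Nodup) :
    Equiv.swap x (circles ((x :: l) :: Ls) x) * circles ((x :: l) :: Ls) = circles (l :: Ls) := by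
  rw [List.flatten_cons, List.nodup_append'] at hN
  have hx : circles Ls x = x := circles_apply_of_notMem (hN.2.2 List.mem_cons_self)
  cases l with
  | nil =>
    simp [hx]
    rfl
  | cons y l =>
    rw [circles_cons, Equiv.Perm.mul_apply, hx, List.formPerm_apply_head _ _ _ hN.1,
      List.formPerm_cons_cons, mul_assoc, swap_mul_swap_mul_self, circles_cons]

/-- Splitting the first circle. -/
theorem swap_mul_circles_split {x k : α} {u v : List α} {Ls : List (List α)}
    (hN : ((x :: (u ++ k :: v)) :: Ls).flatten.Nodup) :
    Equiv.swap x k * circles ((x :: (u ++ k :: v)) :: Ls) =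
      circles ((x :: u) :: (k :: v) :: Ls) := by
  rw [List.flatten_cons, List.nodup_append'] at hN
  rw [circles_cons, ← mul_assoc, swap_mul_formPerm hN.1, circles_cons, circles_cons, mul_assoc]

omit [DecidableEq α] in
theorem nodup_merge {x k : α} {l u v : List α} {Ls : List (List α)}
    (hN : ((x :: l) :: (u ++ k :: v) :: Ls).flatten.Nodup) :
    ((x :: (l ++ k :: (v ++ u))) :: Ls).flatten.Nodup := by
  refine (List.Perm.nodup_iff ?_).1 hN
  simp only [List.flatten_cons, List.cons_append, List.append_assoc]
  refine List.Perm.cons _ (List.Perm.append_left _ ?_)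
  refine List.perm_middle.trans (List.Perm.cons _ ?_)
  rw [← List.append_assoc, ← List.append_assoc]
  exact List.Perm.append_right _ List.perm_append_comm

/-- Merging the first two circles. -/
theorem swap_mul_circles_merge {x k : α} {l u v : List α} {Ls : List (List α)}
    (hN : ((x :: l) :: (u ++ k :: v) :: Ls).flatten.Nodup) :
    Equiv.swap x k * circles ((x :: l) :: (u ++ k :: v) :: Ls) =
      circles ((x :: (l ++ k :: (v ++ u))) :: Ls) := by
  have h1 := nodup_merge hN
  -- The second circle is rotated to start at `k`; merging is then splitting read backwards.
  have h2 : (u ++ k :: v).formPerm = (k :: (v ++ u)).formPerm := by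
    simp only [List.flatten_cons] at hN
    have := (List.nodup_append'.1 (List.nodup_append'.1 hN).2.1).1
    rw [← List.formPerm_rotate _ this u.length, List.rotate_append_length_eq]
    rfl
  have h3 := swap_mul_circles_split h1
  rw [circles_cons, circles_cons, h2, ← circles_cons, ← circles_cons, ← h3,
    swap_mul_swap_mul_self]

theorem splitSum_eq_sum_toFinset {M : Type*} [AddCommMonoid M] {l : List α} (h : l.Nodup)
    (f : α → M) : splitSum (fun _ k _ => f k) l = ∑ k ∈ l.toFinset, f k := by
  induction l with
  | nil => rfl
  | cons x l ih =>
    rw [List.nodup_cons] at h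
    rw [splitSum_cons, ih h.2, List.toFinset_cons, Finset.sum_insert (by simpa using h.1)]

variable [Fintype α]

/-- The permutations `σ` with `#(σ) + #(σ⁻¹ γ) + e = |α| + #(γ)`. -/
def IsGeod (γ : Equiv.Perm α) (e : ℕ) (σ : Equiv.Perm α) : Prop :=
  geod σ γ + e = Fintype.card α + numCycles γ

/-- If `x` is fixed by `σ`, detaching it from its circle raises both sides of the geodesic condition
by one. -/
theorem isGeod_circles_cons {x : α} {l : List α} {Ls : List (List α)}
    (hN : ((x :: l) :: Ls).flatten.Nodup) {σ : Equiv.Perm α} (hσ : σ x = x) (e : ℕ) :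
    IsGeod (circles ((x :: l) :: Ls)) e σ ↔ IsGeod (circles (l :: Ls)) e σ := by
  by_cases h : circles ((x :: l) :: Ls) x = x
  · rw [← swap_mul_circles hN, h, Equiv.swap_self]
    rfl
  · have h1 := geod_swap_right σ _ hσ h
    have h2 := numCycles_swap_apply_mul h
    rw [swap_mul_circles hN] at h1 h2
    rw [IsGeod, IsGeod, h1, h2]
    omega

/-- Once `x` is off the circles it is a cycle of its own, and permutations with defect `0` preserve
cycles; so `σ x = x` becomes automatic. -/
theorem isGeod_circles_cons_and {x : α} {l : List α} {Ls : List (List α)}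
    (hN : ((x :: l) :: Ls).flatten.Nodup) (σ : Equiv.Perm α) :
    IsGeod (circles ((x :: l) :: Ls)) 0 σ ∧ σ x = x ↔ IsGeod (circles (l :: Ls)) 0 σ := by
  constructor
  · rintro ⟨h, hσ⟩
    exact (isGeod_circles_cons hN hσ 0).1 h
  · intro h
    have hx : circles (l :: Ls) x = x := circles_apply_of_notMem (List.nodup_cons.1 hN).1
    have hσ := eq_of_sameCycle_of_fixed hx (sameCycle_of_geod_eq h x)
    exact ⟨(isGeod_circles_cons hN hσ 0).2 h, hσ⟩

/-- The relation between `e` and `e'` covers both geometric moves: splitting a circle keeps the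
defect, and merging two circles lowers it by two. -/
theorem isGeod_swap_mul {γ σ : Equiv.Perm α} {x k : α} (hxk : k ≠ x) (hσ : σ x = x) {e e' : ℕ}
    (he : numCycles (Equiv.swap x k * γ) + e = numCycles γ + e' + 1) :
    IsGeod γ e (Equiv.swap x k * σ) ↔ IsGeod (Equiv.swap x k * γ) e' σ := by
  have h : (Equiv.swap x k * σ) x = k := by simp [hσ]
  have h1 := geod_swap (Equiv.swap x k * σ) γ (x := x) (by rwa [h])
  rw [h, swap_mul_swap_mul_self] at h1
  rw [IsGeod, IsGeod, h1]
  omega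

variable {D : Type*} [Ring D] [Algebra ℂ D] {ψ : D →ₗ[ℂ] ℂ}
  (htr : ∀ a b, ψ (a * b) = ψ (b * a)) (h1 : ψ 1 = 1)

include htr h1

-- Multiplication by the transposition of `x` and `k` is an involution that exchanges the
-- permutations sending `x` to `k` with those fixing `x`; the weight of `x` moves to `k`.
open Classical in
theorem sum_permFunctional_moved {x k : α} (hxk : k ≠ x) (p q : Equiv.Perm α → Prop)
    (hpq : ∀ σ, σ x = x → (p (Equiv.swap x k * σ) ↔ q σ)) (a : α → D) :
    ∑ σ with p σ ∧ σ x = k, permFunctional ψ σ a =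
      ∑ σ with q σ ∧ σ x = x, permFunctional ψ σ
        (Function.update (Function.update a k (a x * a k)) x 1) := by
  refine Finset.sum_bij' (fun σ _ => Equiv.swap x k * σ) (fun σ _ => Equiv.swap x k * σ)
    ?_ ?_ ?_ ?_ ?_
  · intro σ hσ
    rw [Finset.mem_filter_univ] at hσ ⊢
    have h : (Equiv.swap x k * σ) x = x := by simp [hσ.2]
    rw [← hpq _ h, swap_mul_swap_mul_self]
    exact ⟨hσ.1, h⟩
  · intro σ hσ
    rw [Finset.mem_filter_univ] at hσ ⊢
    exact ⟨(hpq σ hσ.2).2 hσ.1, by simp [hσ.2]⟩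
  · intro σ _
    exact swap_mul_swap_mul_self x k σ
  · intro σ _
    exact swap_mul_swap_mul_self x k σ
  · intro σ hσ
    rw [Finset.mem_filter_univ] at hσ
    rw [permFunctional_eq_swap_mul htr h1 (x := x) (by rw [hσ.2]; exact hxk), hσ.2]

open Classical in
theorem sum_permFunctional_fixed {x : α} (p : Equiv.Perm α → Prop) (a : α → D) :
    ∑ σ with p σ ∧ σ x = x, permFunctional ψ σ a =
      ψ (a x) * ∑ σ with p σ ∧ σ x = x, permFunctional ψ σ (Function.update a x 1) := by
  rw [Finset.mul_sum]
  refine Finset.sum_congr rfl fun σ hσ => ?_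
  rw [Finset.mem_filter_univ] at hσ
  exact permFunctional_fixed htr h1 a hσ.2

omit htr [DecidableEq α] in
theorem permFunctional_one {a : α → D} (ha : ∀ x, a x = 1) : permFunctional ψ 1 a = 1 := by
  classical
  rw [permFunctional_eq]
  refine Finset.prod_eq_one fun c _ => ?_
  rw [classVal, cycleVal_fixed _ rfl, ha, h1]

omit htr h1 [Fintype α] in
theorem map_update_of_notMem {β : Type*} {x : α} {l : List α} (h : x ∉ l) (a : α → β) (b : β) :
    l.map (Function.update a x b) = l.map a :=
  List.map_congr_left fun y hy => Function.update_of_ne (fun e => h (by rw [← e]; exact hy)) _ _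

omit htr h1 [Fintype α] in
theorem map_fpMoment_update {x : α} {Ls : List (List α)} (h : x ∉ Ls.flatten) (a : α → D)
    (b : D) : (Ls.map fun L => fpMoment ψ (L.map (Function.update a x b))) =
      Ls.map fun L => fpMoment ψ (L.map a) :=
  List.map_congr_left fun L hL => by
    rw [map_update_of_notMem fun hx => h (List.mem_flatten.2 ⟨L, hL, hx⟩)]

open Classical in
/-- The sum over the non-crossing permutations of several circles factorizes. -/
theorem sum_permFunctional_circles (Ls : List (List α)) (hN : Ls.flatten.Nodup) (a : α → D)
    (ha : ∀ x, x ∉ Ls.flatten → a x = 1) :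
    ∑ σ with IsGeod (circles Ls) 0 σ, permFunctional ψ σ a =
      (Ls.map fun L => fpMoment ψ (L.map a)).prod := by
  -- Splitting removes one letter but adds one circle, and an empty circle is dropped without
  -- removing a letter. Counting letters twice makes both decrease.
  induction hn : 2 * Ls.flatten.length + Ls.length using Nat.strong_induction_on generalizing Ls a with
  | _ n ih =>
  match Ls with
  | [] =>
    rw [Finset.sum_eq_single (1 : Equiv.Perm α)]
    · simp [permFunctional_one h1 (fun x => ha x (by simp))]
    · intro σ hσ hne
      rw [Finset.mem_filter_univ] at hσ
      refine absurd (Equiv.ext fun x => ?_) hne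
      exact eq_of_sameCycle_of_fixed rfl (sameCycle_of_geod_eq hσ x)
    · intro h
      refine absurd ?_ h
      rw [Finset.mem_filter_univ]
      simp [IsGeod, geod]
  | [] :: Ls =>
    have := ih _ (by subst hn; simp) Ls (by simpa using hN) a (by simpa using ha) rfl
    simpa using this
  | (x :: l) :: Ls =>
    set γ := circles ((x :: l) :: Ls) with hγ
    have hxl : x ∉ l := by simp at hN; tauto
    have hl : l.Nodup := by simp at hN; exact (List.nodup_append'.1 hN.2).1
    have hxL : x ∉ Ls.flatten := by
      rw [List.flatten_cons, List.nodup_append'] at hN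
      exact hN.2.2 List.mem_cons_self
    -- The sum is organized by the image of `x`, which lies on the circle of `x` because cycles are
    -- preserved.
    have e1 : ∑ σ with IsGeod γ 0 σ, permFunctional ψ σ a =
        ∑ k ∈ (x :: l).toFinset, ∑ σ with IsGeod γ 0 σ ∧ σ x = k, permFunctional ψ σ a := by
      rw [← Finset.sum_fiberwise_of_maps_to (g := fun σ => σ x) (t := (x :: l).toFinset)]
      · simp only [Finset.filter_filter]
      · intro σ hσ
        rw [Finset.mem_filter_univ] at hσ
        rw [List.mem_toFinset,
          ← mem_iff_of_sameCycle_circles hN List.mem_cons_self (sameCycle_of_geod_eq hσ x)]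
        exact List.mem_cons_self
    rw [e1, List.toFinset_cons, Finset.sum_insert (by simpa using hxl),
      ← splitSum_eq_sum_toFinset hl, List.map_cons, List.prod_cons, List.map_cons,
      fpMoment_cons htr, splitSum_map, add_mul, splitSum_mul]
    have hx1 : circles Ls x = x := circles_apply_of_notMem hxL
    congr 1
    · rw [sum_permFunctional_fixed htr h1]
      have hN' : (l :: Ls).flatten.Nodup := (List.nodup_cons.1 hN).2
      have := ih _ (by subst hn; simp) (l :: Ls) hN' (Function.update a x 1) (fun y hy => by
        by_cases h : y = x
        · subst h; simp
        · rw [Function.update_of_ne h]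
          exact ha y (by simpa [h] using hy)) rfl
      simp only [hγ, isGeod_circles_cons_and hN, this]
      rw [List.map_cons, List.prod_cons, map_fpMoment_update hxL, map_update_of_notMem hxl,
        mul_assoc]
    · refine splitSum_congr fun u k v huv => ?_
      subst huv
      have hkx : k ≠ x := fun e => hxl (by simp [e])
      have hN1 : ((x :: u) :: (k :: v) :: Ls).flatten.Nodup := by simpa using hN
      have hN2 : (u :: (k :: v) :: Ls).flatten.Nodup := (List.nodup_cons.1 hN1).2
      have hsp : Equiv.swap x k * γ = circles ((x :: u) :: (k :: v) :: Ls) :=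
        swap_mul_circles_split hN
      have hku : k ∉ x :: u := fun e =>
        (List.nodup_append'.1 hN1).2.2 e (by simp)
      have hxk : ¬ (circles ((x :: u) :: (k :: v) :: Ls)).SameCycle x k := fun e =>
        hku ((mem_iff_of_sameCycle_circles hN1 List.mem_cons_self e).1 List.mem_cons_self)
      have hc := numCycles_swap_mul hxk
      rw [← hsp, swap_mul_swap_mul_self] at hc
      rw [sum_permFunctional_moved htr h1 hkx _
        (fun σ => IsGeod (circles ((x :: u) :: (k :: v) :: Ls)) 0 σ) (fun σ hσ => by
          rw [isGeod_swap_mul hkx hσ (e' := 0) (by omega), hsp])]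
      simp only [isGeod_circles_cons_and hN1]
      -- The weight `1` at `x` keeps the hypothesis that weights off the circles are trivial.
      set b := Function.update (Function.update a k (a x * a k)) x 1 with hb
      have hbu : ∀ y, y ≠ x → y ≠ k → b y = a y := fun y h1 h2 => by
        rw [hb, Function.update_of_ne h1, Function.update_of_ne h2]
      have hbx : b x = 1 := by simp [hb]
      have hbk : b k = a x * a k := by simp [hb, hkx]
      rw [ih _ (by subst hn; simp; omega) (u :: (k :: v) :: Ls) hN2 b (fun y hy => by
        by_cases h : y = x
        · rw [h, hbx]
        · rw [hbu y h (by rintro rfl; simp at hy)]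
          exact ha y (by simpa [h] using hy)) rfl]
      have hkL : k ∉ Ls.flatten := by
        simp only [List.flatten_cons, List.nodup_append'] at hN1
        exact hN1.2.1.2.2 List.mem_cons_self
      have hkv : k ∉ v := by
        simp only [List.flatten_cons, List.nodup_append'] at hN1
        exact (List.nodup_cons.1 hN1.2.1.1).1
      simp only [List.map_cons, List.prod_cons, hbk]
      rw [hb, map_fpMoment_update hxL, map_fpMoment_update hkL, map_update_of_notMem,
        map_update_of_notMem, map_update_of_notMem, map_update_of_notMem hkv, mul_assoc]
      · exact fun h => hxl (by simp [h])
      · exact fun h => hku (List.mem_cons_of_mem _ h)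
      · exact fun h => hxl (by simp [h])

end Circles

/-! ### Sums over annular non-crossing permutations -/

section Annular

variable {α : Type*}

/-- Some point of the first list is mapped into the second list. -/
def Connects (σ : Equiv.Perm α) (L L' : List α) : Prop := ∃ z ∈ L, σ z ∈ L'

theorem not_connects_nil (σ : Equiv.Perm α) (L : List α) : ¬ Connects σ [] L := by
  rintro ⟨z, hz, -⟩
  simp at hz

theorem connects_append {σ : Equiv.Perm α} {u v L : List α} :
    Connects σ (u ++ v) L ↔ Connects σ u L ∨ Connects σ v L := by
  simp only [Connects, List.mem_append, or_and_right, exists_or]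

theorem connects_cons_of_notMem {σ : Equiv.Perm α} {x : α} {u L : List α} (h : σ x ∉ L) :
    Connects σ (x :: u) L ↔ Connects σ u L := by
  simp [Connects, h]

theorem nodup_swap {L L' : List α} {Ls : List (List α)} (h : (L :: L' :: Ls).flatten.Nodup) :
    (L' :: L :: Ls).flatten.Nodup := by
  refine (List.Perm.nodup_iff ?_).1 h
  simp only [List.flatten_cons, ← List.append_assoc]
  exact List.Perm.append_right _ List.perm_append_comm

theorem nodup_swap_tail {L L' M : List α} {Ls : List (List α)}
    (h : (L :: L' :: M :: Ls).flatten.Nodup) : (L :: M :: L' :: Ls).flatten.Nodup := by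
  refine (List.Perm.nodup_iff ?_).1 h
  simp only [List.flatten_cons, ← List.append_assoc]
  refine List.Perm.append_right _ ?_
  simp only [List.append_assoc]
  exact List.Perm.append_left _ List.perm_append_comm

theorem nodup_tail {L : List α} {Ls : List (List α)} (h : (L :: Ls).flatten.Nodup) :
    Ls.flatten.Nodup := (List.nodup_append'.1 h).2.1

theorem disjoint_heads {L L' : List α} {Ls : List (List α)}
    (h : (L :: L' :: Ls).flatten.Nodup) {x : α} (hx : x ∈ L) : x ∉ L' := fun hx' =>
  (List.nodup_append'.1 h).2.2 hx (List.mem_append_left _ hx')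

variable [DecidableEq α]

theorem connects_swap_mul {σ : Equiv.Perm α} {x k : α} {L L' : List α} (hx : x ∉ L')
    (hk : k ∉ L') : Connects (Equiv.swap x k * σ) L L' ↔ Connects σ L L' := by
  refine exists_congr fun z => and_congr_right fun _ => ?_
  rw [Equiv.Perm.mul_apply, Equiv.swap_apply_def]
  split_ifs with h1 h2
  · simp [h1, hx, hk]
  · simp [h2, hx, hk]
  · rfl

variable [Fintype α]

/-- A permutation of annular type on the first two circles. -/
def IsAnnular (L L' : List α) (Ls : List (List α)) (σ : Equiv.Perm α) : Prop :=
  IsGeod (circles (L :: L' :: Ls)) 2 σ ∧ Connects σ L L'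

/-- The defect `2` is used up by the connection of the first two circles, so every other circle is
preserved. -/
theorem IsAnnular.sameCycle {L L' : List α} {Ls : List (List α)} {σ : Equiv.Perm α}
    (hN : (L :: L' :: Ls).flatten.Nodup) (h : IsAnnular L L' Ls σ) (x : α) :
    (circles (L :: L' :: Ls)).SameCycle x (σ x) ∨ ((x ∈ L ∨ x ∈ L') ∧ (σ x ∈ L ∨ σ x ∈ L')) := by
  obtain ⟨hg, z, hz, hz'⟩ := h
  have m1 {y w : α} (e : (circles (L :: L' :: Ls)).SameCycle y w) : y ∈ L ↔ w ∈ L :=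
    mem_iff_of_sameCycle_circles hN (by simp) e
  have m2 {y w : α} (e : (circles (L :: L' :: Ls)).SameCycle y w) : y ∈ L' ↔ w ∈ L' :=
    mem_iff_of_sameCycle_circles hN (by simp) e
  refine (sameCycle_of_geod_add_two hg (x := z) (fun e => ?_) x).imp_right
    (And.imp (Or.imp (fun e => (m1 e).2 hz) fun e => (m2 e).2 hz')
      (Or.imp (fun e => (m1 e).2 hz) fun e => (m2 e).2 hz'))
  exact disjoint_heads hN ((m1 e).1 hz) hz'

theorem IsAnnular.apply_mem {L L' : List α} {Ls : List (List α)} {σ : Equiv.Perm α}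
    (hN : (L :: L' :: Ls).flatten.Nodup) (h : IsAnnular L L' Ls σ) {x : α} (hx : x ∈ L) :
    σ x ∈ L ∨ σ x ∈ L' := by
  rcases h.sameCycle hN x with e | e
  · exact Or.inl ((mem_iff_of_sameCycle_circles hN (by simp) e).1 hx)
  · exact e.2

theorem IsAnnular.apply_eq {L L' : List α} {Ls : List (List α)} {σ : Equiv.Perm α}
    (hN : (L :: L' :: Ls).flatten.Nodup) (h : IsAnnular L L' Ls σ) {x : α}
    (hx : x ∉ (L :: L' :: Ls).flatten) : σ x = x := by
  have hc : circles (L :: L' :: Ls) x = x := circles_apply_of_notMem hx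
  simp only [List.flatten_cons, List.mem_append, not_or] at hx
  rcases h.sameCycle hN x with e | e
  · exact eq_of_sameCycle_of_fixed hc e
  · tauto

/-- After a cut, only one of the two pieces can be joined to the second circle; this makes the two
cases of the recursion disjoint. -/
theorem IsAnnular.not_connects {L L' M : List α} {Ls : List (List α)} {σ : Equiv.Perm α}
    (hN : (L :: L' :: M :: Ls).flatten.Nodup) (h : IsAnnular L L' (M :: Ls) σ) :
    ¬ Connects σ M L' := by
  rintro ⟨x, hx, hx'⟩
  have h1 : x ∉ L := fun e => (List.nodup_append'.1 hN).2.2 e (by simp [hx])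
  have h2 : x ∉ L' := fun e => disjoint_heads (nodup_tail hN) e hx
  rcases h.sameCycle hN x with e | e
  · exact h2 ((mem_iff_of_sameCycle_circles hN (by simp) e).2 hx')
  · tauto

/-- As for discs, a point lying on no circle is fixed automatically. -/
theorem isAnnular_cons_and {x : α} {l L' : List α} {Ls : List (List α)}
    (hN : ((x :: l) :: L' :: Ls).flatten.Nodup) (σ : Equiv.Perm α) :
    IsAnnular (x :: l) L' Ls σ ∧ σ x = x ↔ IsAnnular l L' Ls σ := by
  have hx : x ∉ L' := disjoint_heads hN List.mem_cons_self
  constructor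
  · rintro ⟨⟨h, hc⟩, hσ⟩
    exact ⟨(isGeod_circles_cons hN hσ 2).1 h, (connects_cons_of_notMem (by rwa [hσ])).1 hc⟩
  · intro h
    have hσ := h.apply_eq (List.nodup_cons.1 hN).2 (List.nodup_cons.1 hN).1
    exact ⟨⟨(isGeod_circles_cons hN hσ 2).2 h.1,
      (connects_cons_of_notMem (by rwa [hσ])).2 h.2⟩, hσ⟩

omit [Fintype α] in
theorem circles_swap_tail {L L' M : List α} {Ls : List (List α)}
    (hN : (L :: L' :: M :: Ls).flatten.Nodup) :
    circles (L :: L' :: M :: Ls) = circles (L :: M :: L' :: Ls) := by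
  rw [circles_cons, circles_swap (nodup_tail hN), ← circles_cons]

/-- Splitting the first circle leaves an annular permutation on one of the two parts. -/
theorem isAnnular_split {x k : α} {u v L' : List α} {Ls : List (List α)}
    (hN : ((x :: (u ++ k :: v)) :: L' :: Ls).flatten.Nodup) {σ : Equiv.Perm α} (hσ : σ x = x) :
    IsAnnular (x :: (u ++ k :: v)) L' Ls (Equiv.swap x k * σ) ↔
      IsAnnular u L' ((k :: v) :: Ls) σ ∨ IsAnnular (k :: v) L' (u :: Ls) σ := by
  have hkx : k ≠ x := by rintro rfl; simp at hN
  have hx : x ∉ L' := disjoint_heads hN List.mem_cons_self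
  have hk : k ∉ L' := disjoint_heads hN (by simp)
  have hN1 : ((x :: u) :: (k :: v) :: L' :: Ls).flatten.Nodup := by simpa using hN
  have hN2 : (u :: (k :: v) :: L' :: Ls).flatten.Nodup := (List.nodup_cons.1 hN1).2
  have hsp := swap_mul_circles_split hN
  have hxk : ¬ (circles ((x :: u) :: (k :: v) :: L' :: Ls)).SameCycle x k := fun e =>
    disjoint_heads hN1 ((mem_iff_of_sameCycle_circles hN1 List.mem_cons_self e).1
      List.mem_cons_self) List.mem_cons_self
  have hc := numCycles_swap_mul hxk
  rw [← hsp, swap_mul_swap_mul_self] at hc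
  rw [IsAnnular, isGeod_swap_mul hkx hσ (e' := 2) (by omega), hsp, isGeod_circles_cons hN1 hσ,
    connects_swap_mul hx hk, connects_cons_of_notMem (by rwa [hσ]), connects_append, IsAnnular,
    IsAnnular, ← circles_swap_tail hN2, ← circles_swap_tail (nodup_swap hN2), ← circles_swap hN2,
    and_or_left]

variable {D : Type*} [Ring D] [Algebra ℂ D] {ψ : D →ₗ[ℂ] ℂ}
  (htr : ∀ a b, ψ (a * b) = ψ (b * a)) (h1 : ψ 1 = 1)

section Update

omit [Fintype α] [Algebra ℂ D]

theorem map_update_update {x k : α} {L : List α} (hx : x ∉ L) (hk : k ∉ L) (a : α → D) (c : D) :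
    L.map (Function.update (Function.update a k c) x 1) = L.map a := by
  rw [map_update_of_notMem hx, map_update_of_notMem hk]

theorem map_update_update_cons {x k : α} {v : List α} (hkx : k ≠ x) (hx : x ∉ v) (hk : k ∉ v)
    (a : α → D) (c : D) :
    (k :: v).map (Function.update (Function.update a k c) x 1) = c :: v.map a := by
  rw [List.map_cons, map_update_update hx hk, Function.update_of_ne hkx, Function.update_self]

theorem update_update_eq_one {x k y : α} {a : α → D} (hy : y ≠ k) (ha : y ≠ x → a y = 1) (c : D) :
    Function.update (Function.update a k c) x 1 y = 1 := by
  by_cases h : y = x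
  · rw [h, Function.update_self]
  · rw [Function.update_of_ne h, Function.update_of_ne hy, ha h]

end Update

include htr h1

open Classical in
/-- The sum over the annular permutations, given by any solution of the annular recursion. -/
theorem sum_permFunctional_annular {F : List D → List D → ℂ} (hF : IsAnnularMoment ψ F)
    (L L' : List α) (Ls : List (List α)) (hN : (L :: L' :: Ls).flatten.Nodup) (a : α → D)
    (ha : ∀ x, x ∉ (L :: L' :: Ls).flatten → a x = 1) :
    ∑ σ with IsAnnular L L' Ls σ, permFunctional ψ σ a =
      F (L.map a) (L'.map a) * (Ls.map fun M => fpMoment ψ (M.map a)).prod := by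
  -- Cutting shortens the first circle. Merging needs no induction hypothesis, since it leads to the
  -- factorized sum over discs.
  induction hn : L.length using Nat.strong_induction_on generalizing L Ls a with
  | _ n ih =>
  match L with
  | [] =>
    rw [Finset.sum_eq_zero, List.map_nil, hF.nil, zero_mul]
    intro σ hσ
    rw [Finset.mem_filter_univ] at hσ
    exact absurd hσ.2 (not_connects_nil σ L')
  | x :: l =>
    have hxl : x ∉ l := fun e => (List.nodup_cons.1 hN).1 (by simp [e])
    have hl : l.Nodup := (List.nodup_append'.1 (List.nodup_cons.1 hN).2).1
    have hxL' : x ∉ L' := disjoint_heads hN List.mem_cons_self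
    have hL' : L'.Nodup := (List.nodup_append'.1 (nodup_tail hN)).1
    have hxL : x ∉ Ls.flatten := fun e => (List.nodup_cons.1 hN).1 (by simp at e ⊢; tauto)
    have e1 : ∑ σ with IsAnnular (x :: l) L' Ls σ, permFunctional ψ σ a =
        ∑ k ∈ insert x (l.toFinset ∪ L'.toFinset),
          ∑ σ with IsAnnular (x :: l) L' Ls σ ∧ σ x = k, permFunctional ψ σ a := by
      rw [← Finset.sum_fiberwise_of_maps_to (g := fun σ => σ x)
        (t := insert x (l.toFinset ∪ L'.toFinset))]
      · simp only [Finset.filter_filter]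
      · intro σ hσ
        rw [Finset.mem_filter_univ] at hσ
        have := hσ.apply_mem hN List.mem_cons_self
        simp only [List.mem_cons] at this
        simpa [or_assoc] using this
    have hdis : Disjoint l.toFinset L'.toFinset := by
      rw [Finset.disjoint_left]
      intro z hz hz'
      rw [List.mem_toFinset] at hz hz'
      exact disjoint_heads hN (List.mem_cons_of_mem _ hz) hz'
    rw [e1, Finset.sum_insert (by simp [hxl, hxL']), Finset.sum_union hdis,
      ← splitSum_eq_sum_toFinset hl, ← splitSum_eq_sum_toFinset hL', List.map_cons, hF.cons,
      splitSum_map, splitSum_map, add_mul, add_mul, splitSum_mul, splitSum_mul, ← add_assoc]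
    congr 1
    congr 1
    · rw [sum_permFunctional_fixed htr h1]
      simp only [isAnnular_cons_and hN]
      rw [ih _ (by subst hn; simp) l Ls (List.nodup_cons.1 hN).2 (Function.update a x 1)
        (fun y hy => by
          by_cases h : y = x
          · subst h; simp
          · rw [Function.update_of_ne h]
            exact ha y (by simpa [h] using hy)) rfl,
        map_fpMoment_update hxL, map_update_of_notMem hxl, map_update_of_notMem hxL', mul_assoc]
    · refine splitSum_congr fun u k v huv => ?_
      subst huv
      have hkx : k ≠ x := fun e => hxl (by simp [e])
      have hN1 : ((x :: u) :: (k :: v) :: L' :: Ls).flatten.Nodup := by simpa using hN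
      have hN2 : (u :: (k :: v) :: L' :: Ls).flatten.Nodup := (List.nodup_cons.1 hN1).2
      have hN2' := nodup_swap hN2
      have hN3 : (u :: L' :: (k :: v) :: Ls).flatten.Nodup := nodup_swap_tail hN2
      have hN4 : ((k :: v) :: L' :: u :: Ls).flatten.Nodup := nodup_swap_tail hN2'
      have hku : k ∉ u := disjoint_heads hN2' List.mem_cons_self
      have hkv : k ∉ v := (List.nodup_cons.1 (List.nodup_append'.1 hN4).1).1
      have hkL' : k ∉ L' := disjoint_heads hN4 List.mem_cons_self
      have hkL : k ∉ Ls.flatten := (List.nodup_append'.1 (nodup_tail (nodup_tail hN3))).2.2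
        List.mem_cons_self
      have hxu : x ∉ u := fun e => hxl (by simp [e])
      have hxv : x ∉ v := fun e => hxl (by simp [e])
      have hb (y : α) (hy : y ∉ (u :: L' :: (k :: v) :: Ls).flatten) :
          Function.update (Function.update a k (a x * a k)) x 1 y = 1 := by
        refine update_update_eq_one (by rintro rfl; simp at hy) (fun hyx => ha y ?_) _
        simp at hy ⊢
        tauto
      -- The image `k` is on the first circle: the part `u` or the part `k :: v` stays connected to
      -- `L'`, and the other becomes one more disc.
      rw [sum_permFunctional_moved htr h1 hkx _ _ fun σ hσ => isAnnular_split hN hσ]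
      have e2 (σ : Equiv.Perm α) : ((IsAnnular u L' ((k :: v) :: Ls) σ ∨
          IsAnnular (k :: v) L' (u :: Ls) σ) ∧ σ x = x) ↔ (IsAnnular u L' ((k :: v) :: Ls) σ ∨
          IsAnnular (k :: v) L' (u :: Ls) σ) := by
        refine and_iff_left_of_imp ?_
        rintro (h | h)
        · exact h.apply_eq hN3 (by simp [hxu, hxL', hkx.symm, hxv, hxL])
        · exact h.apply_eq hN4 (by simp [hxu, hxL', hkx.symm, hxv, hxL])
      simp only [e2]
      rw [Finset.filter_or, Finset.sum_union, ih _ (by subst hn; simp) u _ hN3 _ hb rfl,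
        ih _ (by subst hn; simp) (k :: v) _ hN4 _ (fun y hy => hb y (by
          simp at hy ⊢; tauto)) rfl, map_update_update_cons hkx hxv hkv,
        map_update_update hxL' hkL', map_update_update hxu hku]
      · simp only [List.map_cons (f := fun M => fpMoment ψ _), List.prod_cons]
        rw [map_fpMoment_update hxL, map_fpMoment_update hkL,
          map_update_update_cons hkx hxv hkv, map_update_update hxu hku]
        ring
      · rw [Finset.disjoint_left]
        intro σ hσ hσ'
        rw [Finset.mem_filter_univ] at hσ hσ'
        exact hσ.not_connects hN3 hσ'.2
    · refine splitSum_congr fun u k v huv => ?_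
      subst huv
      have hkx : k ≠ x := fun e => hxL' (by simp [e])
      have hm := swap_mul_circles_merge hN
      have hxk : ¬ (circles ((x :: l) :: (u ++ k :: v) :: Ls)).SameCycle x k := fun e =>
        disjoint_heads hN ((mem_iff_of_sameCycle_circles hN List.mem_cons_self e).1
          List.mem_cons_self) (by simp)
      have hc := numCycles_swap_mul hxk
      rw [hm] at hc
      have hN1 := nodup_merge hN
      have hN2 : ((k :: (v ++ u)) :: Ls).flatten.Nodup := by
        have := (List.nodup_cons.1 hN1).2
        simp only [List.append_eq, List.append_assoc] at this
        simpa using (List.nodup_append'.1 this).2.1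
      have hkl : k ∉ l := fun e => disjoint_heads hN (List.mem_cons_of_mem _ e) (by simp)
      have hkvu : k ∉ v ++ u := (List.nodup_cons.1 (List.nodup_append'.1 hN2).1).1
      have hkL : k ∉ Ls.flatten := (List.nodup_append'.1 hN2).2.2 List.mem_cons_self
      have hxvu : x ∉ v ++ u := fun e => hxL' (by simp at e ⊢; tauto)
      -- The image `k` is on the second circle: the connection is then automatic, the circles merge,
      -- and the defect drops from `2` to `0`.
      rw [sum_permFunctional_moved htr h1 hkx _
        (IsGeod (circles ((x :: (l ++ k :: (v ++ u))) :: Ls)) 0) fun σ hσ => by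
          rw [IsAnnular, isGeod_swap_mul hkx hσ (e' := 0) (by rw [hm]; omega), hm]
          exact and_iff_left ⟨x, List.mem_cons_self, by simp [hσ]⟩]
      simp only [isGeod_circles_cons_and hN1]
      rw [sum_permFunctional_circles htr h1 ((l ++ k :: (v ++ u)) :: Ls) (List.nodup_cons.1 hN1).2]
      · rw [List.map_cons, List.prod_cons, map_fpMoment_update hxL, map_fpMoment_update hkL,
          List.map_append, map_update_update hxl hkl, map_update_update_cons hkx hxvu hkvu,
          fpMoment_append_comm htr, List.map_append]
        simp
      · intro y hy
        refine update_update_eq_one (by rintro rfl; simp at hy) (fun hyx => ha y ?_) _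
        simp at hy ⊢
        tauto

end Annular

/-! ### The two circles `Fin n` and `Fin m` -/

section SNC

variable {α : Type*} [DecidableEq α] [Fintype α]

/-- Detaching the head of a circle of length at least two adds one cycle and removes one letter from
the circles. -/
theorem numCycles_circles {Ls : List (List α)} (hN : Ls.flatten.Nodup) (h : ∀ L ∈ Ls, L ≠ []) :
    numCycles (circles Ls) + Ls.flatten.length = Fintype.card α + Ls.length := by
  induction hn : Ls.flatten.length using Nat.strong_induction_on generalizing Ls with
  | _ n ih =>
  match Ls with
  | [] => subst hn; simp
  | [] :: Ls => simp at h
  | [x] :: Ls =>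
    have := ih _ (by subst hn; simp) (nodup_tail hN) (fun L hL => h L (List.mem_cons_of_mem _ hL))
      rfl
    subst hn
    simp at this ⊢
    omega
  | (x :: y :: l) :: Ls =>
    have hN' : ((y :: l) :: Ls).flatten.Nodup := (List.nodup_cons.1 hN).2
    have h1 := ih _ (by subst hn; simp) hN' (by simp at h ⊢; exact h) rfl
    have hx : circles Ls x = x :=
      circles_apply_of_notMem ((List.nodup_append'.1 hN).2.2 List.mem_cons_self)
    have h2 : circles ((x :: y :: l) :: Ls) x ≠ x := by
      rw [circles_cons, Equiv.Perm.mul_apply, hx,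
        List.formPerm_apply_head _ _ _ (List.nodup_append'.1 hN).1]
      rintro rfl
      simp at hN
    have h3 := numCycles_swap_apply_mul h2
    rw [swap_mul_circles hN] at h3
    subst hn
    simp only [List.flatten_cons, List.length_append, List.length_cons] at h1 ⊢
    omega

omit [Fintype α] in
theorem formPerm_map_finRange {n : ℕ} (e : Fin n ↪ α) (i : Fin n) :
    ((List.finRange n).map e).formPerm (e i) = e (finRotate n i) := by
  have hN : ((List.finRange n).map e).Nodup := (List.nodup_finRange n).map e.injective
  have h := List.formPerm_apply_getElem _ hN i (by simp)
  simp only [List.getElem_map, List.getElem_finRange, List.length_map, List.length_finRange,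
    Fin.cast_mk, Fin.eta] at h
  rw [h]
  congr 1
  cases n with
  | zero => exact i.elim0
  | succ n =>
    rw [finRotate_apply]
    ext
    simp [Fin.val_add]

variable (n m : ℕ)

/-- The first circle of the annulus, as a word. -/
def innerCircle : List (Fin n ⊕ Fin m) := (List.finRange n).map Sum.inl

/-- The second circle of the annulus, as a word. -/
def outerCircle : List (Fin n ⊕ Fin m) := (List.finRange m).map Sum.inr

theorem circles_annulus :
    circles [innerCircle n m, outerCircle n m] = annularRotation n m := by
  ext x
  have h1 := formPerm_map_finRange (n := n) (Function.Embedding.inl (β := Fin m))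
  have h2 := formPerm_map_finRange (n := m) (Function.Embedding.inr (α := Fin n))
  rw [circles_cons, circles_cons, circles_nil, mul_one, Equiv.Perm.mul_apply]
  rcases x with i | j
  · rw [List.formPerm_apply_of_notMem (l := outerCircle n m) (by simp [outerCircle])]
    exact h1 i
  · rw [List.formPerm_apply_of_notMem (l := innerCircle n m)]
    · exact h2 j
    · rw [outerCircle]
      erw [h2 j]
      simp [innerCircle]

theorem nodup_annulus : [innerCircle n m, outerCircle n m].flatten.Nodup := by
  simp only [List.flatten_cons, List.flatten_nil, List.append_nil]
  refine List.nodup_append'.2 ⟨(List.nodup_finRange n).map Sum.inl_injective,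
    (List.nodup_finRange m).map Sum.inr_injective, ?_⟩
  simp [List.disjoint_left, innerCircle, outerCircle]

variable {n m}

theorem connects_annulus_iff (π : Equiv.Perm (Fin n ⊕ Fin m)) :
    Connects π (innerCircle n m) (outerCircle n m) ↔
      ∃ i j, π.SameCycle (Sum.inl i) (Sum.inr j) := by
  constructor
  · rintro ⟨z, hz, hz'⟩
    simp only [innerCircle, outerCircle, List.mem_map, List.mem_finRange, true_and] at hz hz'
    obtain ⟨i, rfl⟩ := hz
    obtain ⟨j, hj⟩ := hz'
    refine ⟨i, j, ?_⟩
    rw [hj]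
    exact Equiv.Perm.sameCycle_apply_right.2 (.refl _ _)
  · rintro ⟨i, j, h⟩
    by_contra hc
    -- Without a direct crossing the orbit never leaves the first circle; since the type is finite,
    -- nonnegative powers describe the whole cycle.
    have key (k : ℕ) : ∃ i', (π ^ k) (Sum.inl i) = Sum.inl i' := by
      induction k with
      | zero => exact ⟨i, rfl⟩
      | succ k ih =>
        obtain ⟨i', hi'⟩ := ih
        rw [pow_succ', Equiv.Perm.mul_apply, hi']
        rcases hx : π (Sum.inl i') with i'' | j''
        · exact ⟨i'', rfl⟩
        · refine absurd ⟨Sum.inl i', by simp [innerCircle], ?_⟩ hc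
          rw [hx]
          simp [outerCircle]
    obtain ⟨k, -, -, hk⟩ := h.exists_pow_eq π
    obtain ⟨i', hi'⟩ := key k
    rw [hi'] at hk
    simp at hk

theorem numCycles_annularRotation (hn : n ≠ 0) (hm : m ≠ 0) :
    numCycles (annularRotation n m) = 2 := by
  have := numCycles_circles (nodup_annulus n m) (by
    simp [innerCircle, outerCircle, hn, hm])
  rw [circles_annulus] at this
  simp [innerCircle, outerCircle] at this
  omega

/-- A connecting cycle forces both circles to be nonempty, so the rotation has two cycles and the
condition `n + m` is defect `2`. -/
theorem isAnnularNC_iff (π : Equiv.Perm (Fin n ⊕ Fin m)) :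
    IsAnnularNC π ↔ IsAnnular (innerCircle n m) (outerCircle n m) [] π := by
  rw [IsAnnularNC, IsAnnular, connects_annulus_iff, and_comm, circles_annulus, IsGeod]
  refine and_congr_left fun ⟨i, j, _⟩ => ?_
  rw [numCycles_annularRotation (by rintro rfl; exact i.elim0) (by rintro rfl; exact j.elim0)]
  simp [geod]

variable {D : Type*} [Ring D] [Algebra ℂ D] {ψ : D →ₗ[ℂ] ℂ}
  (htr : ∀ a b, ψ (a * b) = ψ (b * a)) (h1 : ψ 1 = 1)

include htr h1 in
theorem sum_SNC_permFunctional {F : List D → List D → ℂ} (hF : IsAnnularMoment ψ F)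
    (a : Fin n → D) (b : Fin m → D) :
    ∑ π ∈ SNC n m, permFunctional ψ π (Sum.elim a b) = F (List.ofFn a) (List.ofFn b) := by
  classical
  have := sum_permFunctional_annular htr h1 hF _ _ [] (nodup_annulus n m) (Sum.elim a b)
    (fun x hx => absurd (by rcases x with x | x <;> simp [innerCircle, outerCircle]) hx)
  simp only [← isAnnularNC_iff] at this
  rw [SNC]
  convert this using 1
  simp [innerCircle, outerCircle, List.map_map, List.ofFn_eq_map, Function.comp_def]

end SNC

/-! ### The inner product as a permutation sum -/

section Fock

variable {D : Type*} [Ring D] [StarRing D] [Algebra ℂ D] [StarModule ℂ D] {ψ : D →ₗ[ℂ] ℂ}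

omit [Algebra ℂ D] [StarModule ℂ D] in
theorem ofFn_star_rev {n : ℕ} (b : Fin n → D) :
    List.ofFn (fun k => star (b k.rev)) = starRev (List.ofFn b) := by
  refine List.ext_getElem (by simp [starRev]) fun k h1 h2 => ?_
  simp only [List.length_ofFn] at h1
  simp only [List.getElem_ofFn, starRev, List.map_ofFn, List.getElem_reverse, List.length_ofFn,
    Function.comp_apply]
  congr 2
  ext
  simp [Fin.val_rev]
  omega

/-- The inner product solves the annular recursion, and the permutation sum equals every solution.
-/
theorem cycInner_poissonVector (hψ : IsTracialState ψ) {n m : ℕ} (a : Fin n → D) (b : Fin m → D) :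
    cycInner ψ (cyc ψ (poissonVector ψ a)) (cyc ψ (poissonVector ψ fun k => star (b k.rev))) =
      ∑ π ∈ SNC n m, permFunctional ψ π (Sum.elim a b) := by
  rw [sum_SNC_permFunctional hψ.tracial hψ.map_one (isAnnularMoment_cycInner hψ),
    poissonVector_eq, poissonVector_eq, ofFn_star_rev]
  rfl

end Fock

/-! ### Random variables with finite moments -/

section Moments

variable {Ω : Type*} [MeasurableSpace Ω] {P : Measure Ω}

/-- All moments of `f` are finite. -/
def HasMoments (f : Ω → ℂ) (P : Measure Ω) : Prop := ∀ p : ℝ≥0, MemLp f p P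

namespace HasMoments

variable {f g : Ω → ℂ}

theorem memLp_two (hf : HasMoments f P) : MemLp f 2 P := hf 2

theorem integrable (hf : HasMoments f P) : Integrable f P := memLp_one_iff_integrable.1 (hf 1)

theorem const [IsFiniteMeasure P] (c : ℂ) : HasMoments (fun _ => c) P := fun _ => memLp_const c

theorem add (hf : HasMoments f P) (hg : HasMoments g P) : HasMoments (fun ω => f ω + g ω) P :=
  fun p => (hf p).add (hg p)

theorem mul (hf : HasMoments f P) (hg : HasMoments g P) : HasMoments (fun ω => f ω * g ω) P := by
  intro p
  -- Hölder with both exponents `2 p`; for `p = 0` the identity reads `⊤ + ⊤ = ⊤`.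
  have : ENNReal.HolderTriple ((2 * p : ℝ≥0) : ENNReal) ((2 * p : ℝ≥0) : ENNReal) (p : ENNReal) := by
    constructor
    rw [ENNReal.coe_mul, ENNReal.mul_inv (by simp) (by simp), ← two_mul, ← mul_assoc]
    simp [ENNReal.mul_inv_cancel]
  exact (hg (2 * p)).mul (hf (2 * p))

theorem star (hf : HasMoments f P) : HasMoments (fun ω => conj (f ω)) P := fun p =>
  (hf p).star

theorem pow [IsFiniteMeasure P] (hf : HasMoments f P) (n : ℕ) :
    HasMoments (fun ω => f ω ^ n) P := by
  induction n with
  | zero => simpa using const (P := P) 1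
  | succ n ih => simpa only [pow_succ] using ih.mul hf

theorem sum {β : Type*} (s : Finset β) {f : β → Ω → ℂ} (hf : ∀ i, HasMoments (f i) P) :
    HasMoments (fun ω => ∑ i ∈ s, f i ω) P := fun p => memLp_finsetSum s fun i _ => hf i p

theorem prod [IsFiniteMeasure P] {β : Type*} (s : Finset β) {f : β → Ω → ℂ}
    (hf : ∀ i, HasMoments (f i) P) : HasMoments (fun ω => ∏ i ∈ s, f i ω) P := by
  classical
  induction s using Finset.induction_on with
  | empty => simpa using const (P := P) 1
  | insert i s hi ih =>
    simp only [Finset.prod_insert hi]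
    exact (hf i).mul ih

theorem of_real {f : Ω → ℝ} (hf : ∀ p : ℝ≥0, MemLp f p P) : HasMoments (fun ω => (f ω : ℂ)) P :=
  fun p => (hf p).ofReal

theorem of_law {f : Ω → ℝ} {v : ℝ≥0} (hf : HasLaw f (gaussianReal 0 v) P) :
    HasMoments (fun ω => (f ω : ℂ)) P := by
  refine of_real fun p => ?_
  have := memLp_id_gaussianReal (μ := 0) (v := v) p
  rw [← hf.map_eq] at this
  exact this.comp_of_map hf.aemeasurable

end HasMoments

/-! ### Moments of a complex Gaussian variable -/

/-- Gaussian integration by parts: `x` times the density is `-v` times its derivative. -/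
theorem integral_mul_gaussianReal {v : ℝ≥0} (hv : v ≠ 0) {f f' : ℝ → ℂ}
    (h : ∀ x, HasDerivAt f (f' x) x) (hf : Integrable f (gaussianReal 0 v))
    (hf' : Integrable f' (gaussianReal 0 v))
    (hxf : Integrable (fun x : ℝ => (x : ℂ) * f x) (gaussianReal 0 v)) :
    ∫ x : ℝ, (x : ℂ) * f x ∂gaussianReal 0 v = v * ∫ x, f' x ∂gaussianReal 0 v := by
  have hi {F : ℝ → ℂ} (hF : Integrable F (gaussianReal 0 v)) :
      Integrable (fun x => F x * (gaussianPDFReal 0 v x : ℂ)) := by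
    rw [gaussianReal_of_var_ne_zero _ hv, integrable_withDensity_iff_integrable_smul'
      (measurable_gaussianPDF 0 v) (by simp [gaussianPDF])] at hF
    refine hF.congr (ae_of_all _ fun x => ?_)
    simp [toReal_gaussianPDF, mul_comm]
  have hd (x : ℝ) : HasDerivAt (fun x => (gaussianPDFReal 0 v x : ℂ))
      (((-(x / v) * gaussianPDFReal 0 v x : ℝ)) : ℂ) x := by
    refine HasDerivAt.ofReal_comp ?_
    have h1 := (((((hasDerivAt_id x).sub_const 0).pow 2).neg.div_const (2 * (v : ℝ))).exp).const_mul
      (√(2 * Real.pi * v))⁻¹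
    rw [gaussianPDFReal_def]
    refine h1.congr_deriv ?_
    have : (v : ℝ) ≠ 0 := by exact_mod_cast hv
    simp
    field_simp
  have key := integral_mul_deriv_eq_deriv_mul_of_integrable (u := f) (u' := f')
    (v := fun x => (gaussianPDFReal 0 v x : ℂ))
    (v' := fun x => (((-(x / v) * gaussianPDFReal 0 v x : ℝ)) : ℂ))
    (fun x _ => h x) (fun x _ => hd x) (by
      refine ((hi hxf).const_mul (-(v : ℂ)⁻¹)).congr (ae_of_all _ fun x => ?_)
      simp
      ring) (hi hf') (hi hf)
  rw [integral_gaussianReal_eq_integral_smul hv, integral_gaussianReal_eq_integral_smul hv]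
  simp only [Complex.real_smul]
  have hv' : (v : ℂ) ≠ 0 := by exact_mod_cast hv
  rw [integral_congr_ae (g := fun x => -(v : ℂ) *
    (f x * (((-(x / v) * gaussianPDFReal 0 v x : ℝ)) : ℂ))) (ae_of_all _ fun x => ?_),
    integral_const_mul, key, neg_mul_neg]
  · simp only [mul_comm]
  · simp only [Complex.ofReal_mul, Complex.ofReal_neg, Complex.ofReal_div]
    field_simp

/-- The law of the real and imaginary parts of a circular complex Gaussian variable. -/
def gaussianPair (v : ℝ≥0) : Measure (ℝ × ℝ) := (gaussianReal 0 v).prod (gaussianReal 0 v)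

instance (v : ℝ≥0) : IsProbabilityMeasure (gaussianPair v) := by
  unfold gaussianPair; infer_instance

theorem hasMoments_fst (v : ℝ≥0) : HasMoments (fun w : ℝ × ℝ => (w.1 : ℂ)) (gaussianPair v) :=
  HasMoments.of_law ⟨by fun_prop, by rw [gaussianPair]; exact Measure.fst_prod⟩

theorem hasMoments_snd (v : ℝ≥0) : HasMoments (fun w : ℝ × ℝ => (w.2 : ℂ)) (gaussianPair v) :=
  HasMoments.of_law ⟨by fun_prop, by rw [gaussianPair]; exact Measure.snd_prod⟩

theorem integral_fst_mul {v : ℝ≥0} (hv : v ≠ 0) {G G' : ℝ × ℝ → ℂ}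
    (h : ∀ x y, HasDerivAt (fun x => G (x, y)) (G' (x, y)) x)
    (hG : HasMoments G (gaussianPair v)) (hG' : HasMoments G' (gaussianPair v)) :
    ∫ w, (w.1 : ℂ) * G w ∂gaussianPair v = v * ∫ w, G' w ∂gaussianPair v := by
  have hi := ((hasMoments_fst v).mul hG).integrable
  rw [gaussianPair] at *
  rw [integral_prod_symm _ hi, integral_prod_symm _ hG'.integrable, ← integral_const_mul]
  refine integral_congr_ae ?_
  filter_upwards [hi.prod_left_ae, hG.integrable.prod_left_ae, hG'.integrable.prod_left_ae]
    with y h1 h2 h3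
  exact integral_mul_gaussianReal hv (fun x => h x y) h2 h3 h1

theorem integral_snd_mul {v : ℝ≥0} (hv : v ≠ 0) {G G' : ℝ × ℝ → ℂ}
    (h : ∀ x y, HasDerivAt (fun y => G (x, y)) (G' (x, y)) y)
    (hG : HasMoments G (gaussianPair v)) (hG' : HasMoments G' (gaussianPair v)) :
    ∫ w, (w.2 : ℂ) * G w ∂gaussianPair v = v * ∫ w, G' w ∂gaussianPair v := by
  have hi := ((hasMoments_snd v).mul hG).integrable
  rw [gaussianPair] at *
  rw [integral_prod _ hi, integral_prod _ hG'.integrable, ← integral_const_mul]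
  refine integral_congr_ae ?_
  filter_upwards [hi.prod_right_ae, hG.integrable.prod_right_ae, hG'.integrable.prod_right_ae]
    with x h1 h2 h3
  exact integral_mul_gaussianReal hv (fun y => h x y) h2 h3 h1

/-- The complex number with given real and imaginary part. -/
def pairToComplex (w : ℝ × ℝ) : ℂ := w.1 + w.2 * Complex.I

theorem hasMoments_pairToComplex (v : ℝ≥0) : HasMoments pairToComplex (gaussianPair v) :=
  (hasMoments_fst v).add ((hasMoments_snd v).mul (.const _))

/-- The monomial `z̄ᵃ zᵇ`. -/
def mono (a b : ℕ) (w : ℝ × ℝ) : ℂ := conj (pairToComplex w) ^ a * pairToComplex w ^ b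

theorem hasMoments_mono (v : ℝ≥0) (a b : ℕ) : HasMoments (mono a b) (gaussianPair v) :=
  ((hasMoments_pairToComplex v).star.pow a).mul ((hasMoments_pairToComplex v).pow b)

/-- The truncated exponents `a - 1` and `b - 1` are harmless: at `0` the factor in front vanishes.
-/
theorem integral_fst_mul_mono {v : ℝ≥0} (hv : v ≠ 0) (a b : ℕ) :
    ∫ w, (w.1 : ℂ) * mono a b w ∂gaussianPair v =
      v * (a * ∫ w, mono (a - 1) b w ∂gaussianPair v +
        b * ∫ w, mono a (b - 1) w ∂gaussianPair v) := by
  have h1 := ((HasMoments.const (a : ℂ)).mul (hasMoments_mono v (a - 1) b))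
  have h2 := ((HasMoments.const (b : ℂ)).mul (hasMoments_mono v a (b - 1)))
  rw [← integral_const_mul, ← integral_const_mul, ← integral_add h1.integrable h2.integrable]
  refine integral_fst_mul hv (fun x y => ?_) (hasMoments_mono v a b) (h1.add h2)
  have e1 : HasDerivAt (fun x : ℝ => pairToComplex (x, y)) 1 x :=
    (HasDerivAt.ofReal_comp (f := fun x : ℝ => x) (hasDerivAt_id x)).add_const
      ((y : ℂ) * Complex.I)
  have e2 : HasDerivAt (fun x : ℝ => conj (pairToComplex (x, y))) 1 x := by
    simpa using e1.star
  refine ((e2.pow a).mul (e1.pow b)).congr_deriv ?_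
  simp [mono]
  ring

theorem integral_snd_mul_mono {v : ℝ≥0} (hv : v ≠ 0) (a b : ℕ) :
    ∫ w, (w.2 : ℂ) * mono a b w ∂gaussianPair v =
      v * (-Complex.I * a * ∫ w, mono (a - 1) b w ∂gaussianPair v +
        Complex.I * b * ∫ w, mono a (b - 1) w ∂gaussianPair v) := by
  have h1 := ((HasMoments.const (-Complex.I * a : ℂ)).mul (hasMoments_mono v (a - 1) b))
  have h2 := ((HasMoments.const (Complex.I * b : ℂ)).mul (hasMoments_mono v a (b - 1)))
  rw [← integral_const_mul, ← integral_const_mul, ← integral_add h1.integrable h2.integrable]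
  refine integral_snd_mul hv (fun x y => ?_) (hasMoments_mono v a b) (h1.add h2)
  have e1 : HasDerivAt (fun y : ℝ => pairToComplex (x, y)) Complex.I y := by
    have := ((HasDerivAt.ofReal_comp (f := fun x : ℝ => x) (hasDerivAt_id y)).mul_const
      Complex.I).const_add (x : ℂ)
    rwa [Complex.ofReal_one, one_mul] at this
  have e2 : HasDerivAt (fun y : ℝ => conj (pairToComplex (x, y))) (-Complex.I) y := by
    simpa using e1.star
  refine ((e2.pow a).mul (e1.pow b)).congr_deriv ?_
  simp [mono]
  ring

/-- The factor `z̄ = x - i y` acts under the integral as `v (∂ₓ - i ∂ᵧ)`, which annihilates powers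
of `z̄` and doubles the derivative in `z`. -/
theorem integral_mono_succ_left {v : ℝ≥0} (hv : v ≠ 0) (a b : ℕ) :
    ∫ w, mono (a + 1) b w ∂gaussianPair v =
      2 * v * b * ∫ w, mono a (b - 1) w ∂gaussianPair v := by
  have h1 := (hasMoments_fst v).mul (hasMoments_mono v a b)
  have h2 := (HasMoments.const (-Complex.I)).mul ((hasMoments_snd v).mul (hasMoments_mono v a b))
  rw [integral_congr_ae (g := fun w => (w.1 : ℂ) * mono a b w +
    -Complex.I * ((w.2 : ℂ) * mono a b w)) (ae_of_all _ fun w => ?_),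
    integral_add h1.integrable h2.integrable, integral_const_mul, integral_fst_mul_mono hv,
    integral_snd_mul_mono hv]
  · linear_combination (v * (a * ∫ w, mono (a - 1) b w ∂gaussianPair v) -
      v * (b * ∫ w, mono a (b - 1) w ∂gaussianPair v)) * Complex.I_mul_I
  · simp [mono, pairToComplex]
    ring

/-- The factor `z` acts as `v (∂ₓ + i ∂ᵧ)`, which annihilates the holomorphic monomial. -/
theorem integral_mono_zero_succ {v : ℝ≥0} (hv : v ≠ 0) (b : ℕ) :
    ∫ w, mono 0 (b + 1) w ∂gaussianPair v = 0 := by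
  have h1 := (hasMoments_fst v).mul (hasMoments_mono v 0 b)
  have h2 := (HasMoments.const Complex.I).mul ((hasMoments_snd v).mul (hasMoments_mono v 0 b))
  rw [integral_congr_ae (g := fun w => (w.1 : ℂ) * mono 0 b w +
    Complex.I * ((w.2 : ℂ) * mono 0 b w)) (ae_of_all _ fun w => ?_),
    integral_add h1.integrable h2.integrable, integral_const_mul, integral_fst_mul_mono hv,
    integral_snd_mul_mono hv]
  · push_cast
    linear_combination v * (b * ∫ w, mono 0 (b - 1) w ∂gaussianPair v) * Complex.I_mul_I
  · simp [mono, pairToComplex]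
    ring

theorem integral_mono {v : ℝ≥0} (hv : v ≠ 0) (a b : ℕ) :
    ∫ w, mono a b w ∂gaussianPair v = if a = b then (2 * v) ^ a * (a.factorial : ℂ) else 0 := by
  induction a generalizing b with
  | zero =>
    cases b with
    | zero => simp [mono]
    | succ b => simp [integral_mono_zero_succ hv]
  | succ a ih =>
    rw [integral_mono_succ_left hv, ih]
    cases b with
    | zero => simp
    | succ b =>
      simp only [add_tsub_cancel_right, add_left_inj]
      split_ifs with h
      · subst h
        push_cast [Nat.factorial_succ]
        ring
      · simp

end Moments

/-! ### The Wick formula -/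

section Wick

theorem map_pi_gaussianPair {E : Type*} [Fintype E] (v : ℝ≥0) :
    (Measure.pi fun _ : E => gaussianPair v).map
      (fun w (p : E × Bool) => if p.2 then (w p.1).1 else (w p.1).2) =
    Measure.pi fun _ : E × Bool => gaussianReal 0 v := by
  have hm : Measurable fun (w : E → ℝ × ℝ) (p : E × Bool) =>
      if p.2 then (w p.1).1 else (w p.1).2 := by
    refine measurable_pi_lambda _ fun p => ?_
    split_ifs <;> fun_prop
  refine (Measure.pi_eq fun s hs => ?_).symm
  rw [Measure.map_apply hm (.univ_pi hs)]
  have : (fun (w : E → ℝ × ℝ) (p : E × Bool) => if p.2 then (w p.1).1 else (w p.1).2) ⁻¹'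
      Set.univ.pi s = Set.univ.pi fun e => s (e, true) ×ˢ s (e, false) := by
    ext w
    simp only [Set.mem_preimage, Set.mem_univ_pi, Prod.forall, Bool.forall_bool, Set.mem_prod]
    simp [and_comm]
  rw [this, Measure.pi_pi, Fintype.prod_prod_type]
  simp [gaussianPair]

/-- The joint law of all entries of a complex Gaussian matrix. -/
theorem IsComplexGaussian.hasLaw {N : ℕ} {Ω : Type*} [MeasurableSpace Ω] {P : Measure Ω}
    {X : Ω → Matrix (Fin N) (Fin N) ℂ} (hX : IsComplexGaussian X P) :
    HasLaw (fun ω (e : Fin N × Fin N) => ((X ω e.1 e.2).re, (X ω e.1 e.2).im))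
      (Measure.pi fun _ => gaussianPair (1 / (2 * (N : ℝ≥0)))) P := by
  have h1 := hX.indep.hasLaw_pi (μ := fun _ => gaussianReal 0 (1 / (2 * (N : ℝ≥0)))) fun p => by
    rcases p with ⟨e, b⟩
    cases b
    · exact hX.law_im e.1 e.2
    · exact hX.law_re e.1 e.2
  have hT : Measurable fun (u : (Fin N × Fin N) × Bool → ℝ) (e : Fin N × Fin N) =>
    (u (e, true), u (e, false)) := by fun_prop
  have h2 : HasLaw (fun (u : (Fin N × Fin N) × Bool → ℝ) (e : Fin N × Fin N) =>
      (u (e, true), u (e, false))) (Measure.pi fun _ => gaussianPair (1 / (2 * (N : ℝ≥0))))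
      (Measure.pi fun _ => gaussianReal 0 (1 / (2 * (N : ℝ≥0)))) := by
    refine ⟨hT.aemeasurable, ?_⟩
    rw [← map_pi_gaussianPair, Measure.map_map hT]
    · convert Measure.map_id
      ext <;> simp
    · refine measurable_pi_lambda _ fun p => ?_
      split_ifs <;> fun_prop
  exact (h2.comp h1)

theorem IsComplexGaussian.integral_prod_mono {N : ℕ} {Ω : Type*} [MeasurableSpace Ω]
    {P : Measure Ω} {X : Ω → Matrix (Fin N) (Fin N) ℂ} (hX : IsComplexGaussian X P) (hN : N ≠ 0)
    (a b : Fin N × Fin N → ℕ) :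
    ∫ ω, ∏ e : Fin N × Fin N, (conj (X ω e.1 e.2) ^ a e * X ω e.1 e.2 ^ b e) ∂P =
      ∏ e, if a e = b e then (1 / (N : ℂ)) ^ a e * ((a e).factorial : ℂ) else 0 := by
  have hv : 1 / (2 * (N : ℝ≥0)) ≠ 0 := by simpa using hN
  -- Real and imaginary parts have variance `1 / (2 N)`, so each pair of conjugate entries
  -- contributes `1 / N`.
  have h2 : 2 * ((1 / (2 * (N : ℝ≥0)) : ℝ≥0) : ℂ) = 1 / (N : ℂ) := by
    push_cast
    field_simp
  have := hX.hasLaw.integral_comp (f := fun w => ∏ e, mono (a e) (b e) (w e)) (by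
    refine Continuous.aestronglyMeasurable ?_
    unfold mono pairToComplex
    fun_prop)
  rw [integral_fintype_prod_eq_prod] at this
  simp only [integral_mono hv, h2] at this
  rw [← this]
  have hz (z : ℂ) : pairToComplex (z.re, z.im) = z := Complex.re_add_im z
  simp only [mono, Function.comp_apply, hz]

variable {α E : Type*} [Fintype α] [DecidableEq E]

theorem prod_comp_eq_prod_pow [Fintype E] (c : α → E) (z : E → ℂ) :
    ∏ k, z (c k) = ∏ e, z e ^ Fintype.card {k // c k = e} := by
  rw [← Finset.prod_fiberwise' Finset.univ c z]
  refine Finset.prod_congr rfl fun e _ => ?_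
  rw [Finset.prod_const, Fintype.card_subtype]

variable [DecidableEq α]

/-- If the fibres of `c` and `f` have equal sizes, the solutions form a coset of the stabilizer of
`f`, whose order is a product of factorials; otherwise there is no solution. -/
theorem card_perm_comp_eq [Fintype E] (c f : α → E) :
    (Fintype.card {σ : Equiv.Perm α // c ∘ σ = f} : ℂ) =
      ∏ e, if Fintype.card {k // c k = e} = Fintype.card {k // f k = e} then
        ((Fintype.card {k // c k = e}).factorial : ℂ) else 0 := by
  by_cases h : ∀ e, Fintype.card {k // c k = e} = Fintype.card {k // f k = e}
  · simp only [h, if_true]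
    let σ₀ : Equiv.Perm α := Equiv.ofFiberEquiv fun e => Fintype.equivOfCardEq (h e).symm
    have h0 : c ∘ σ₀ = f := funext fun k => Equiv.ofFiberEquiv_map _ k
    rw [← Nat.cast_prod, ← DomMulAct.stabilizer_card]
    congr 1
    refine Fintype.card_congr (Equiv.subtypeEquiv (Equiv.mulLeft σ₀⁻¹) fun σ => ?_)
    have : f ∘ (Equiv.mulLeft σ₀⁻¹ σ) = c ∘ σ := by
      rw [← h0]
      ext k
      simp
    rw [this]
  · push Not at h
    obtain ⟨e, he⟩ := h
    rw [Finset.prod_eq_zero (Finset.mem_univ e) (if_neg he), Nat.cast_eq_zero,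
      Fintype.card_eq_zero_iff]
    refine ⟨fun ⟨σ, hσ⟩ => he ?_⟩
    refine (Fintype.card_congr (Equiv.subtypeEquiv σ fun k => ?_)).symm
    rw [← hσ]
    rfl

-- Wick's formula: the factorial in the moments of a single entry counts the ways to match its
-- conjugated occurrences with the others, so the product over entries counts matchings `σ`.
omit [DecidableEq α] in
theorem IsComplexGaussian.integral_prod {N : ℕ} {Ω : Type*} [MeasurableSpace Ω]
    {P : Measure Ω} {X : Ω → Matrix (Fin N) (Fin N) ℂ} (hX : IsComplexGaussian X P) (hN : N ≠ 0)
    (c f : α → Fin N × Fin N) :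
    ∫ ω, ∏ k, (conj (X ω (c k).1 (c k).2) * X ω (f k).1 (f k).2) ∂P =
      (1 / (N : ℂ)) ^ Fintype.card α * Nat.card {σ : Equiv.Perm α // c ∘ σ = f} := by
  classical
  have h1 (ω : Ω) : ∏ k, (conj (X ω (c k).1 (c k).2) * X ω (f k).1 (f k).2) =
      ∏ e : Fin N × Fin N, (conj (X ω e.1 e.2) ^ Fintype.card {k // c k = e} *
        X ω e.1 e.2 ^ Fintype.card {k // f k = e}) := by
    rw [Finset.prod_mul_distrib, Finset.prod_mul_distrib,
      prod_comp_eq_prod_pow c fun e => conj (X ω e.1 e.2), prod_comp_eq_prod_pow f fun e => X ω e.1 e.2]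
  simp only [h1]
  have h2 : Fintype.card α = ∑ e, Fintype.card {k // c k = e} := by
    rw [← Fintype.card_sigma]
    exact Fintype.card_congr (Equiv.sigmaFiberEquiv c).symm
  rw [hX.integral_prod_mono hN, Nat.card_eq_fintype_card, card_perm_comp_eq, h2, ← Finset.prod_pow_eq_pow_sum,
    ← Finset.prod_mul_distrib]
  simp only [mul_ite, mul_zero]

end Wick

/-! ### Second cumulants -/

section Cumulant

variable {Ω : Type*} [MeasurableSpace Ω] {P : Measure Ω}

theorem k₂_sum {T S : Type*} [Fintype T] [Fintype S] (w : T → ℂ) (w' : S → ℂ) {Y : T → Ω → ℂ}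
    {Z : S → Ω → ℂ} (hY : ∀ t, HasMoments (Y t) P) (hZ : ∀ s, HasMoments (Z s) P)
    [IsFiniteMeasure P] :
    k₂ P (fun ω => ∑ t, w t * Y t ω) (fun ω => ∑ s, w' s * Z s ω) =
      ∑ t, ∑ s, w t * w' s * k₂ P (Y t) (Z s) := by
  have h1 : ∫ ω, ∑ t, w t * Y t ω ∂P = ∑ t, w t * ∫ ω, Y t ω ∂P := by
    rw [integral_finsetSum _ fun t _ => (hY t).integrable.const_mul _]
    simp only [integral_const_mul]
  have h2 : ∫ ω, ∑ s, w' s * Z s ω ∂P = ∑ s, w' s * ∫ ω, Z s ω ∂P := by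
    rw [integral_finsetSum _ fun t _ => (hZ t).integrable.const_mul _]
    simp only [integral_const_mul]
  have h3 : ∫ ω, (∑ t, w t * Y t ω) * (∑ s, w' s * Z s ω) ∂P =
      ∑ t, ∑ s, w t * w' s * ∫ ω, Y t ω * Z s ω ∂P := by
    have h (ω : Ω) : (∑ t, w t * Y t ω) * (∑ s, w' s * Z s ω) =
        ∑ t, ∑ s, w t * w' s * (Y t ω * Z s ω) := by
      rw [Finset.sum_mul_sum]
      exact Finset.sum_congr rfl fun t _ => Finset.sum_congr rfl fun s _ => by ring
    simp only [h]
    have hi (t : T) (s : S) : Integrable (fun ω => w t * w' s * (Y t ω * Z s ω)) P :=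
      ((hY t).mul (hZ s)).integrable.const_mul _
    rw [integral_finsetSum _ fun t _ => integrable_finsetSum _ fun s _ => hi t s]
    refine Finset.sum_congr rfl fun t _ => ?_
    rw [integral_finsetSum _ fun s _ => hi t s]
    simp only [integral_const_mul]
  rw [k₂, h1, h2, h3, Finset.sum_mul_sum, ← Finset.sum_sub_distrib]
  refine Finset.sum_congr rfl fun t _ => ?_
  rw [← Finset.sum_sub_distrib]
  refine Finset.sum_congr rfl fun s _ => ?_
  rw [k₂]
  ring

theorem k₂_const_left [IsProbabilityMeasure P] (c : ℂ) (Z : Ω → ℂ) : k₂ P (fun _ => c) Z = 0 := by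
  simp [k₂, integral_const_mul]

theorem k₂_const_right [IsProbabilityMeasure P] (c : ℂ) (Y : Ω → ℂ) : k₂ P Y (fun _ => c) = 0 := by
  simp [k₂, integral_mul_const]

theorem IsComplexGaussian.hasMoments {N : ℕ} {X : Ω → Matrix (Fin N) (Fin N) ℂ}
    (hX : IsComplexGaussian X P) (i j : Fin N) : HasMoments (fun ω => X ω i j) P := by
  have := hX.indep.isProbabilityMeasure
  have h := (HasMoments.of_law (hX.law_re i j)).add
    ((HasMoments.of_law (hX.law_im i j)).mul (.const Complex.I))
  simpa only [Complex.re_add_im] using h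

variable {A B : Type*}

/-- Some point of the first component is mapped to the second one. -/
def ConnectsSum (σ : Equiv.Perm (A ⊕ B)) : Prop := ∃ i j, σ (Sum.inl i) = Sum.inr j

/-- By finiteness, a permutation that maps the first component into itself also preserves the
second, hence is a pair of permutations. -/
theorem card_not_connectsSum [Finite A] [Finite B] {E : Type*} (c f : A → E) (c' f' : B → E) :
    Nat.card {σ : Equiv.Perm (A ⊕ B) // ¬ ConnectsSum σ ∧ Sum.elim c c' ∘ σ = Sum.elim f f'} =
      Nat.card {σ : Equiv.Perm A // c ∘ σ = f} * Nat.card {σ : Equiv.Perm B // c' ∘ σ = f'} := by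
  rw [← Nat.card_prod]
  let F (τ : {σ : Equiv.Perm A // c ∘ σ = f} × {σ : Equiv.Perm B // c' ∘ σ = f'}) :
      {σ : Equiv.Perm (A ⊕ B) // ¬ ConnectsSum σ ∧ Sum.elim c c' ∘ σ = Sum.elim f f'} :=
    ⟨Equiv.sumCongr τ.1.1 τ.2.1, by
      rintro ⟨i, j, h⟩
      simp at h, by
      ext (i | j)
      · exact congrFun τ.1.2 i
      · exact congrFun τ.2.2 j⟩
  refine (Nat.card_congr (Equiv.ofBijective F ⟨?_, ?_⟩)).symm
  · rintro ⟨⟨σ, _⟩, τ, _⟩ ⟨⟨σ', _⟩, τ', _⟩ h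
    have := Equiv.Perm.sumCongrHom_injective (a₁ := (σ, τ)) (a₂ := (σ', τ')) (congrArg Subtype.val h)
    simp only [Prod.mk.injEq] at this
    simp [this.1, this.2]
  · rintro ⟨σ, h1, h2⟩
    obtain ⟨⟨τ, τ'⟩, rfl⟩ := Equiv.Perm.mem_sumCongrHom_range_of_perm_mapsTo_inl (σ := σ) (by
      rintro _ ⟨i, rfl⟩
      rcases h : σ (Sum.inl i) with i' | j
      · exact ⟨i', rfl⟩
      · exact absurd ⟨i, j, h⟩ h1)
    refine ⟨⟨⟨τ, ?_⟩, τ', ?_⟩, rfl⟩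
    · exact funext fun i => congrFun h2 (Sum.inl i)
    · exact funext fun i => congrFun h2 (Sum.inr i)

variable [Fintype A] [Fintype B] [DecidableEq A] [DecidableEq B]

-- The matchings that preserve both components are exactly what the product of the expectations
-- counts.
open Classical in
theorem IsComplexGaussian.k₂_prod {N : ℕ} {X : Ω → Matrix (Fin N) (Fin N) ℂ}
    (hX : IsComplexGaussian X P) (hN : N ≠ 0) (c f : A → Fin N × Fin N) (c' f' : B → Fin N × Fin N) :
    k₂ P (fun ω => ∏ k, (conj (X ω (c k).1 (c k).2) * X ω (f k).1 (f k).2))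
        (fun ω => ∏ k, (conj (X ω (c' k).1 (c' k).2) * X ω (f' k).1 (f' k).2)) =
      (1 / (N : ℂ)) ^ (Fintype.card A + Fintype.card B) *
        ∑ σ : Equiv.Perm (A ⊕ B) with ConnectsSum σ,
          if Sum.elim c c' ∘ σ = Sum.elim f f' then 1 else 0 := by
  have h := hX.integral_prod hN (Sum.elim c c') (Sum.elim f f')
  simp only [Fintype.prod_sum_type, Sum.elim_inl, Sum.elim_inr, Fintype.card_sum] at h
  rw [k₂, h, hX.integral_prod hN, hX.integral_prod hN, pow_add, mul_mul_mul_comm, ← mul_sub]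
  congr 1
  rw [← Nat.cast_mul, ← card_not_connectsSum, Finset.sum_boole, Finset.filter_filter,
    sub_eq_iff_eq_add, ← Nat.cast_add, Nat.card_eq_fintype_card, Nat.card_eq_fintype_card,
    Fintype.card_subtype, Fintype.card_subtype, Nat.cast_inj, ← Finset.card_union_of_disjoint]
  · congr 1
    ext σ
    simp only [Finset.mem_filter_univ, Finset.mem_union]
    tauto
  · rw [Finset.disjoint_left]
    intro σ h1 h2
    rw [Finset.mem_filter_univ] at h1 h2
    exact h2.1 h1.1

variable {N : ℕ}

/-- `∑ ∏ₖ Wₖ(pₖ, qₖ) x̄(pₖ, eₖ) x(qₖ, e_{γ k})`, the sum over all `p`, `q`, `e`. -/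
def cyclicSum (γ : Equiv.Perm A) (W : A → Matrix (Fin N) (Fin N) ℂ)
    (x : Matrix (Fin N) (Fin N) ℂ) : ℂ :=
  ∑ t : (A → Fin N) × (A → Fin N) × (A → Fin N), (∏ k, W k (t.1 k) (t.2.1 k)) *
    ∏ k, (conj (x (t.1 k) (t.2.2 k)) * x (t.2.1 k) (t.2.2 (γ k)))

omit [DecidableEq A] in
theorem IsComplexGaussian.hasMoments_prod {X : Ω → Matrix (Fin N) (Fin N) ℂ}
    (hX : IsComplexGaussian X P) (γ : Equiv.Perm A)
    (t : (A → Fin N) × (A → Fin N) × (A → Fin N)) :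
    HasMoments (fun ω => ∏ k, (conj (X ω (t.1 k) (t.2.2 k)) * X ω (t.2.1 k) (t.2.2 (γ k)))) P := by
  have := hX.indep.isProbabilityMeasure
  exact HasMoments.prod _ fun k => (hX.hasMoments _ _).star.mul (hX.hasMoments _ _)

-- The condition on row indices determines `q` as `p ∘ σ`, and the condition on the column indices
-- `e` is independent of `p`; the sum factorizes.
open Classical in
theorem sum_triples_eq (σ δ : Equiv.Perm A) (V : A → Matrix (Fin N) (Fin N) ℂ) :
    ∑ y : (A → Fin N) × (A → Fin N) × (A → Fin N), (∏ k, V k (y.1 k) (y.2.1 k)) *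
        ((if y.1 ∘ σ = y.2.1 then 1 else 0) * (if y.2.2 ∘ δ = y.2.2 ∘ σ then 1 else 0)) =
      (∑ p : A → Fin N, ∏ k, V k (p k) (p (σ k))) * Nat.card {e : A → Fin N // e ∘ δ = e ∘ σ} := by
  rw [Nat.card_eq_fintype_card, Fintype.card_subtype, ← Finset.sum_boole, Fintype.sum_prod_type,
    Finset.sum_mul]
  refine Finset.sum_congr rfl fun p _ => ?_
  rw [Fintype.sum_prod_type, Finset.sum_eq_single (p ∘ σ)]
  · simp only [if_true, one_mul, Finset.mul_sum, Function.comp_apply]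
  · intro q _ hq
    simp [hq.symm]
  · simp

omit [Fintype A] [Fintype B] [DecidableEq A] [DecidableEq B] in
theorem elim_comp_eq_iff {E E' : Type*} (σ : Equiv.Perm (A ⊕ B)) (γ : Equiv.Perm A)
    (γ' : Equiv.Perm B) (p q : A → E) (e : A → E') (p' q' : B → E) (e' : B → E') :
    Sum.elim (fun k => (p k, e k)) (fun k => (p' k, e' k)) ∘ σ =
        Sum.elim (fun k => (q k, e (γ k))) (fun k => (q' k, e' (γ' k))) ↔
      Sum.elim p p' ∘ σ = Sum.elim q q' ∧
        Sum.elim e e' ∘ Equiv.sumCongr γ γ' = Sum.elim e e' ∘ σ := by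
  simp only [funext_iff, ← forall_and]
  refine forall_congr' fun k => ?_
  rw [eq_comm (b := (Sum.elim e e' ∘ σ) k), Function.comp_apply]
  rcases h : σ k with i | i <;> rcases k with k | k <;> simp [h]

open Classical in
theorem IsComplexGaussian.k₂_cyclicSum {X : Ω → Matrix (Fin N) (Fin N) ℂ}
    (hX : IsComplexGaussian X P) (hN : N ≠ 0) (γ : Equiv.Perm A) (γ' : Equiv.Perm B)
    (W : A → Matrix (Fin N) (Fin N) ℂ) (W' : B → Matrix (Fin N) (Fin N) ℂ) :
    k₂ P (fun ω => cyclicSum γ W (X ω)) (fun ω => cyclicSum γ' W' (X ω)) =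
      ∑ σ : Equiv.Perm (A ⊕ B) with ConnectsSum σ,
        (1 / (N : ℂ)) ^ (Fintype.card A + Fintype.card B) *
        ((∑ p : A ⊕ B → Fin N, ∏ k, Sum.elim W W' k (p k) (p (σ k))) *
          Nat.card {e : A ⊕ B → Fin N // e ∘ Equiv.sumCongr γ γ' = e ∘ σ}) := by
  have := hX.indep.isProbabilityMeasure
  unfold cyclicSum
  rw [k₂_sum _ _ (hX.hasMoments_prod γ) (hX.hasMoments_prod γ')]
  have hk (t : (A → Fin N) × (A → Fin N) × (A → Fin N))
      (s : (B → Fin N) × (B → Fin N) × (B → Fin N)) :=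
    hX.k₂_prod hN (fun k => (t.1 k, t.2.2 k)) (fun k => (t.2.1 k, t.2.2 (γ k)))
      (fun k => (s.1 k, s.2.2 k)) (fun k => (s.2.1 k, s.2.2 (γ' k)))
  simp only at hk
  simp only [hk]
  rw [← Fintype.sum_prod_type']
  simp only [Finset.mul_sum]
  rw [Finset.sum_comm]
  refine Finset.sum_congr rfl fun σ _ => ?_
  -- Index families on the two components are combined into families on the disjoint union.
  let Φ : ((A → Fin N) × (A → Fin N) × (A → Fin N)) × ((B → Fin N) × (B → Fin N) × (B → Fin N)) ≃
      (A ⊕ B → Fin N) × (A ⊕ B → Fin N) × (A ⊕ B → Fin N) :=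
    { toFun := fun x => (Sum.elim x.1.1 x.2.1, Sum.elim x.1.2.1 x.2.2.1, Sum.elim x.1.2.2 x.2.2.2)
      invFun := fun y => ((y.1 ∘ Sum.inl, y.2.1 ∘ Sum.inl, y.2.2 ∘ Sum.inl),
        (y.1 ∘ Sum.inr, y.2.1 ∘ Sum.inr, y.2.2 ∘ Sum.inr))
      left_inv := fun x => rfl
      right_inv := fun y => by simp }
  rw [← sum_triples_eq, Finset.mul_sum]
  refine Fintype.sum_equiv Φ _ _ fun x => ?_
  have hΦ : Φ x = (Sum.elim x.1.1 x.2.1, Sum.elim x.1.2.1 x.2.2.1, Sum.elim x.1.2.2 x.2.2.2) := rfl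
  simp only [elim_comp_eq_iff, Fintype.prod_sum_type, ite_and, hΦ, Sum.elim_inl, Sum.elim_inr]
  split_ifs <;> ring

end Cumulant

/-! ### Index sums over permutations -/

section IndexSums

variable {α : Type*} [Fintype α]

/-- The condition says that `e ∘ σ` is constant on the cycles of `σ⁻¹ δ`, so one value is chosen
freely per cycle. -/
theorem card_comp_perm_eq {E : Type*} (σ δ : Equiv.Perm α) :
    Nat.card {e : α → E // e ∘ δ = e ∘ σ} = Nat.card E ^ numCycles (σ⁻¹ * δ) := by
  set τ := σ⁻¹ * δ with hτ
  let F (c : Quotient (Equiv.Perm.SameCycle.setoid τ) → E) : {e : α → E // e ∘ δ = e ∘ σ} :=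
    ⟨fun k => c (Quotient.mk _ (σ⁻¹ k)), funext fun k => by
      have h : τ.SameCycle (σ⁻¹ (δ k)) (σ⁻¹ (σ k)) := by
        have h1 : σ⁻¹ (δ k) = τ k := rfl
        have h2 : σ⁻¹ (σ k) = k := σ.symm_apply_apply k
        rw [h1, h2, Equiv.Perm.sameCycle_apply_left]
      exact congrArg c (Quotient.sound h)⟩
  have hF : Function.Bijective F := by
    constructor
    · intro c c' h
      funext q
      induction q using Quotient.inductionOn with
      | h k =>
        have := congrFun (congrArg Subtype.val h) (σ k)
        have h2 : σ⁻¹ (σ k) = k := σ.symm_apply_apply k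
        simpa only [F, h2] using this
    · rintro ⟨e, he⟩
      have key (k : α) : e (σ (τ k)) = e (σ k) := by
        have h1 : σ (τ k) = δ k := σ.apply_symm_apply (δ k)
        rw [h1]
        exact congrFun he k
      refine ⟨Quotient.lift (fun k => e (σ k)) fun k l h => sameCycle_apply_eq
        (r := fun k => e (σ k)) key h, ?_⟩
      refine Subtype.ext (funext fun k => ?_)
      exact congrArg e (σ.apply_symm_apply k)
  rw [← Nat.card_congr (Equiv.ofBijective F hF), Nat.card_fun, numCycles]

variable {N : ℕ}

variable (N) in
/-- The normalized trace. -/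
def normTrace : Matrix (Fin N) (Fin N) ℂ →ₗ[ℂ] ℂ :=
  (1 / (N : ℂ)) • Matrix.traceLinearMap (Fin N) ℂ ℂ

theorem normTrace_apply (M : Matrix (Fin N) (Fin N) ℂ) :
    normTrace N M = 1 / (N : ℂ) * M.trace := rfl

theorem normTrace_mul_comm (M M' : Matrix (Fin N) (Fin N) ℂ) :
    normTrace N (M * M') = normTrace N (M' * M) := by
  rw [normTrace_apply, normTrace_apply, Matrix.trace_mul_comm]

theorem normTrace_one (hN : N ≠ 0) : normTrace N 1 = 1 := by
  have : (N : ℂ) ≠ 0 := by exact_mod_cast hN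
  rw [normTrace_apply, Matrix.trace_one, Fintype.card_fin, one_div_mul_cancel this]

theorem permFunctional_id {D : Type*} [Ring D] [Algebra ℂ D] {ψ : D →ₗ[ℂ] ℂ} (a : α → D) :
    permFunctional ψ 1 a = ∏ x, ψ (a x) := by
  classical
  have hb : Function.Bijective
      (Quotient.mk (Equiv.Perm.SameCycle.setoid (1 : Equiv.Perm α))) := by
    refine ⟨fun x y h => ?_, fun c => Quotient.exists_rep c⟩
    exact (eq_of_sameCycle_of_fixed rfl (Quotient.exact h)).symm
  rw [permFunctional_eq, ← hb.prod_comp]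
  refine Finset.prod_congr rfl fun x _ => ?_
  rw [classVal, cycleVal_fixed _ rfl]
  congr 2
  exact hb.1 (Quotient.out_eq _)

variable [DecidableEq α]

/-- The sum over the index shared by `W x` and `W (σ x)` is a matrix product. The identity matrix
left at the fixed point `x` carries a free index, which is the factor `N`. -/
theorem sum_prod_swap_mul {σ : Equiv.Perm α} {x : α} (hx : σ x ≠ x)
    (W : α → Matrix (Fin N) (Fin N) ℂ) :
    ∑ p : α → Fin N, ∏ j, Function.update (Function.update W (σ x) (W x * W (σ x))) x 1 j (p j)
        (p ((Equiv.swap x (σ x) * σ) j)) =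
      N * ∑ p : α → Fin N, ∏ j, W j (p j) (p (σ j)) := by
  set k := σ x with hk
  set σ' := Equiv.swap x k * σ with hσ'
  have hσx : σ' x = x := by simp [hσ', ← hk]
  have hj (j : α) (h : j ≠ x) : σ' j ≠ x := fun e => h (σ'.injective (e.trans hσx.symm))
  have h1 (p : α → Fin N) : ∏ j, Function.update (Function.update W k (W x * W k)) x 1 j (p j)
      (p (σ' j)) = ∑ q, W x (p k) q * (W k q (p (σ' k)) *
        ∏ j ∈ (Finset.univ.erase x).erase k, W j (p j) (p (σ' j))) := by
    rw [← Finset.mul_prod_erase _ _ (Finset.mem_univ x),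
      ← Finset.mul_prod_erase _ _ (Finset.mem_erase.2 ⟨hx, Finset.mem_univ k⟩),
      Function.update_self, hσx, Matrix.one_apply_eq, one_mul, Function.update_of_ne hx,
      Function.update_self, Matrix.mul_apply, Finset.sum_mul]
    refine Finset.sum_congr rfl fun q _ => ?_
    rw [mul_assoc]
    congr 2
    refine Finset.prod_congr rfl fun j hj => ?_
    simp only [Finset.mem_erase] at hj
    rw [Function.update_of_ne hj.2.1, Function.update_of_ne hj.1]
  simp only [h1]
  have h2 : (N : ℂ) * ∑ p : α → Fin N, ∏ j, W j (p j) (p (σ j)) =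
      ∑ p : α → Fin N, ∑ _q : Fin N, ∏ j, W j (p j) (p (σ j)) := by
    simp [Finset.mul_sum]
  rw [h2, ← Fintype.sum_prod_type', ← Fintype.sum_prod_type']
  -- The index at `k` moves to `x`, the summation index of the matrix product becomes the index at
  -- `k`, and the free index at `x` is kept as the second component.
  let Φ : (α → Fin N) × Fin N ≃ (α → Fin N) × Fin N :=
    { toFun := fun y => (Function.update (y.1 ∘ Equiv.swap x k) k y.2, y.1 x)
      invFun := fun y => (Function.update (y.1 ∘ Equiv.swap x k) x y.2, y.1 k)
      left_inv := fun y => Prod.ext (funext fun j => by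
        by_cases h : j = x
        · simp [h]
        · have : Equiv.swap x k j ≠ k := fun e =>
            h ((Equiv.swap x k).injective (e.trans (Equiv.swap_apply_left x k).symm))
          simp [Function.update_of_ne h, Function.update_of_ne this]) (by simp)
      right_inv := fun y => Prod.ext (funext fun j => by
        by_cases h : j = k
        · simp [h]
        · have : Equiv.swap x k j ≠ x := fun e =>
            h ((Equiv.swap x k).injective (e.trans (Equiv.swap_apply_right x k).symm))
          simp [Function.update_of_ne h, Function.update_of_ne this]) (by simp) }
  refine Fintype.sum_equiv Φ _ _ fun y => ?_
  have e1 (j : α) (h : j ≠ k) : (Φ y).1 j = y.1 (Equiv.swap x k j) := by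
    simp [Φ, h]
  have e2 : (Φ y).1 k = y.2 := by simp [Φ]
  have e3 (j : α) (h : j ≠ x) : (Φ y).1 (σ j) = y.1 (σ' j) := by
    rw [e1 _ (fun e => h (σ.injective e))]
    rfl
  change _ = ∏ j, W j ((Φ y).1 j) ((Φ y).1 (σ j))
  rw [← Finset.mul_prod_erase _ _ (Finset.mem_univ x),
      ← Finset.mul_prod_erase _ _ (Finset.mem_erase.2 ⟨hx, Finset.mem_univ k⟩),
      e1 x hx.symm, Equiv.swap_apply_left, ← hk, e2, e3 k hx]
  congr 2
  refine Finset.prod_congr rfl fun j hj => ?_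
  simp only [Finset.mem_erase] at hj
  rw [e3 j hj.2.1, e1 j hj.1, Equiv.swap_apply_of_ne_of_ne hj.2.1 hj.1]

/-- Sums over indices of products of matrix entries, arranged along the cycles of `σ`. -/
theorem sum_prod_perm (hN : N ≠ 0) (σ : Equiv.Perm α) (W : α → Matrix (Fin N) (Fin N) ℂ) :
    ∑ p : α → Fin N, ∏ k, W k (p k) (p (σ k)) =
      (N : ℂ) ^ numCycles σ * permFunctional (normTrace N) σ W := by
  have hN' : (N : ℂ) ≠ 0 := by exact_mod_cast hN
  induction hn : σ.support.card using Nat.strong_induction_on generalizing σ W with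
  | _ n ih =>
    by_cases h : ∃ x, σ x ≠ x
    · obtain ⟨x, hx⟩ := h
      have h1 := ih _ (by
        rw [← hn]
        exact Equiv.Perm.card_support_swap_mul hx) (Equiv.swap x (σ x) * σ)
        (Function.update (Function.update W (σ x) (W x * W (σ x))) x 1) rfl
      rw [sum_prod_swap_mul hx, numCycles_swap_apply_mul hx,
        ← permFunctional_eq_swap_mul normTrace_mul_comm (normTrace_one hN) hx] at h1
      refine mul_left_cancel₀ hN' (h1.trans ?_)
      ring
    · push Not at h
      obtain rfl : σ = 1 := Equiv.ext h
      rw [numCycles_one, permFunctional_id]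
      simp only [Equiv.Perm.one_apply, normTrace_apply, Finset.prod_mul_distrib, Finset.prod_const,
        Finset.card_univ]
      rw [← mul_assoc, ← mul_pow, mul_one_div_cancel hN', one_pow, one_mul]
      simp only [Matrix.trace, Matrix.diag]
      rw [Finset.prod_univ_sum]
      simp

end IndexSums

/-! ### Traces of products of compound Wishart matrices -/

section TraceWishart

variable {N : ℕ}

/-- Sum over paths from `i` to `j`: prepending `i` gives the row indices, appending `j` the column
indices. -/
theorem prod_ofFn_apply {n : ℕ} (B : Fin (n + 1) → Matrix (Fin N) (Fin N) ℂ) (i j : Fin N) :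
    (List.ofFn B).prod i j = ∑ e : Fin n → Fin N,
      ∏ k, B k ((Fin.cons i e : Fin (n + 1) → Fin N) k) ((Fin.snoc e j : Fin (n + 1) → Fin N) k) := by
  induction n generalizing i with
  | zero => simp [Fin.snoc]
  | succ n ih =>
    rw [List.ofFn_succ, List.prod_cons, Matrix.mul_apply,
      ← (Fin.consEquiv fun _ => Fin N).sum_comp, Fintype.sum_prod_type]
    refine Finset.sum_congr rfl fun a _ => ?_
    rw [ih, Finset.mul_sum]
    refine Finset.sum_congr rfl fun e _ => ?_
    change _ = ∏ k, B k ((Fin.cons i (Fin.cons a e : Fin (n + 1) → Fin N) : Fin (n + 2) → Fin N) k)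
      ((Fin.snoc (Fin.cons a e : Fin (n + 1) → Fin N) j : Fin (n + 2) → Fin N) k)
    conv_rhs => rw [Fin.prod_univ_succ]
    simp only [Fin.cons_zero, Fin.cons_succ, ← Fin.cons_snoc_eq_snoc_cons]

theorem trace_prod_ofFn {n : ℕ} (B : Fin (n + 1) → Matrix (Fin N) (Fin N) ℂ) :
    (List.ofFn B).prod.trace = ∑ e : Fin (n + 1) → Fin N, ∏ k, B k (e k) (e (finRotate _ k)) := by
  rw [Matrix.trace, ← (Fin.consEquiv fun _ => Fin N).sum_comp, Fintype.sum_prod_type]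
  refine Finset.sum_congr rfl fun i _ => ?_
  rw [Matrix.diag, prod_ofFn_apply]
  refine Finset.sum_congr rfl fun e _ => ?_
  simp only [Fin.consEquiv_apply, Fin.snoc_eq_cons_rotate]

theorem traceWishart_zero (x : Matrix (Fin N) (Fin N) ℂ) (A : Fin 0 → Matrix (Fin N) (Fin N) ℂ) :
    traceWishart x A = N := by
  simp [traceWishart]

theorem traceWishart_succ {n : ℕ} (x : Matrix (Fin N) (Fin N) ℂ)
    (A : Fin (n + 1) → Matrix (Fin N) (Fin N) ℂ) :
    traceWishart x A = cyclicSum (finRotate (n + 1)) A x := by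
  have h (k : Fin (n + 1)) (i j : Fin N) : wishart x (A k) i j =
      ∑ p, ∑ q, A k p q * (conj (x p i) * x q j) := by
    rw [wishart, Matrix.mul_assoc, Matrix.mul_apply]
    refine Finset.sum_congr rfl fun p _ => ?_
    rw [Matrix.mul_apply, Finset.mul_sum]
    refine Finset.sum_congr rfl fun q _ => ?_
    rw [Matrix.conjTranspose_apply, starRingEnd_apply]
    ring
  rw [traceWishart, trace_prod_ofFn, cyclicSum, Fintype.sum_prod_type]
  simp only [h, Finset.prod_univ_sum, Fintype.piFinset_univ, Fintype.sum_prod_type,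
    Finset.prod_mul_distrib]
  rw [Finset.sum_comm]
  exact Finset.sum_congr rfl fun p _ => Finset.sum_comm

theorem IsComplexGaussian.hasMoments_traceWishart {Ω : Type*} [MeasurableSpace Ω] {P : Measure Ω}
    {X : Ω → Matrix (Fin N) (Fin N) ℂ} (hX : IsComplexGaussian X P) {n : ℕ}
    (A : Fin n → Matrix (Fin N) (Fin N) ℂ) : HasMoments (fun ω => traceWishart (X ω) A) P := by
  have := hX.indep.isProbabilityMeasure
  cases n with
  | zero => simpa only [traceWishart_zero] using HasMoments.const (P := P) _
  | succ n =>
    simp only [traceWishart_succ, cyclicSum]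
    exact HasMoments.sum _ fun t => (HasMoments.const _).mul (hX.hasMoments_prod _ t)

/-- The adjoint of `X⋆ A X` is `X⋆ A⋆ X`, and taking adjoints reverses products. -/
theorem conj_traceWishart {n : ℕ} (x : Matrix (Fin N) (Fin N) ℂ)
    (A : Fin n → Matrix (Fin N) (Fin N) ℂ) :
    conj (traceWishart x A) = traceWishart x fun k => (A k.rev).conjTranspose := by
  rw [traceWishart, traceWishart, starRingEnd_apply, ← Matrix.trace_conjTranspose,
    Matrix.conjTranspose_list_prod]
  have h := ofFn_star_rev fun k => wishart x (A k)
  rw [starRev] at h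
  have h2 : (fun k : Fin n => wishart x (A k.rev).conjTranspose) =
      fun k => star (wishart x (A k.rev)) := funext fun k => by
    simp [wishart, Matrix.star_eq_conjTranspose, Matrix.conjTranspose_mul, Matrix.mul_assoc]
  rw [h2, h]
  rfl

end TraceWishart

/-! ### The limit of the second cumulants -/

section Limit

theorem connectsSum_iff {n m : ℕ} (σ : Equiv.Perm (Fin n ⊕ Fin m)) :
    ConnectsSum σ ↔ ∃ i j, σ.SameCycle (Sum.inl i) (Sum.inr j) := by
  rw [← connects_annulus_iff, Connects, ConnectsSum]
  simp [innerCircle, outerCircle, eq_comm]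

theorem mem_SNC_iff {n m : ℕ} {σ : Equiv.Perm (Fin n ⊕ Fin m)} :
    σ ∈ SNC n m ↔ ConnectsSum σ ∧ geod σ (annularRotation n m) = n + m := by
  simp only [SNC, Finset.mem_filter, Finset.mem_univ, true_and, IsAnnularNC, connectsSum_iff]
  rfl

/-- The rotation has two cycles, so the general bound is `n + m + 2`; connecting them costs two. -/
theorem geod_annularRotation_le {n m : ℕ} {σ : Equiv.Perm (Fin n ⊕ Fin m)} (h : ConnectsSum σ) :
    geod σ (annularRotation n m) ≤ n + m := by
  obtain ⟨i, j, h⟩ := h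
  have h1 : ¬ (annularRotation n m).SameCycle (Sum.inl i) (σ (Sum.inl i)) := by
    rw [h, ← circles_annulus]
    intro e
    have := (mem_iff_of_sameCycle_circles (nodup_annulus n m) List.mem_cons_self e).1
      (by simp [innerCircle])
    simp [innerCircle] at this
  have h2 := geod_of_not_sameCycle h1
  rw [numCycles_annularRotation (by rintro rfl; exact i.elim0) (by rintro rfl; exact j.elim0)] at h2
  simp at h2
  omega

variable {D : Type*} [Ring D] [StarRing D] [Algebra ℂ D] [StarModule ℂ D]
  {ι : Type*} {ψ : D →ₗ[ℂ] ℂ} {d : ι → D} {A : ∀ N : ℕ, ι → Matrix (Fin N) (Fin N) ℂ}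

omit [StarRing D] [StarModule ℂ D] in
theorem ConvergesInDistribution.tendsto_permFunctional (hA : ConvergesInDistribution A ψ d)
    {α : Type*} [Fintype α] (σ : Equiv.Perm α) (i : α → ι) :
    Tendsto (fun N => permFunctional (normTrace N) σ fun k => A N (i k)) atTop
      (𝓝 (permFunctional ψ σ fun k => d (i k))) := by
  classical
  simp only [permFunctional_eq]
  refine tendsto_finsetProd _ fun c _ => ?_
  have := hA ((List.range (Function.minimalPeriod σ c.out)).map fun k => i ((σ ^ k) c.out))
  simpa only [List.map_map, classVal, cycleVal, normTrace_apply, Function.comp_def] using this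

variable {Ω : ℕ → Type*} [∀ N, MeasurableSpace (Ω N)] {P : ∀ N, Measure (Ω N)}
    {X : ∀ N : ℕ, Ω N → Matrix (Fin N) (Fin N) ℂ}

omit [StarRing D] [StarModule ℂ D] in
theorem tendsto_k₂_traceWishart (hA : ConvergesInDistribution A ψ d)
    (hX : ∀ N, IsComplexGaussian (X N) (P N)) {n m : ℕ} (i : Fin n → ι) (j : Fin m → ι) :
    Tendsto (fun N => k₂ (P N) (fun ω => traceWishart (X N ω) fun k => A N (i k))
      (fun ω => traceWishart (X N ω) fun k => A N (j k))) atTop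
      (𝓝 (∑ π ∈ SNC n m, permFunctional ψ π
        (Sum.elim (fun k => d (i k)) fun k => d (j k)))) := by
  classical
  have hP (N : ℕ) := (hX N).indep.isProbabilityMeasure
  -- For an empty word the trace is the constant `N`, so the cumulant vanishes, and there are no
  -- connecting permutations.
  rcases n with _ | n
  · have : SNC 0 m = ∅ := Finset.eq_empty_of_forall_notMem fun σ hσ => by
      obtain ⟨⟨i, _⟩, _⟩ := mem_SNC_iff.1 hσ
      exact i.elim0
    simp [this, traceWishart_zero, k₂_const_left]
  rcases m with _ | m
  · have : SNC (n + 1) 0 = ∅ := Finset.eq_empty_of_forall_notMem fun σ hσ => by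
      obtain ⟨⟨_, j, _⟩, _⟩ := mem_SNC_iff.1 hσ
      exact j.elim0
    simp [this, traceWishart_zero, k₂_const_right]
  have hs : SNC (n + 1) (m + 1) = (Finset.univ.filter ConnectsSum).filter
      fun σ => geod σ (annularRotation (n + 1) (m + 1)) = n + 1 + (m + 1) := by
    ext σ
    simp [mem_SNC_iff]
  rw [hs, Finset.sum_filter]
  have hd : (Sum.elim (fun k => d (i k)) fun k => d (j k)) = fun k => d (Sum.elim i j k) := by
    ext (k | k) <;> rfl
  have hA' (N : ℕ) : (Sum.elim (fun k => A N (i k)) fun k => A N (j k)) =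
      fun k => A N (Sum.elim i j k) := by
    ext (k | k) <;> rfl
  -- The prefactor, the row sums and the column sums carry the powers `-(n + m)`, `#(σ)` and `#(σ⁻¹
  -- γ)` of `N`; the total exponent is never positive, which makes the natural subtraction exact.
  have key : ∀ᶠ N : ℕ in atTop, ∑ σ : Equiv.Perm (Fin (n + 1) ⊕ Fin (m + 1)) with ConnectsSum σ,
      (1 / (N : ℂ)) ^ (n + 1 + (m + 1) - geod σ (annularRotation (n + 1) (m + 1))) *
        permFunctional (normTrace N) σ (fun k => A N (Sum.elim i j k)) =
      k₂ (P N) (fun ω => traceWishart (X N ω) fun k => A N (i k))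
        (fun ω => traceWishart (X N ω) fun k => A N (j k)) := by
    filter_upwards [eventually_ne_atTop 0] with N hN
    have hN' : (N : ℂ) ≠ 0 := by exact_mod_cast hN
    simp only [traceWishart_succ]
    rw [(hX N).k₂_cyclicSum hN]
    refine Finset.sum_congr (Finset.filter_congr_decidable ..) fun σ hσ => ?_
    rw [Finset.mem_filter_univ] at hσ
    rw [sum_prod_perm hN, card_comp_perm_eq, Nat.card_eq_fintype_card, Fintype.card_fin, hA',
      Fintype.card_fin, Fintype.card_fin]
    have hg := geod_annularRotation_le hσ
    obtain ⟨r, hr⟩ := Nat.exists_eq_add_of_le hg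
    have hr' : n + 1 + (m + 1) - geod σ (annularRotation (n + 1) (m + 1)) = r := by omega
    rw [hr', hr, geod, annularRotation]
    push_cast
    rw [pow_add, pow_add, one_div, inv_pow, inv_pow, inv_pow]
    field_simp
  refine Tendsto.congr' key (tendsto_finsetSum _ fun σ hσ => ?_)
  rw [Finset.mem_filter_univ] at hσ
  have hlim := hA.tendsto_permFunctional σ (Sum.elim i j)
  rw [hd]
  split_ifs with h
  · simpa [h] using hlim
  · have h0 : n + 1 + (m + 1) - geod σ (annularRotation (n + 1) (m + 1)) ≠ 0 := by
      have := geod_annularRotation_le hσ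
      omega
    have := (((tendsto_one_div_atTop_nhds_zero_nat (𝕜 := ℂ)).pow
      (n + 1 + (m + 1) - geod σ (annularRotation (n + 1) (m + 1)))).mul hlim)
    rwa [zero_pow h0, zero_mul] at this

end Limit

end CompoundWishart

end

/-! ### The main theorem -/

theorem mainTheorem3 {ι : Type*} {D : Type*} [Ring D] [StarRing D] [Algebra ℂ D] [StarModule ℂ D]
    (ψ : D →ₗ[ℂ] ℂ) (hψ : CompoundWishart.IsTracialState ψ) (d : ι → D)
    (A : ∀ N : ℕ, ι → Matrix (Fin N) (Fin N) ℂ)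
    (hA : CompoundWishart.ConvergesInDistribution A ψ d)
    {Ω : ℕ → Type*} [∀ N, MeasurableSpace (Ω N)] (P : ∀ N, Measure (Ω N))
    [∀ N, IsProbabilityMeasure (P N)] (X : ∀ N : ℕ, Ω N → Matrix (Fin N) (Fin N) ℂ)
    (hX : ∀ N, CompoundWishart.IsComplexGaussian (X N) (P N))
    (n m : ℕ) (i : Fin n → ι) (j : Fin m → ι) :
    -- the traces are square integrable, so that their second cumulants are defined
    (∀ N, MemLp (fun ω => CompoundWishart.traceWishart (X N ω) fun k => A N (i k)) 2 (P N) ∧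
      MemLp (fun ω => CompoundWishart.traceWishart (X N ω) fun k => A N (j k)) 2 (P N)) ∧
    -- the cumulant of the two traces
    Tendsto (fun N => CompoundWishart.k₂ (P N)
        (fun ω => CompoundWishart.traceWishart (X N ω) fun k => A N (i k))
        (fun ω => CompoundWishart.traceWishart (X N ω) fun k => A N (j k))) atTop
      (𝓝 (CompoundWishart.cycInner ψ
        (CompoundWishart.cyc ψ (CompoundWishart.poissonVector ψ fun k => d (i k)))
        (CompoundWishart.cyc ψ
          (CompoundWishart.poissonVector ψ fun k => star (d (j k.rev)))))) ∧
    CompoundWishart.cycInner ψ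
        (CompoundWishart.cyc ψ (CompoundWishart.poissonVector ψ fun k => d (i k)))
        (CompoundWishart.cyc ψ (CompoundWishart.poissonVector ψ fun k => star (d (j k.rev)))) =
      ∑ π ∈ CompoundWishart.SNC n m, CompoundWishart.permFunctional ψ π
        (Sum.elim (fun k => d (i k)) fun k => d (j k)) ∧
    -- the cumulant of the first trace and the complex conjugate of the second one
    (CompoundWishart.ConvergesInStarDistribution A ψ d →
      Tendsto (fun N => CompoundWishart.k₂ (P N)
          (fun ω => CompoundWishart.traceWishart (X N ω) fun k => A N (i k))
          (fun ω => conj (CompoundWishart.traceWishart (X N ω) fun k => A N (j k)))) atTop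
        (𝓝 (CompoundWishart.cycInner ψ
          (CompoundWishart.cyc ψ (CompoundWishart.poissonVector ψ fun k => d (i k)))
          (CompoundWishart.cyc ψ (CompoundWishart.poissonVector ψ fun k => d (j k)))))) ∧
    CompoundWishart.cycInner ψ
        (CompoundWishart.cyc ψ (CompoundWishart.poissonVector ψ fun k => d (i k)))
        (CompoundWishart.cyc ψ (CompoundWishart.poissonVector ψ fun k => d (j k))) =
      ∑ π ∈ CompoundWishart.SNC n m, CompoundWishart.permFunctional ψ π
        (Sum.elim (fun k => d (i k)) fun k => star (d (j k.rev))) := by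
  refine ⟨fun N => ⟨((hX N).hasMoments_traceWishart _).memLp_two,
    ((hX N).hasMoments_traceWishart _).memLp_two⟩, ?_,
    CompoundWishart.cycInner_poissonVector hψ (fun k => d (i k)) fun k => d (j k), ?_, ?_⟩
  · rw [CompoundWishart.cycInner_poissonVector hψ (fun k => d (i k)) fun k => d (j k)]
    exact CompoundWishart.tendsto_k₂_traceWishart hA hX i j
  · intro hstar
    -- Reversing and taking adjoints twice is the identity, so the inner product without adjoints is
    -- an instance of the previous one.
    have h := CompoundWishart.cycInner_poissonVector hψ (fun k => d (i k))
      fun k => star (d (j k.rev))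
    simp only [Fin.rev_rev, star_star] at h
    rw [h]
    simp only [CompoundWishart.conj_traceWishart]
    -- Convergence in `*`-distribution is convergence of the enlarged family, in which the adjoints
    -- needed for the conjugated trace are the `Sum.inr` members.
    exact CompoundWishart.tendsto_k₂_traceWishart hstar hX (fun k => Sum.inl (i k))
      fun k => Sum.inr (j k.rev)
  · simpa only [Fin.rev_rev, star_star] using
      CompoundWishart.cycInner_poissonVector hψ (fun k => d (i k)) fun k => star (d (j k.rev))
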